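/- Let $\delta>0$. For $f:\mathbb R\to\mathbb C$ put $$(Tf)(x)=\frac1{2\delta}\,\mathrm{p.v.}\!\!\int_{\mathbb R}\coth\Big(\frac{\pi(x'-x)}{2\delta}\Big)f(x')\,dx',\qquad (\tilde Tf)(x)=\frac1{2\delta}\int_{\mathbb R}\tanh\Big(\frac{\pi(x'-x)}{2\delta}\Big)f(x')\,dx',\qquad P_\pm=-\tfrac12(\mathrm iT\pm1).$$ Let $\mathcal S$ be the space of complex-valued Schwartz functions on $\mathbb R$. A solution of the non-chiral ILW equation on an interval $J\subseteq\mathbb R$ is a pair of maps $u,v:J\to\mathcal S$, $t\mapsto u(\cdot,t),v(\cdot,t)$, continuous in the Schwartz topology and differentiable in $t$ at each $x$ (relative to $J$), with $$u_t+2uu_x+Tu_{xx}+\tilde Tv_{xx}=0,\qquad v_t-2vv_x-Tv_{xx}-\tilde Tu_{xx}=0 .$$ **Theorem.** (a) For all $u,v\in\mathcal S$ there are unique sequences $W_n=W_n[u,v]$ and $Z_n=Z_n[u,v]$, $n\ge1$, in $\mathcal S$ such that, as formal power series in $\epsilon$ at every $x\in\mathbb R$, $$u=\frac{1-\exp\big(-\sum_{n\ge1}W_n\epsilon^n\big)}{\epsilon}-\mathrm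 iP_-\sum_{n\ge1}W_{n,x}\epsilon^n-\frac12\tilde T\sum_{n\ge1}Z_{n,x}\epsilon^n,$$ $$v=-\frac{1-\exp\big(\sum_{n\ge1}Z_n\epsilon^n\big)}{\epsilon}+\mathrm iP_+\sum_{n\ge1}Z_{n,x}\epsilon^n+\frac12\tilde T\sum_{n\ge1}W_{n,x}\epsilon^n .$$ They are computed recursively: $W_1=u$, $Z_1=v$ and, for $n\ge1$, $$W_{n+1}=[\epsilon^{n+1}]\exp\Big(-\sum_{m=1}^nW_m\epsilon^m\Big)+\mathrm iP_-W_{n,x}+\tfrac12\tilde TZ_{n,x},\qquad Z_{n+1}=-[\epsilon^{n+1}]\exp\Big(\sum_{m=1}^nZ_m\epsilon^m\Big)-\mathrm iP_+Z_{n,x}-\tfrac12\tilde TW_{n,x}.$$ (b) Put $I_n[u,v]=\int_{\mathbb R}(W_n[u,v]+Z_n[u,v])\,dx$. If $(u,v)$ is a solution of the non-chiral ILW equation on an interval $J$, then $I_n[u(\cdot,t),v(\cdot,t)]$, for every $n\ge1$, as well as $I_{1,u}=\int_{\mathbb R}u\,dx$ and $I_{1,v}=\int_{\mathbb R}v\,dx$,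 do not depend on $t\in J$. These are infinitely many conserved quantities: the functionals $I_n$, $n\ge1$, on $\mathcal S\times\mathcal S$ are linearly independent over $\mathbb C$. (c) For all $u,v\in\mathcal S$, with integrable integrands in $I_3$ and $I_4$, $$I_1=\int_{\mathbb R}u\,dx+\int_{\mathbb R}v\,dx,\qquad I_2=\frac12\int_{\mathbb R}(u^2-v^2)\,dx,$$ $$I_3=\int_{\mathbb R}\Big(\tfrac13(u^3+v^3)+\tfrac12\big(uTu_x+vTv_x+u\tilde Tv_x+v\tilde Tu_x\big)\Big)dx,$$ $$I_4=\int_{\mathbb R}\Big(\tfrac{u^4-v^4}4+\tfrac{u_x^2-v_x^2}8+\tfrac38\big((Tu_x)^2-(Tv_x)^2-(\tilde Tu_x)^2+(\tilde Tv_x)^2\big)+\tfrac34\big(u^2Tu_x-v^2Tv_x\big)+\tfrac34\big(u^2\tilde Tv_x-v^2\tilde Tu_x\big)\Big)dx .$$ (d) The same quantities come, up to complex conjugation, from the Lax pair, whose spatial part, in normalised form with spectral parameter $\zeta$, is $$\mathrm iM_{2,x}^-+\zeta(M_2^--M_1^+)=uM_2^-,\qquad \mathrm iM_{2,x}^++\zeta(M_2^+-M_1^-)=-vM_2^+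 .$$ Here $M_1,M_2$ are functions on the strip $0\le\operatorname{Im}z\le\delta$, $M_j^+(x)=M_j(x)$ and $M_j^-(x)=M_j(x+\mathrm i\delta)$ are their boundary values at the bottom and at the top, and $M_1,M_2\to1$ as $\operatorname{Re}z\to-\infty$. For all $u,v\in\mathcal S$ this system has a solution in formal power series $M_j=\sum_{n\ge0}M_j^{(n)}\zeta^{-n}$ whose coefficients are bounded and continuous on the closed strip, analytic inside, differentiable along the two boundary lines, and satisfy $M_j^{(0)}\to1$ and $M_j^{(n)}\to0$ $(n\ge1)$ as $\operatorname{Re}z\to-\infty$ in the strip. For every such solution there are unique formal power series $$\log\frac{M_2^-}{M_1^+}=\sum_{n\ge1}\sigma_1^{(n)}\zeta^{-n},\qquad\log\frac{M_1^-}{M_2^+}=\sum_{n\ge1}\sigma_2^{(n)}\zeta^{-n}$$ without constant term; their coefficients belong to $\mathcal S$, depend only on $(u,v)$, and satisfy $$\sigma_1^{(n)}[u,v]=\overline{W_n[\bar u,\bar v]},\qquad \sigma_2^{(n)}[u,v]=\overline{Z_n[\bar u,\bar v]},\qquad \int_{\mathbb R}\big(\sigma_1^{(n)}[u,v]+\sigma_2^{(n)}[u,v]\big)dx=\overline{I_n[\bar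 u,\bar v]} .$$ (For real-valued $u,v$ these are the complex conjugates of $W_n$, $Z_n$, $I_n$.) For a solution $(u,v)$ of the non-chiral ILW equation on an interval $J$, the integrals $\int_{\mathbb R}(\sigma_1^{(n)}+\sigma_2^{(n)})\,dx$, $n\ge1$, do not depend on $t\in J$. -/

import Mathlib

open scoped SchwartzMap

noncomputable section

namespace NcILW

/-- `(T f)(x) = (1 / 2δ) p.v. ∫ coth (π (y - x) / 2δ) f y dy`; the principal value is the limit
`ε → 0+` of the integrals over `|y - x| > ε`. -/
def T (δ : ℝ) (f : ℝ → ℂ) (x : ℝ) : ℂ :=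
  Filter.limUnder (nhdsWithin (0 : ℝ) (Set.Ioi 0)) fun ε : ℝ =>
    (1 / (2 * δ) : ℂ) * ∫ y in {y : ℝ | ε < |y - x|},
      ((Real.cosh (Real.pi / (2 * δ) * (y - x)) / Real.sinh (Real.pi / (2 * δ) * (y - x)) : ℝ) : ℂ)
        * f y

/-- `(T̃ f)(x) = (1 / 2δ) ∫ tanh (π (y - x) / 2δ) f y dy`. -/
def Tt (δ : ℝ) (f : ℝ → ℂ) (x : ℝ) : ℂ :=
  (1 / (2 * δ) : ℂ) * ∫ y : ℝ, ((Real.tanh (Real.pi / (2 * δ) * (y - x)) : ℝ) : ℂ) * f y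

/-- `P₊ = -(i T + 1) / 2`. -/
def Pplus (δ : ℝ) (f : ℝ → ℂ) (x : ℝ) : ℂ := -(1 / 2 : ℂ) * (Complex.I * T δ f x + f x)

/-- `P₋ = -(i T - 1) / 2`. -/
def Pminus (δ : ℝ) (f : ℝ → ℂ) (x : ℝ) : ℂ := -(1 / 2 : ℂ) * (Complex.I * T δ f x - f x)

/-- A (complex-valued, classical) solution of the non-chiral ILW equation
`u_t + 2 u u_x + T u_xx + T̃ v_xx = 0`, `v_t - 2 v v_x - T v_xx - T̃ u_xx = 0`
on a set `J` of times, whose values are Schwartz functions of `x` depending continuously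
on `t` in the Schwartz topology. -/
structure IsSolution (δ : ℝ) (J : Set ℝ) (u v : ℝ → 𝓢(ℝ, ℂ)) : Prop where
  continuousOn_u : ContinuousOn u J
  continuousOn_v : ContinuousOn v J
  eq_u : ∀ t ∈ J, ∀ x : ℝ, HasDerivWithinAt (fun s => u s x)
    (-(2 * u t x * deriv (u t) x) - T δ (deriv (deriv (u t))) x - Tt δ (deriv (deriv (v t))) x) J t
  eq_v : ∀ t ∈ J, ∀ x : ℝ, HasDerivWithinAt (fun s => v s x)
    (2 * v t x * deriv (v t) x + T δ (deriv (deriv (v t))) x + Tt δ (deriv (deriv (u t))) x) J t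

/-- The formal power series `∑ₙ f n X ^ n`. -/
def ser (f : ℕ → ℂ) : PowerSeries ℂ := PowerSeries.mk f

/-- The exponential of a formal power series without constant term. -/
def fexp (f : PowerSeries ℂ) : PowerSeries ℂ := (PowerSeries.exp ℂ).subst f

/-- `W = ∑_{n ≥ 1} W n ε ^ n` and `Z = ∑_{n ≥ 1} Z n ε ^ n` satisfy, as formal power series in `ε`
(at every `x`), the two relations
`u = (1 - exp (-W)) / ε - i P₋ W_x - T̃ Z_x / 2`,
`v = -(1 - exp Z) / ε + i P₊ Z_x + T̃ W_x / 2`.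
Both relations are written multiplied by `ε`, which is the variable `X`. -/
structure IsBacklundExpansion (δ : ℝ) (u v : 𝓢(ℝ, ℂ)) (W Z : ℕ → 𝓢(ℝ, ℂ)) : Prop where
  W_zero : W 0 = 0
  Z_zero : Z 0 = 0
  eq_u : ∀ x : ℝ,
    PowerSeries.X * PowerSeries.C (u x)
      = (1 - fexp (-ser fun n => W n x))
        - PowerSeries.X * (PowerSeries.C Complex.I * ser fun n => Pminus δ (deriv (W n)) x)
        - PowerSeries.X * (PowerSeries.C (1 / 2) * ser fun n => Tt δ (deriv (Z n)) x)
  eq_v : ∀ x : ℝ,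
    PowerSeries.X * PowerSeries.C (v x)
      = -(1 - fexp (ser fun n => Z n x))
        + PowerSeries.X * (PowerSeries.C Complex.I * ser fun n => Pplus δ (deriv (Z n)) x)
        + PowerSeries.X * (PowerSeries.C (1 / 2) * ser fun n => Tt δ (deriv (W n)) x)

/-- The closed strip `0 ≤ Im z ≤ δ`. -/
def strip (δ : ℝ) : Set ℂ := {z | 0 ≤ z.im ∧ z.im ≤ δ}

/-- `f` is a bounded continuous function on the closed strip `0 ≤ Im z ≤ δ`, analytic in its
interior, with differentiable boundary values and with limit `c` as `Re z → -∞`. -/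
structure IsStripFunction (δ : ℝ) (f : ℂ → ℂ) (c : ℂ) : Prop where
  continuousOn : ContinuousOn f (strip δ)
  differentiableOn : DifferentiableOn ℂ f {z | 0 < z.im ∧ z.im < δ}
  bounded : ∃ B : ℝ, ∀ z ∈ strip δ, ‖f z‖ ≤ B
  bottom_differentiable : Differentiable ℝ fun x : ℝ => f x
  top_differentiable : Differentiable ℝ fun x : ℝ => f (x + δ * Complex.I)
  tendsto : Filter.Tendsto f (Filter.comap Complex.re Filter.atBot ⊓ Filter.principal (strip δ))
    (nhds c)

/-- Formal eigenfunctions, as `ζ → ∞`, of the spatial part of the Lax pair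
`i ∂ₓ M₂⁻ + ζ (M₂⁻ - M₁⁺) = u M₂⁻`, `i ∂ₓ M₂⁺ + ζ (M₂⁺ - M₁⁻) = -v M₂⁺`,
normalised by `M₁, M₂ → 1` as `Re z → -∞`. Here `M₁`, `M₂` are formal power series
`∑ₙ Mⱼ n (z) ζ⁻ⁿ` whose coefficients are analytic in the strip `0 < Im z < δ`. On the cylinder
`ℂ / 2iδℤ`, `M₁` lives on `0 < Im z < δ` and `M₂`, shifted by `iδ`, on `δ < Im z < 2δ`; the signs
`±` denote the limits from above and from below onto the lines `Im z = 0` and `Im z = δ` of the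
cylinder, so `M₁⁺`, `M₂⁺` are boundary values at the bottom `Im z = 0` of the strip, and `M₁⁻`, `M₂⁻`
are boundary values at its top `Im z = δ`.
Both equations are written multiplied by `ζ⁻¹`, which is the variable `X`. -/
structure IsFormalEigenfunction (δ : ℝ) (u v : 𝓢(ℝ, ℂ)) (M₁ M₂ : ℕ → ℂ → ℂ) : Prop where
  strip₁ : ∀ n, IsStripFunction δ (M₁ n) (if n = 0 then 1 else 0)
  strip₂ : ∀ n, IsStripFunction δ (M₂ n) (if n = 0 then 1 else 0)
  eq_u : ∀ x : ℝ,
    PowerSeries.X * (PowerSeries.C Complex.I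
        * ser fun n => deriv (fun y : ℝ => M₂ n (y + δ * Complex.I)) x)
      + ((ser fun n => M₂ n (x + δ * Complex.I)) - ser fun n => M₁ n x)
    = PowerSeries.X * (PowerSeries.C (u x) * ser fun n => M₂ n (x + δ * Complex.I))
  eq_v : ∀ x : ℝ,
    PowerSeries.X * (PowerSeries.C Complex.I * ser fun n => deriv (fun y : ℝ => M₂ n y) x)
      + ((ser fun n => M₂ n x) - ser fun n => M₁ n (x + δ * Complex.I))
    = -(PowerSeries.X * (PowerSeries.C (v x) * ser fun n => M₂ n x))

/-- The formal power series `σ` is `log (F / G)`: it has no constant term and `exp σ * G = F`. -/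
def IsFormalLogRatio (σ F G : PowerSeries ℂ) : Prop :=
  PowerSeries.constantCoeff σ = 0 ∧ fexp σ * G = F

/-- `σ₁ = log (M₂⁻ / M₁⁺)` and `σ₂ = log (M₁⁻ / M₂⁺)`, as formal power series in `ζ⁻¹`,
at every `x`. -/
def IsLaxExpansion (δ : ℝ) (M₁ M₂ : ℕ → ℂ → ℂ) (σ₁ σ₂ : ℕ → ℝ → ℂ) : Prop :=
  ∀ x : ℝ,
    IsFormalLogRatio (ser fun n => σ₁ n x)
      (ser fun n => M₂ n (x + δ * Complex.I)) (ser fun n => M₁ n x) ∧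
    IsFormalLogRatio (ser fun n => σ₂ n x)
      (ser fun n => M₁ n (x + δ * Complex.I)) (ser fun n => M₂ n x)

/-- The complex conjugate of a Schwartz function. -/
def conjS (f : 𝓢(ℝ, ℂ)) : 𝓢(ℝ, ℂ) :=
  SchwartzMap.postcompCLM (𝕜 := ℝ) (Complex.conjCLE : ℂ →L[ℝ] ℂ) f

theorem conjS_apply (f : 𝓢(ℝ, ℂ)) (x : ℝ) : conjS f x = (starRingEnd ℂ) (f x) := rfl

/-- The density of the cubic conserved quantity `I₃`. -/
def density₃ (δ : ℝ) (u v : 𝓢(ℝ, ℂ)) (x : ℝ) : ℂ :=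
  1 / 3 * (u x ^ 3 + v x ^ 3)
    + 1 / 2 * (u x * T δ (deriv u) x + v x * T δ (deriv v) x
      + u x * Tt δ (deriv v) x + v x * Tt δ (deriv u) x)

/-- The density of the quartic conserved quantity `I₄`. -/
def density₄ (δ : ℝ) (u v : 𝓢(ℝ, ℂ)) (x : ℝ) : ℂ :=
  (u x ^ 4 - v x ^ 4) / 4 + (deriv u x ^ 2 - deriv v x ^ 2) / 8
    + 3 / 8 * (T δ (deriv u) x ^ 2 - T δ (deriv v) x ^ 2
      - Tt δ (deriv u) x ^ 2 + Tt δ (deriv v) x ^ 2)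
    + 3 / 4 * (u x ^ 2 * T δ (deriv u) x - v x ^ 2 * T δ (deriv v) x)
    + 3 / 4 * (u x ^ 2 * Tt δ (deriv v) x - v x ^ 2 * Tt δ (deriv u) x)

end NcILW

end

open NcILW

/-! The operators `T ∂ₓ` and `T̃ ∂ₓ` are Fourier multipliers with the smooth even symbols -2πξ
coth(2πδξ) and -2πξ / sinh(2πδξ). Hence they act on Schwartz functions and are symmetric for the
pairing ∫ f g. In exponential form the relations of (a) and the Lax pair of (d) become one system,
`IsSol`, with a parameter: `ι = -i` for (a) and `ι = i` for (d). Comparing coefficients turns it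
into the recursion of a logarithm (`fexp_ser_eq_iff`), where each coefficient depends only on
earlier ones, so it has exactly one solution `sol` (`isSol_iff`). The kernels are real, so complex
conjugation exchanges the two values of `ι` (`conjS_sol`) and preserves the equation
(`IsSolution.conj`). Conservation is therefore proved for `ι = i` only.

For `ι = i` the setting is a cylinder cut along two lines. `IsStripPair` encodes the two boundary
values of a function analytic in a strip by the factor e^{-2πδξ} between their Fourier transforms.
Such pairs are stable under derivatives and products, and the top and bottom values have equal
integrals, which is Cauchy's theorem. A pair of strip functions is determined by its jumps across
the two lines, and `T`, `T̃` give its derivatives explicitly (`isStripPair_lift`,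
`IsStripPair.eq_lift`). The components of `sol` are the jumps of log M₂ and log M₁.

The time part of the Lax pair, M_t = -i M_xx - 2ζ M_x + q M, suggests that ζ⁻¹ (log M)_t is the
series `gam`. Its jumps satisfy the system obtained by differentiating `IsSol` in time. That system
has only one solution (`linearised_unique`), so the jumps are the time derivatives of the
coefficients, shifted by one power of ζ⁻¹. The sum of the two jumps is the sum, over the two strip
functions, of top minus bottom; its integral vanishes (`integral_linearised_eq_zero`).

Formal eigenfunctions are exponentials of primitives of the lifted functions, and Phragmén–Lindelöf
supplies the decay needed to integrate from -∞. Their boundary values are unique by Liouville's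
theorem on the cylinder (`eq_zero_of_no_jumps`). The explicit integrals follow from expanding the
recursion modulo terms whose integral vanishes by symmetry. Independence follows from I_n[ru, 0] ~
rⁿ ∫ uⁿ / n as r → ∞. -/

noncomputable section

namespace NcILW

/-! ### Exponentials of formal power series -/

section FormalExponential

open PowerSeries

theorem coeff_ser (f : ℕ → ℂ) (n : ℕ) : coeff n (ser f) = f n := coeff_mk _ _

theorem constantCoeff_ser (f : ℕ → ℂ) : constantCoeff (ser f) = f 0 := by
  rw [← coeff_zero_eq_constantCoeff_apply, coeff_ser]

theorem ser_coeff (F : PowerSeries ℂ) : ser (fun n => coeff n F) = F := by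
  ext n; rw [coeff_ser]

theorem ser_neg (f : ℕ → ℂ) : ser (fun n => -f n) = -ser f := by
  ext n; simp [coeff_ser]

theorem ser_add (f g : ℕ → ℂ) : ser (fun n => f n + g n) = ser f + ser g := by
  ext n; simp [coeff_ser]

theorem ser_sub (f g : ℕ → ℂ) : ser (fun n => f n - g n) = ser f - ser g := by
  ext n; simp [coeff_ser]

theorem constantCoeff_fexp {f : PowerSeries ℂ} (hf : constantCoeff f = 0) :
    constantCoeff (fexp f) = 1 := by
  rw [fexp, ← coeff_zero_eq_constantCoeff_apply,
    coeff_subst' (HasSubst.of_constantCoeff_zero' hf), finsum_eq_single _ 0]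
  · simp
  · intro n hn
    simp [hf, hn]

theorem derivative_fexp {f : PowerSeries ℂ} (hf : constantCoeff f = 0) :
    derivative ℂ (fexp f) = fexp f * derivative ℂ f := by
  rw [fexp, derivative_subst (HasSubst.of_constantCoeff_zero' hf), derivative_exp]

/-- The differential equation y' = y f' is a recursion for the coefficients of y. All properties of
`fexp` below come from it, not from the definition by substitution. -/
theorem coeff_succ_of_derivative {y f : PowerSeries ℂ} (h : derivative ℂ y = y * derivative ℂ f)
    (n : ℕ) : coeff (n + 1) y
      = (1 / (n + 1) : ℂ) * ∑ p ∈ Finset.HasAntidiagonal.antidiagonal n,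
        coeff p.1 y * (coeff (p.2 + 1) f * (p.2 + 1)) := by
  have h1 := congrArg (coeff n) h
  rw [coeff_derivative, coeff_mul] at h1
  simp only [coeff_derivative] at h1
  rw [← h1]
  have : (n + 1 : ℂ) ≠ 0 := Nat.cast_add_one_ne_zero n
  field_simp

theorem coeff_succ_fexp {f : PowerSeries ℂ} (hf : constantCoeff f = 0) (n : ℕ) :
    coeff (n + 1) (fexp f) = (1 / (n + 1) : ℂ) * ∑ p ∈ Finset.HasAntidiagonal.antidiagonal n,
        coeff p.1 (fexp f) * (coeff (p.2 + 1) f * (p.2 + 1)) :=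
  coeff_succ_of_derivative (derivative_fexp hf) n

/-- The recursion determines every coefficient from the constant term. Identities between
exponentials thus reduce to checking the differential equation. -/
theorem eq_of_derivative_eq_mul {y z f : PowerSeries ℂ}
    (hy : derivative ℂ y = y * derivative ℂ f) (hz : derivative ℂ z = z * derivative ℂ f)
    (h0 : constantCoeff y = constantCoeff z) : y = z := by
  ext n
  induction n using Nat.strong_induction_on with
  | _ n ih =>
    cases n with
    | zero => simpa using h0
    | succ n =>
      rw [coeff_succ_of_derivative hy, coeff_succ_of_derivative hz]
      congr 1
      refine Finset.sum_congr rfl fun p hp => ?_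
      rw [ih p.1 (by have := Finset.HasAntidiagonal.mem_antidiagonal.1 hp; omega)]

theorem fexp_zero : fexp 0 = 1 :=
  eq_of_derivative_eq_mul (f := 0) (by rw [derivative_fexp (map_zero _)]) (by simp)
    (by rw [constantCoeff_fexp (map_zero _), map_one])

theorem fexp_add {f g : PowerSeries ℂ} (hf : constantCoeff f = 0) (hg : constantCoeff g = 0) :
    fexp (f + g) = fexp f * fexp g := by
  have hfg : constantCoeff (f + g) = 0 := by simp [hf, hg]
  refine eq_of_derivative_eq_mul (derivative_fexp hfg) ?_ ?_
  · rw [Derivation.leibniz, derivative_fexp hf, derivative_fexp hg, map_add]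
    simp only [smul_eq_mul]
    ring
  · rw [map_mul, constantCoeff_fexp hf, constantCoeff_fexp hg, constantCoeff_fexp hfg, one_mul]

theorem fexp_mul_fexp_neg {f : PowerSeries ℂ} (hf : constantCoeff f = 0) :
    fexp f * fexp (-f) = 1 := by
  rw [← fexp_add hf (by simp [hf]), add_neg_cancel, fexp_zero]

theorem fexp_injective {f g : PowerSeries ℂ} (hf : constantCoeff f = 0)
    (hg : constantCoeff g = 0) (h : fexp f = fexp g) : f = g := by
  refine derivative.ext ?_ (by rw [hf, hg])
  have h1 : fexp f * derivative ℂ f = fexp f * derivative ℂ g := by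
    rw [← derivative_fexp hf]
    nth_rewrite 2 [h]
    rw [← derivative_fexp hg, h]
  refine mul_left_cancel₀ (fun h0 => ?_) h1
  have := constantCoeff_fexp hf
  rw [h0, map_zero] at this
  exact zero_ne_one this

/-- The coefficients of the exponential of a formal power series that depends on a parameter lie in
every algebra of functions that contains the coefficients of the series. -/
theorem coeff_fexp_mem {X : Type*} (S : NonUnitalSubalgebra ℂ (X → ℂ)) (f : ℕ → X → ℂ)
    (h0 : f 0 = 0) (hf : ∀ n, f n ∈ S) (n : ℕ) :
    (fun x => coeff (n + 1) (fexp (ser fun m => f m x))) ∈ S := by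
  have hc : ∀ x, constantCoeff (ser fun m => f m x) = 0 := fun x => by
    rw [constantCoeff_ser, h0]; rfl
  induction n using Nat.strong_induction_on with
  | _ n ih =>
    have h1 : (fun x => coeff (n + 1) (fexp (ser fun m => f m x)))
        = (1 / (n + 1) : ℂ) • ∑ p ∈ Finset.HasAntidiagonal.antidiagonal n, fun x =>
          coeff p.1 (fexp (ser fun m => f m x)) * (f (p.2 + 1) x * (p.2 + 1)) := by
      ext x
      rw [coeff_succ_fexp (hc x)]
      simp [coeff_ser, Finset.sum_apply]
    rw [h1]
    refine S.toSubmodule.smul_mem _ (S.toSubmodule.sum_mem fun p hp => ?_)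
    have h2 : (p.2 + 1 : ℂ) • f (p.2 + 1) ∈ S := S.toSubmodule.smul_mem _ (hf _)
    obtain ⟨a, b⟩ := p
    -- The factor with index 0 is the constant 1, which need not lie in a non-unital algebra; that
    -- term is the function `f (n + 1)` alone.
    cases a with
    | zero =>
      refine (congrArg (· ∈ S) (funext fun x => ?_)).mpr h2
      simp [constantCoeff_fexp (hc x), mul_comm]
    | succ a =>
      refine (congrArg (· ∈ S) (funext fun x => ?_)).mpr (S.mul_mem
        (ih a (by have := Finset.HasAntidiagonal.mem_antidiagonal.1 hp; simp at this; omega)) h2)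
      simp [mul_comm]

/-- Derivative of the exponential of a formal power series with respect to a parameter. -/
theorem hasDerivAt_coeff_fexp {f : ℕ → ℝ → ℂ} {f' : ℕ → ℂ} {t : ℝ} (h0 : f 0 = 0)
    (hf : ∀ n, HasDerivAt (f n) (f' n) t) (n : ℕ) :
    HasDerivAt (fun s => coeff n (fexp (ser fun m => f m s)))
      (coeff n (fexp (ser fun m => f m t) * ser f')) t := by
  have hc : ∀ x, constantCoeff (ser fun m => f m x) = 0 := fun x => by
    rw [constantCoeff_ser, h0]; rfl
  have hf0 : f' 0 = 0 := by
    have := hf 0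
    rw [h0] at this
    exact this.unique (hasDerivAt_const t 0)
  set F := ser fun m => f m t with hF
  set E := fexp F with hE
  -- The product `E * ser f'` obeys the recursion of `E` differentiated in the parameter, so the
  -- induction can run on the two recursions side by side.
  have key : derivative ℂ (E * ser f') = E * ser f' * derivative ℂ F + E * derivative ℂ (ser f') := by
    rw [Derivation.leibniz, derivative_fexp (hc t)]
    simp only [smul_eq_mul]
    ring
  induction n using Nat.strong_induction_on with
  | _ n ih =>
    cases n with
    | zero =>
      have h1 : (fun s => coeff 0 (fexp (ser fun m => f m s))) = fun _ => (1 : ℂ) := by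
        ext s
        simp [constantCoeff_fexp (hc s)]
      rw [h1]
      simpa [constantCoeff_ser, hf0] using hasDerivAt_const t (1 : ℂ)
    | succ n =>
      have h1 : (fun s => coeff (n + 1) (fexp (ser fun m => f m s)))
          = fun s => (1 / (n + 1) : ℂ) * ∑ p ∈ Finset.HasAntidiagonal.antidiagonal n,
            coeff p.1 (fexp (ser fun m => f m s)) * (f (p.2 + 1) s * (p.2 + 1)) := by
        ext s
        rw [coeff_succ_fexp (hc s)]
        simp [coeff_ser]
      rw [h1]
      have h2 : coeff (n + 1) (E * ser f') = (1 / (n + 1) : ℂ) * ∑ p ∈ Finset.HasAntidiagonal.antidiagonal n,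
          (coeff p.1 (E * ser f') * (f (p.2 + 1) t * (p.2 + 1))
            + coeff p.1 E * (f' (p.2 + 1) * (p.2 + 1))) := by
        have h3 := congrArg (coeff n) key
        have hFc : ∀ m, coeff m F = f m t := fun m => by rw [hF, coeff_ser]
        rw [coeff_derivative, map_add, coeff_mul n (E * ser f'), coeff_mul n E] at h3
        simp only [coeff_derivative, coeff_ser, hFc] at h3
        rw [Finset.sum_add_distrib, ← h3]
        have : (n + 1 : ℂ) ≠ 0 := Nat.cast_add_one_ne_zero n
        field_simp
      rw [h2]
      refine (HasDerivAt.fun_sum fun p hp => ?_).const_mul _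
      exact (ih p.1 (by have := Finset.HasAntidiagonal.mem_antidiagonal.1 hp; omega)).mul
        ((hf (p.2 + 1)).mul_const _)

end FormalExponential

/-! ### Smoothness and growth of the symbol of T ∂ₓ -/

section Symbol

open MeasureTheory Set Real

/-- The regular part `coth (c s / 2) - 1 = 2 / (exp (c s) - 1)` of the kernel of `T`. -/
def rho (c s : ℝ) : ℝ := 2 / (exp (c * s) - 1)

theorem rho_pos {c s : ℝ} (hc : 0 < c) (hs : 0 < s) : 0 < rho c s := by
  have : 1 < exp (c * s) := by rw [Real.one_lt_exp_iff]; positivity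
  exact div_pos two_pos (by linarith)

/-- The factor s cancels the simple pole of `rho` at 0. The decay follows from exp(cs) - 1 = 2
exp(cs/2) sinh(cs/2) ≥ cs exp(cs/2). -/
theorem mul_rho_le {c s : ℝ} (hc : 0 < c) (hs : 0 < s) :
    s * rho c s ≤ 2 / c * exp (-(c / 2) * s) := by
  have h1 : 1 < exp (c * s) := by rw [Real.one_lt_exp_iff]; positivity
  have h2 : c * s * exp (c * s / 2) ≤ exp (c * s) - 1 := by
    have h3 : c * s / 2 ≤ sinh (c * s / 2) := Real.self_le_sinh_iff.2 (by positivity)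
    rw [Real.sinh_eq] at h3
    have h4 : exp (c * s) = exp (c * s / 2) * exp (c * s / 2) := by rw [← Real.exp_add]; ring_nf
    have h5 : exp (c * s / 2) * exp (-(c * s / 2)) = 1 := by rw [← Real.exp_add]; simp
    have h6 := exp_pos (c * s / 2)
    nlinarith
  have h7 : exp (-(c / 2) * s) * exp (c * s / 2) = 1 := by
    rw [← Real.exp_add, show -(c / 2) * s + c * s / 2 = 0 by ring, Real.exp_zero]
  rw [rho, ← mul_div_assoc, div_le_iff₀ (by linarith)]
  calc s * 2 = 2 / c * exp (-(c / 2) * s) * (c * s * exp (c * s / 2)) := by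
        rw [show 2 / c * exp (-(c / 2) * s) * (c * s * exp (c * s / 2)) = c / c * (2 * s)
          * (exp (-(c / 2) * s) * exp (c * s / 2)) by ring, h7, div_self hc.ne']
        ring
    _ ≤ _ := by gcongr

theorem measurable_rho (c : ℝ) : Measurable (rho c) := by
  unfold rho; fun_prop

theorem integrableOn_pow_mul_exp_neg {b : ℝ} (hb : 0 < b) (n : ℕ) :
    IntegrableOn (fun s => s ^ n * exp (-b * s)) (Ioi 0) := by
  have := integrableOn_rpow_mul_exp_neg_mul_rpow (s := n) (p := 1) (b := b)
    (by have : (0 : ℝ) ≤ n := n.cast_nonneg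
        linarith) one_pos hb
  simpa using this

theorem integrableOn_pow_mul_rho {c : ℝ} (hc : 0 < c) (n : ℕ) :
    IntegrableOn (fun s => s ^ n * (s * rho c s)) (Ioi 0) := by
  refine Integrable.mono' ((integrableOn_pow_mul_exp_neg (half_pos hc) n).const_mul (2 / c))
    (by have := measurable_rho c; fun_prop) ?_
  filter_upwards [ae_restrict_mem measurableSet_Ioi] with s hs
  have hs' : 0 < s := hs
  have h1 := rho_pos hc hs'
  rw [Real.norm_of_nonneg (by positivity), mul_left_comm (2 / c)]
  exact mul_le_mul_of_nonneg_left (mul_rho_le hc hs') (by positivity)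

/-- The sine transform of `rho`. -/
def sineRho (c ξ : ℝ) : ℝ := ∫ s in Ioi (0 : ℝ), rho c s * sin (2 * π * ξ * s)

theorem norm_rho_mul_sin_le {c s : ℝ} (hc : 0 < c) (hs : 0 < s) (k : ℝ) :
    ‖rho c s * sin (k * s)‖ ≤ |k| * (s * rho c s) := by
  have h1 := rho_pos hc hs
  rw [norm_mul, Real.norm_of_nonneg h1.le, Real.norm_eq_abs]
  have h2 : |sin (k * s)| ≤ |k * s| := Real.abs_sin_le_abs
  rw [abs_mul, abs_of_pos hs] at h2
  calc rho c s * |sin (k * s)| ≤ rho c s * (|k| * s) := by gcongr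
    _ = _ := by ring

theorem integrableOn_mul_rho {c : ℝ} (hc : 0 < c) :
    IntegrableOn (fun s => s * rho c s) (Ioi 0) := by
  simpa using integrableOn_pow_mul_rho hc 0

theorem integrableOn_rho_mul_sin {c : ℝ} (hc : 0 < c) (k : ℝ) :
    IntegrableOn (fun s => rho c s * sin (k * s)) (Ioi 0) := by
  refine Integrable.mono' ((integrableOn_mul_rho hc).const_mul |k|)
    (by have := measurable_rho c; fun_prop) ?_
  filter_upwards [ae_restrict_mem measurableSet_Ioi] with s hs
  exact norm_rho_mul_sin_le hc hs k

/-- Finite moments allow differentiation under the integral to any order, and each derivative is the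
Fourier integral of an integrable function, hence bounded. -/
theorem hasTemperateGrowth_fourier {h : ℝ → ℂ} (hm : AEStronglyMeasurable h)
    (hi : ∀ n : ℕ, Integrable (fun s => ‖s‖ ^ n * ‖h s‖)) :
    Function.HasTemperateGrowth (FourierTransform.fourier h) := by
  refine ⟨Real.contDiff_fourier (fun n _ => hi n), fun n =>
    ⟨0, ∫ s, ‖VectorFourier.fourierPowSMulRight (innerSL ℝ) h s n‖, fun x => ?_⟩⟩
  rw [Real.iteratedFDeriv_fourier (N := ⊤) (fun n _ => hi n) hm (by exact_mod_cast le_top)]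
  rw [pow_zero, mul_one]
  exact VectorFourier.norm_fourierIntegral_le_integral_norm Real.fourierChar volume (innerₗ ℝ)
    (fun s => VectorFourier.fourierPowSMulRight (innerSL ℝ) h s n) x

/-- `rho` is not integrable at 0, but differentiating the sine brings down a factor s. The
derivative is a cosine transform of the integrable function s `rho`. -/
theorem hasDerivAt_sineRho {c : ℝ} (hc : 0 < c) (ξ : ℝ) :
    HasDerivAt (sineRho c)
      (2 * π * (FourierTransform.fourier ((Ioi (0 : ℝ)).indicator
        fun s => ((s * rho c s : ℝ) : ℂ)) ξ).re) ξ := by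
  have hi := integrableOn_mul_rho hc
  have key := hasDerivAt_integral_of_dominated_loc_of_deriv_le (μ := volume.restrict (Ioi (0 : ℝ)))
    (F := fun ξ s => rho c s * sin (2 * π * ξ * s)) (x₀ := ξ) (s := univ)
    (F' := fun ξ s => rho c s * (cos (2 * π * ξ * s) * (2 * π * s)))
    (bound := fun s => 2 * π * (s * rho c s)) Filter.univ_mem
    (Filter.Eventually.of_forall fun x => by have := measurable_rho c; fun_prop)
    (integrableOn_rho_mul_sin hc _) (by have := measurable_rho c; fun_prop) ?_ (hi.const_mul _) ?_
  · refine key.2.congr_deriv ?_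
    rw [Real.fourier_real_eq_integral_exp_smul]
    have e1 : ∀ v : ℝ, Complex.exp (((-2 * π * v * ξ : ℝ) : ℂ) * Complex.I) • (Ioi (0 : ℝ)).indicator
        (fun s => ((s * rho c s : ℝ) : ℂ)) v = (Ioi (0 : ℝ)).indicator
        (fun s => Complex.exp (((-2 * π * s * ξ : ℝ) : ℂ) * Complex.I) *
          ((s * rho c s : ℝ) : ℂ)) v := by
      intro v
      by_cases hv : v ∈ Ioi (0 : ℝ) <;> simp [hv]
    simp_rw [e1]
    rw [integral_indicator measurableSet_Ioi]
    have e2 : Integrable (fun s : ℝ => Complex.exp (((-2 * π * s * ξ : ℝ) : ℂ) * Complex.I) *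
          ((s * rho c s : ℝ) : ℂ)) (volume.restrict (Ioi 0)) := by
      refine hi.norm.mono' (by have := measurable_rho c; fun_prop) ?_
      refine Filter.Eventually.of_forall fun s => ?_
      rw [norm_mul, Complex.norm_exp_ofReal_mul_I, one_mul, Complex.norm_real]
    have e3 := integral_re e2
    simp only [RCLike.re_to_complex] at e3
    rw [← e3, ← integral_const_mul]
    refine integral_congr_ae (Filter.Eventually.of_forall fun s => ?_)
    simp only [Complex.re_mul_ofReal, Complex.exp_ofReal_mul_I_re]
    rw [show -2 * π * s * ξ = -(2 * π * ξ * s) by ring, Real.cos_neg]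
    ring
  · filter_upwards [ae_restrict_mem measurableSet_Ioi] with s hs x _
    have hs' : 0 < s := hs
    have h1 := rho_pos hc hs'
    rw [norm_mul, norm_mul, Real.norm_of_nonneg h1.le,
      Real.norm_of_nonneg (show 0 ≤ 2 * π * s by positivity), Real.norm_eq_abs]
    have h2 := Real.abs_cos_le_one (2 * π * x * s)
    calc rho c s * (|cos (2 * π * x * s)| * (2 * π * s)) ≤ rho c s * (1 * (2 * π * s)) := by
          gcongr
      _ = _ := by ring
  · refine Filter.Eventually.of_forall fun s x _ => ?_
    refine HasDerivAt.const_mul _ ?_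
    refine (Real.hasDerivAt_sin _).comp x ?_
    simpa using ((hasDerivAt_id x).const_mul (2 * π)).mul_const s

/-- The derivative is the real part of the Fourier transform of a function with finite moments. The
function itself grows at most linearly, since |sin(ks)| ≤ |k| s; this is the exponent `k := 1`. -/
theorem hasTemperateGrowth_sineRho {c : ℝ} (hc : 0 < c) :
    Function.HasTemperateGrowth (sineRho c) := by
  have hm : AEStronglyMeasurable ((Ioi (0 : ℝ)).indicator fun s => ((s * rho c s : ℝ) : ℂ)) := by
    refine AEStronglyMeasurable.indicator ?_ measurableSet_Ioi
    have := measurable_rho c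
    fun_prop
  have hi : ∀ n : ℕ, Integrable (fun s => ‖s‖ ^ n * ‖(Ioi (0 : ℝ)).indicator
      (fun s => ((s * rho c s : ℝ) : ℂ)) s‖) := by
    intro n
    have h1 := (integrableOn_pow_mul_rho hc n).norm
    have h1 := (integrable_indicator_iff measurableSet_Ioi).2 h1
    refine h1.congr (Filter.Eventually.of_forall fun s => ?_)
    by_cases hs : s ∈ Ioi (0 : ℝ)
    · simp [hs]
    · simp [hs]
  have hF := hasTemperateGrowth_fourier hm hi
  set H := FourierTransform.fourier ((Ioi (0 : ℝ)).indicator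
    fun s => ((s * rho c s : ℝ) : ℂ)) with hH
  have hre : Function.HasTemperateGrowth fun ξ => 2 * π * (H ξ).re :=
    (Function.HasTemperateGrowth.const (2 * π)).mul
      ((Complex.reCLM.hasTemperateGrowth).comp hF)
  refine Function.HasTemperateGrowth.of_fderiv (k := 1)
    (C := 2 * π * ∫ s in Ioi (0 : ℝ), s * rho c s) ?_
    (fun ξ => (hasDerivAt_sineRho hc ξ).differentiableAt) ?_
  · have : fderiv ℝ (sineRho c)
        = fun ξ => ContinuousLinearMap.toSpanSingleton ℝ (2 * π * (H ξ).re) := by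
      ext ξ
      simp [(hasDerivAt_sineRho hc ξ).hasFDerivAt.fderiv, hH]
    rw [this]
    exact ((ContinuousLinearMap.toSpanSingletonCLE (𝕜 := ℝ) (E := ℝ)
      ).toContinuousLinearMap.hasTemperateGrowth).comp hre
  · intro ξ
    have h1 : ‖sineRho c ξ‖ ≤ ∫ s in Ioi (0 : ℝ), |2 * π * ξ| * (s * rho c s) := by
      refine norm_integral_le_of_norm_le ((integrableOn_mul_rho hc).const_mul _) ?_
      filter_upwards [ae_restrict_mem measurableSet_Ioi] with s hs
      exact norm_rho_mul_sin_le hc hs _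
    rw [integral_const_mul, abs_mul, abs_of_pos (by positivity : (0 : ℝ) < 2 * π)] at h1
    have h2 : 0 ≤ ∫ s in Ioi (0 : ℝ), s * rho c s :=
      setIntegral_nonneg measurableSet_Ioi fun s hs => (mul_pos hs (rho_pos hc hs)).le
    refine h1.trans ?_
    rw [Real.norm_eq_abs, pow_one]
    nlinarith [mul_nonneg (by positivity : (0 : ℝ) ≤ 2 * π) h2]

end Symbol

/-! ### Closed form of the symbol -/

section SymbolValue

open MeasureTheory Set Real

theorem integral_exp_neg_mul_sin {b : ℝ} (hb : 0 < b) (k : ℝ) :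
    ∫ s in Ioi (0 : ℝ), exp (-b * s) * sin (k * s) = k / (b ^ 2 + k ^ 2) := by
  have ha : (-b + k * Complex.I : ℂ).re < 0 := by simpa using hb
  have h1 := integral_exp_mul_complex_Ioi ha 0
  have h2 := integral_im (integrableOn_exp_mul_complex_Ioi ha 0)
  rw [h1] at h2
  simp only [RCLike.im_to_complex] at h2
  have h3 : ∀ s : ℝ, (Complex.exp ((-b + k * Complex.I) * s)).im = exp (-b * s) * sin (k * s) := by
    intro s
    rw [Complex.exp_im]
    simp
  simp_rw [h3] at h2
  rw [h2]
  have h4 : (0 : ℝ) < b ^ 2 + k ^ 2 := by positivity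
  rw [Complex.ofReal_zero, mul_zero, Complex.exp_zero, Complex.div_im]
  simp [Complex.normSq_apply]
  field_simp

theorem hasSum_rho {c s : ℝ} (hc : 0 < c) (hs : 0 < s) :
    HasSum (fun n : ℕ => 2 * exp (-(c * (n + 1)) * s)) (rho c s) := by
  have h1 : exp (-(c * s)) < 1 := by rw [Real.exp_lt_one_iff]; simp; positivity
  have h2 := ((hasSum_geometric_of_lt_one (exp_pos _).le h1).mul_left (2 * exp (-(c * s))))
  have hv : rho c s = 2 * exp (-(c * s)) * (1 - exp (-(c * s)))⁻¹ := by
    rw [rho, Real.exp_neg]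
    have : 1 < exp (c * s) := by rw [Real.one_lt_exp_iff]; positivity
    have h3 : exp (c * s) - 1 ≠ 0 := by linarith
    have h4 : 1 - (exp (c * s))⁻¹ ≠ 0 := by
      rw [sub_ne_zero]
      exact (inv_lt_one_of_one_lt₀ this).ne'
    field_simp
  rw [hv]
  refine (congrArg (fun f => HasSum f _) (funext fun n => ?_)).mpr h2
  rw [← Real.exp_nat_mul, mul_assoc, ← Real.exp_add]
  ring_nf

/-- The geometric series of `rho` is integrated term by term. The bound |sin(ks)| ≤ |k| s makes the
L¹ norms at most 2|k| / (c(n+1))², which is summable. -/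
theorem hasSum_sineRho {c : ℝ} (hc : 0 < c) (ξ : ℝ) :
    HasSum (fun n : ℕ => 2 * (2 * π * ξ) / ((c * (n + 1)) ^ 2 + (2 * π * ξ) ^ 2)) (sineRho c ξ) := by
  set k := 2 * π * ξ with hk
  have hpos : ∀ n : ℕ, 0 < c * (n + 1) := fun n => by positivity
  have hle : ∀ n : ℕ, ∀ s ∈ Ioi (0 : ℝ), ‖2 * exp (-(c * (n + 1)) * s) * sin (k * s)‖
      ≤ 2 * |k| * (s ^ 1 * exp (-(c * (n + 1)) * s)) := by
    intro n s hs
    have hs' : 0 < s := hs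
    rw [norm_mul, Real.norm_of_nonneg (by positivity), Real.norm_eq_abs]
    have h2 : |sin (k * s)| ≤ |k * s| := Real.abs_sin_le_abs
    rw [abs_mul, abs_of_pos hs'] at h2
    calc 2 * exp (-(c * (n + 1)) * s) * |sin (k * s)|
        ≤ 2 * exp (-(c * (n + 1)) * s) * (|k| * s) := by gcongr
      _ = _ := by ring
  have hint : ∀ n : ℕ, IntegrableOn (fun s => 2 * exp (-(c * (n + 1)) * s) * sin (k * s))
      (Ioi 0) := fun n =>
    ((integrableOn_pow_mul_exp_neg (hpos n) 1).const_mul (2 * |k|)).mono' (by fun_prop)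
      ((ae_restrict_mem measurableSet_Ioi).mono (hle n))
  have hsum : Summable fun n : ℕ =>
      ∫ s in Ioi (0 : ℝ), ‖2 * exp (-(c * (n + 1)) * s) * sin (k * s)‖ := by
    have h1 : ∀ n : ℕ, ∫ s in Ioi (0 : ℝ), s ^ 1 * exp (-(c * (n + 1)) * s)
        = 1 / c ^ 2 * (1 / ((n + 1 : ℕ) : ℝ) ^ 2) := by
      intro n
      have := Real.integral_rpow_mul_exp_neg_mul_Ioi (a := 2) (r := c * (n + 1)) two_pos (hpos n)
      have e : ∀ s : ℝ, s ^ ((2 : ℝ) - 1) * exp (-(c * (n + 1) * s))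
        = s ^ 1 * exp (-(c * (n + 1)) * s) := by
        intro s
        norm_num
      simp_rw [e] at this
      rw [this]
      have hG : Gamma (2 : ℝ) = 1 := by
        simp
      rw [hG, mul_one]
      push_cast
      rw [show (2 : ℝ) = ((2 : ℕ) : ℝ) by norm_num, Real.rpow_natCast]
      field_simp
    refine Summable.of_nonneg_of_le (fun n => integral_nonneg fun s => norm_nonneg _)
      (fun n => ?_) (((summable_nat_add_iff 1).2
        (Real.summable_one_div_nat_pow.2 one_lt_two)).mul_left (2 * |k| * (1 / c ^ 2)))
    rw [mul_assoc, ← h1 n, ← integral_const_mul]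
    exact setIntegral_mono_on (hint n).norm
      ((integrableOn_pow_mul_exp_neg (hpos n) 1).const_mul (2 * |k|)) measurableSet_Ioi (hle n)
  have key := hasSum_integral_of_summable_integral_norm hint hsum
  have hv : sineRho c ξ = ∫ s in Ioi (0 : ℝ), ∑' n : ℕ, 2 * exp (-(c * (n + 1)) * s) * sin (k * s) :=
    setIntegral_congr_fun measurableSet_Ioi fun s hs =>
      (((hasSum_rho hc hs).mul_right _).tsum_eq).symm
  rw [hv]
  refine (congrArg (fun f => HasSum f _) (funext fun n => ?_)).mpr key
  have h1 : ∀ s : ℝ, 2 * exp (-(c * (n + 1)) * s) * sin (k * s)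
      = 2 * (exp (-(c * (n + 1)) * s) * sin (k * s)) := fun s => by ring
  simp only [h1]
  rw [integral_const_mul, integral_exp_neg_mul_sin (hpos n)]
  ring

/-- The series of `hasSum_sineRho` is, up to a factor, the Mittag-Leffler expansion of π cot(πx) -
1/x at the imaginary point x = 2iδξ, where the cotangent becomes a hyperbolic cotangent. -/
theorem sineRho_eq {δ ξ : ℝ} (hδ : 0 < δ) (hξ : ξ ≠ 0) :
    sineRho (π / δ) ξ
      = δ * (cosh (2 * π * δ * ξ) / sinh (2 * π * δ * ξ)) - 1 / (2 * π * ξ) := by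
  have hpi := Real.pi_pos
  have hk : 2 * π * ξ ≠ 0 := by positivity
  have hx : (2 * δ * ξ : ℝ) ≠ 0 := by positivity
  set x : ℂ := ((2 * δ * ξ : ℝ) : ℂ) * Complex.I with hxdef
  have hx0 : x ≠ 0 := mul_ne_zero (by exact_mod_cast hx) Complex.I_ne_zero
  have hxmem : x ∈ Complex.integerComplement := by
    rw [Complex.mem_integerComplement_iff]
    rintro ⟨n, hn⟩
    have := congrArg Complex.im hn
    rw [hxdef, Complex.intCast_im, Complex.im_ofReal_mul, Complex.I_im, mul_one] at this
    exact hx this.symm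
  have h1 := cot_series_rep' hxmem
  have h2 := (Complex.hasSum_ofReal.2 (hasSum_sineRho (c := π / δ) (by positivity) ξ)).mul_left
    (-Complex.I * (π / δ : ℝ))
  have h3 : ∀ n : ℕ, (1 / (x - (n + 1)) + 1 / (x + (n + 1)) : ℂ)
      = -Complex.I * (π / δ : ℝ) * ((2 * (2 * π * ξ) / ((π / δ * (n + 1)) ^ 2 + (2 * π * ξ) ^ 2) : ℝ) : ℂ) := by
    intro n
    have e1 : x - (n + 1) ≠ 0 := by
      intro h
      have := congrArg Complex.im h
      rw [hxdef, Complex.sub_im, Complex.im_ofReal_mul] at this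
      simp at this
      rcases this with h | h
      · exact hδ.ne' h
      · exact hξ h
    have e2 : x + (n + 1) ≠ 0 := by
      intro h
      have := congrArg Complex.im h
      rw [hxdef, Complex.add_im, Complex.im_ofReal_mul] at this
      simp at this
      rcases this with h | h
      · exact hδ.ne' h
      · exact hξ h
    have e3 : ((π / δ * (n + 1)) ^ 2 + (2 * π * ξ) ^ 2 : ℝ)
        = -(π / δ) ^ 2 * ((-(2 * δ * ξ) ^ 2 - (n + 1) ^ 2)) := by
      field_simp
      ring
    have e4 : (x - (n + 1)) * (x + (n + 1)) = ((-(2 * δ * ξ) ^ 2 - (n + 1) ^ 2 : ℝ) : ℂ) := by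
      rw [hxdef]
      push_cast
      linear_combination (2 * δ * ξ : ℂ) ^ 2 * Complex.I_sq
    have e5 : ((-(2 * δ * ξ) ^ 2 - (n + 1) ^ 2 : ℝ) : ℂ) ≠ 0 := by
      rw [← e4]; exact mul_ne_zero e1 e2
    rw [e3, div_add_div _ _ e1 e2, e4, Complex.ofReal_div (2 * (2 * π * ξ)),
      Complex.ofReal_mul (-(π / δ) ^ 2)]
    have hδ' : (δ : ℂ) ≠ 0 := by exact_mod_cast hδ.ne'
    have hpi' : (π : ℂ) ≠ 0 := by exact_mod_cast hpi.ne'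
    generalize ((-(2 * δ * ξ) ^ 2 - (n + 1) ^ 2 : ℝ) : ℂ) = D at *
    rw [hxdef]
    push_cast
    field_simp
    ring
  simp_rw [h3] at h1
  rw [h2.tsum_eq] at h1
  have hs : sinh (2 * π * δ * ξ) ≠ 0 := by
    rw [Ne, Real.sinh_eq_zero]; positivity
  have h4 : (π : ℂ) * Complex.cot (π * x)
      = -Complex.I * (π * (cosh (2 * π * δ * ξ) / sinh (2 * π * δ * ξ)) : ℝ) := by
    have hy : (π : ℂ) * x = ((2 * π * δ * ξ : ℝ) : ℂ) * Complex.I := by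
      rw [hxdef]; push_cast; ring
    rw [hy, Complex.cot, Complex.cos_mul_I, Complex.sin_mul_I, ← Complex.ofReal_cosh,
      ← Complex.ofReal_sinh]
    have hs' : ((sinh (2 * π * δ * ξ) : ℝ) : ℂ) ≠ 0 := by exact_mod_cast hs
    rw [Complex.ofReal_mul, Complex.ofReal_div]
    generalize ((sinh (2 * π * δ * ξ) : ℝ) : ℂ) = S at *
    field_simp
    rw [Complex.I_sq]
    ring
  have h5 : (1 / x : ℂ) = -Complex.I * (1 / (2 * δ * ξ) : ℝ) := by
    rw [hxdef]
    have : ((2 * δ * ξ : ℝ) : ℂ) ≠ 0 := by exact_mod_cast hx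
    rw [Complex.ofReal_div]
    generalize ((2 * δ * ξ : ℝ) : ℂ) = S at *
    push_cast
    field_simp
    rw [Complex.I_sq]
    ring
  rw [h4, h5, ← mul_sub, mul_assoc (-Complex.I)] at h1
  have h6 := mul_left_cancel₀ (neg_ne_zero.2 Complex.I_ne_zero) h1
  have h7 : π * (cosh (2 * π * δ * ξ) / sinh (2 * π * δ * ξ)) - 1 / (2 * δ * ξ)
      = π / δ * sineRho (π / δ) ξ := by exact_mod_cast h6
  have h8 : sineRho (π / δ) ξ = δ / π * (π / δ * sineRho (π / δ) ξ) := by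
    field_simp
  rw [h8, ← h7]
  field_simp

end SymbolValue

/-! ### Singular integrals in Fourier variables -/

section Kernel

open MeasureTheory Set Real
open scoped FourierTransform

/-- After the substitution y = x + s the half-line s < -ε is reflected onto s > ε, with a sign
because the kernel is odd. The value ε = 0 is allowed for bounded kernels such as tanh. -/
theorem setIntegral_odd_kernel {k : ℝ → ℝ} {g : ℝ → ℂ} {ε C : ℝ} (hε : 0 ≤ ε) (hk : Measurable k)
    (hodd : ∀ s, k (-s) = -k s) (hb : ∀ s, ε < s → |k s| ≤ C) (hg : Integrable g) (x : ℝ) :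
    ∫ y in {y : ℝ | ε < |y - x|}, (k (y - x) : ℂ) * g y
      = ∫ s in Ioi ε, (k s : ℂ) * (g (x + s) - g (x - s)) := by
  have hm : MeasurableSet {s : ℝ | ε < |s|} := measurableSet_lt (by fun_prop) (by fun_prop)
  have hm' : MeasurableSet {y : ℝ | ε < |y - x|} := measurableSet_lt (by fun_prop) (by fun_prop)
  have hg1 : Integrable fun s => g (x + s) := hg.comp_add_left x
  have hg2 : Integrable fun s => g (x - s) := hg.comp_sub_left x
  have h1 : ∫ y in {y : ℝ | ε < |y - x|}, (k (y - x) : ℂ) * g y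
      = ∫ s in {s : ℝ | ε < |s|}, (k s : ℂ) * g (x + s) := by
    rw [← integral_indicator hm', ← integral_indicator hm, ← integral_add_left_eq_self _ x]
    refine integral_congr_ae (Filter.Eventually.of_forall fun s => ?_)
    by_cases hs : ε < |s| <;> simp [indicator, hs]
  have hset : {s : ℝ | ε < |s|} = Ioi ε ∪ Iio (-ε) := by
    ext s
    simp only [mem_ofPred_eq, mem_union, mem_Ioi, mem_Iio, lt_abs, lt_neg]
  have hi1 : ∀ h : ℝ → ℂ, Integrable h → IntegrableOn (fun s => (k s : ℂ) * h s) (Ioi ε) := by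
    intro h hh
    refine (hh.integrableOn (s := Ioi ε)).bdd_mul (c := C)
      (by fun_prop) ?_
    filter_upwards [ae_restrict_mem measurableSet_Ioi] with s hs
    rw [Complex.norm_real]
    exact hb s hs
  have hi2 : IntegrableOn (fun s => (k s : ℂ) * g (x + s)) (Iio (-ε)) := by
    refine (hg1.integrableOn (s := Iio (-ε))).bdd_mul (c := C) (by fun_prop) ?_
    filter_upwards [ae_restrict_mem measurableSet_Iio] with s hs
    rw [Complex.norm_real, Real.norm_eq_abs, ← abs_neg, ← hodd]
    exact hb _ (by have : s < -ε := hs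
                   linarith)
  have hdisj : Disjoint (Ioi ε) (Iio (-ε)) := by
    rw [Set.disjoint_left]
    intro s h1 h2
    have h1' : ε < s := h1
    have h2' : s < -ε := h2
    linarith
  rw [h1, hset, setIntegral_union hdisj measurableSet_Iio (hi1 _ hg1) hi2,
    ← integral_Iic_eq_integral_Iio, ← integral_comp_neg_Ioi]
  rw [← integral_add (hi1 _ hg1)]
  · refine integral_congr_ae (Filter.Eventually.of_forall fun s => ?_)
    simp only [hodd]
    push_cast
    rw [← sub_eq_add_neg]
    ring
  · have := hi1 _ hg2
    refine this.neg.congr (Filter.Eventually.of_forall fun s => ?_)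
    simp only [hodd, Pi.neg_apply]
    push_cast
    rw [← sub_eq_add_neg]
    ring

/-- The symbol `-2πξ coth (2πδξ)` of `T ∂ₓ`. -/
def symA (δ ξ : ℝ) : ℝ := -(1 / δ) - 2 * π / δ * (ξ * sineRho (π / δ) ξ)

/-- Writing the symbol through `sineRho` instead of coth makes its smoothness at ξ = 0 immediate. -/
theorem hasTemperateGrowth_symA {δ : ℝ} (hδ : 0 < δ) : (symA δ).HasTemperateGrowth := by
  have h1 := hasTemperateGrowth_sineRho (c := π / δ) (by positivity)
  have h2 : (fun ξ : ℝ => ξ * sineRho (π / δ) ξ).HasTemperateGrowth :=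
    Function.HasTemperateGrowth.id'.mul h1
  exact (Function.HasTemperateGrowth.const _).sub ((Function.HasTemperateGrowth.const _).mul h2)

theorem hasTemperateGrowth_symA_ofReal {δ : ℝ} (hδ : 0 < δ) :
    (fun ξ => (symA δ ξ : ℂ)).HasTemperateGrowth :=
  Complex.ofRealCLM.hasTemperateGrowth.comp (hasTemperateGrowth_symA hδ)

/-- The operator `T ∂ₓ` on Schwartz functions, as a Fourier multiplier. -/
def Aop (δ : ℝ) : 𝓢(ℝ, ℂ) →L[ℂ] 𝓢(ℝ, ℂ) :=
  SchwartzMap.fourierMultiplierCLM ℂ fun ξ => (symA δ ξ : ℂ)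

/-- The operator `T̃ ∂ₓ` on Schwartz functions. -/
def Bop (δ : ℝ) : 𝓢(ℝ, ℂ) →L[ℂ] 𝓢(ℝ, ℂ) := Aop (δ / 2) - Aop δ

theorem fourier_Aop {δ : ℝ} (hδ : 0 < δ) (f : 𝓢(ℝ, ℂ)) (ξ : ℝ) :
    𝓕 (Aop δ f) ξ = symA δ ξ * 𝓕 f ξ := by
  rw [Aop, SchwartzMap.fourierMultiplierCLM_apply, FourierTransform.fourier_fourierInv_eq,
    SchwartzMap.smulLeftCLM_apply_apply (hasTemperateGrowth_symA_ofReal hδ), smul_eq_mul]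

theorem eq_integral_fourier (f : 𝓢(ℝ, ℂ)) (x : ℝ) :
    f x = ∫ ξ : ℝ, Complex.exp (2 * π * Complex.I * x * ξ) * 𝓕 f ξ := by
  conv_lhs => rw [← FourierTransform.fourierInv_fourier_eq (F := 𝓢(ℝ,ℂ)) f]
  rw [SchwartzMap.fourierInv_coe, Real.fourierInv_eq']
  refine integral_congr_ae (Filter.Eventually.of_forall fun ξ => ?_)
  simp only [smul_eq_mul, RCLike.inner_apply, conj_trivial]
  congr 2
  push_cast
  ring

theorem fourier_derivCLM (f : 𝓢(ℝ, ℂ)) (ξ : ℝ) :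
    𝓕 (SchwartzMap.derivCLM ℂ ℂ f) ξ = 2 * π * Complex.I * ξ * 𝓕 f ξ := by
  have h1 : (⇑(SchwartzMap.derivCLM ℂ ℂ f) : ℝ → ℂ) = deriv f := by
    ext x; rw [SchwartzMap.derivCLM_apply]
  have h2 : Integrable (deriv f) := by
    rw [← h1]; exact SchwartzMap.integrable _
  rw [SchwartzMap.fourier_coe, h1, Real.fourier_deriv f.integrable f.differentiable h2,
    SchwartzMap.fourier_coe]
  rfl

theorem integrable_exp_mul (h : 𝓢(ℝ, ℂ)) (x : ℝ) :
    Integrable fun ξ : ℝ => Complex.exp (2 * π * Complex.I * x * ξ) * h ξ := by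
  refine h.integrable.norm.mono' (by fun_prop) (Filter.Eventually.of_forall fun ξ => ?_)
  have : (2 * π * Complex.I * x * ξ : ℂ) = ((2 * π * x * ξ : ℝ) : ℂ) * Complex.I := by
    push_cast; ring
  rw [norm_mul, this, Complex.norm_exp_ofReal_mul_I, one_mul]

theorem deriv_sub_deriv_eq (f : 𝓢(ℝ, ℂ)) (x s : ℝ) :
    deriv f (x + s) - deriv f (x - s)
      = ∫ ξ : ℝ, (sin (2 * π * ξ * s) : ℂ) *
        (-(4 * π * ξ) * (Complex.exp (2 * π * Complex.I * x * ξ) * 𝓕 f ξ)) := by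
  rw [← SchwartzMap.derivCLM_apply ℂ f, ← SchwartzMap.derivCLM_apply ℂ f, eq_integral_fourier,
    eq_integral_fourier _ (x - s), ← integral_sub (integrable_exp_mul _ _) (integrable_exp_mul _ _)]
  refine integral_congr_ae (Filter.Eventually.of_forall fun ξ => ?_)
  simp only [fourier_derivCLM]
  have e1 : Complex.exp (2 * π * Complex.I * ↑(x + s) * ξ)
      = Complex.exp (2 * π * Complex.I * x * ξ) * Complex.exp (((2 * π * ξ * s : ℝ) : ℂ) * Complex.I) := by
    rw [← Complex.exp_add]; push_cast; ring_nf
  have e2 : Complex.exp (2 * π * Complex.I * ↑(x - s) * ξ)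
      = Complex.exp (2 * π * Complex.I * x * ξ) * Complex.exp (-((2 * π * ξ * s : ℝ) : ℂ) * Complex.I) := by
    rw [← Complex.exp_add]; push_cast; ring_nf
  rw [e1, e2, Complex.exp_mul_I, Complex.exp_mul_I, Complex.cos_neg, Complex.sin_neg]
  push_cast
  linear_combination (4 * π * ξ * Complex.exp (2 * π * Complex.I * x * ξ) * (𝓕 f) ξ
    * Complex.sin (2 * π * ξ * s)) * Complex.I_sq

/-- This is the contribution of the constant 1 in coth = 1 + `rho`: the integrand has the primitive
f(x+s) + f(x-s), which vanishes at infinity. -/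
theorem integral_deriv_sub_deriv (f : 𝓢(ℝ, ℂ)) (x : ℝ) :
    IntegrableOn (fun s => deriv f (x + s) - deriv f (x - s)) (Ioi 0) ∧
    ∫ s in Ioi (0 : ℝ), (deriv f (x + s) - deriv f (x - s)) = -2 * f x := by
  have h1 : Integrable (deriv f) := (SchwartzMap.derivCLM ℂ ℂ f).integrable
  have h2 : IntegrableOn (fun s => deriv f (x + s) - deriv f (x - s)) (Ioi 0) :=
    ((h1.comp_add_left x).sub (h1.comp_sub_left x)).integrableOn
  refine ⟨h2, ?_⟩
  have hd : ∀ s : ℝ, HasDerivAt (fun s => f (x + s) + f (x - s))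
      (deriv f (x + s) - deriv f (x - s)) s := by
    intro s
    have a1 := (f.hasDerivAt (x + s)).scomp s ((hasDerivAt_id s).const_add x)
    have a2 := (f.hasDerivAt (x - s)).scomp s ((hasDerivAt_id s).const_sub x)
    refine (a1.add a2).congr_deriv ?_
    simp [sub_eq_add_neg]
  have h0 : Filter.Tendsto f (Filter.cocompact ℝ) (nhds 0) := f.tendsto_cocompact
  have ht : Filter.Tendsto (fun s => f (x + s) + f (x - s)) Filter.atTop (nhds (0 + 0)) := by
    refine Filter.Tendsto.add (h0.comp ?_) (h0.comp ?_)
    · exact (Filter.tendsto_atTop_add_const_left _ x Filter.tendsto_id).mono_right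
        atTop_le_cocompact
    · refine Filter.Tendsto.mono_right ?_ atBot_le_cocompact
      change Filter.Tendsto (fun s => x + -s) _ _
      exact Filter.tendsto_atBot_add_const_left _ x Filter.tendsto_neg_atTop_atBot
  rw [integral_Ioi_of_hasDerivAt_of_tendsto (hd 0).continuousAt.continuousWithinAt
    (fun s _ => hd s) h2 ht]
  simp
  ring

/-- Fourier inversion of the difference followed by Fubini. The sine absorbs the pole of `rho`,
which gives the integrable product majorant s `rho`(s) · 2π|ξ| ‖g(ξ)‖. -/
theorem integral_rho_deriv {c : ℝ} (hc : 0 < c) (f : 𝓢(ℝ, ℂ)) (x : ℝ) :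
    IntegrableOn (fun s => (rho c s : ℂ) * (deriv f (x + s) - deriv f (x - s))) (Ioi 0) ∧
    ∫ s in Ioi (0 : ℝ), (rho c s : ℂ) * (deriv f (x + s) - deriv f (x - s))
      = ∫ ξ : ℝ, (sineRho c ξ : ℂ) *
        (-(4 * π * ξ) * (Complex.exp (2 * π * Complex.I * x * ξ) * 𝓕 f ξ)) := by
  set g : ℝ → ℂ := fun ξ => -(4 * π * ξ) * (Complex.exp (2 * π * Complex.I * x * ξ) * 𝓕 f ξ) with hg
  have hgm : Continuous g := by rw [hg]; fun_prop
  have hgi : Integrable fun ξ : ℝ => 2 * π * |ξ| * ‖g ξ‖ := by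
    have := ((𝓕 f).integrable_pow_mul volume 2).const_mul (2 * π * (4 * π))
    refine this.congr (Filter.Eventually.of_forall fun ξ => ?_)
    have e : (2 * π * Complex.I * x * ξ : ℂ) = ((2 * π * x * ξ : ℝ) : ℂ) * Complex.I := by
      push_cast; ring
    simp only [hg, norm_mul, e, Complex.norm_exp_ofReal_mul_I, norm_neg, Complex.norm_real,
      Real.norm_eq_abs, abs_of_pos Real.pi_pos, RCLike.norm_ofNat]
    ring
  have hF : Integrable (Function.uncurry fun s ξ : ℝ =>
      (rho c s : ℂ) * ((sin (2 * π * ξ * s) : ℂ) * g ξ))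
      ((volume.restrict (Ioi (0 : ℝ))).prod volume) := by
    refine ((integrableOn_mul_rho hc).mul_prod hgi).mono' ?_ ?_
    · have := measurable_rho c
      have := hgm.measurable
      refine Measurable.aestronglyMeasurable ?_
      simp only [Function.uncurry_def]
      fun_prop
    · have h1 : ∀ᵐ z ∂((volume.restrict (Ioi (0 : ℝ))).prod (volume : Measure ℝ)),
          z.1 ∈ Ioi (0 : ℝ) :=
        Measure.quasiMeasurePreserving_fst.ae (ae_restrict_mem measurableSet_Ioi)
      filter_upwards [h1] with z hz
      have h2 := norm_rho_mul_sin_le hc hz (2 * π * z.2)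
      rw [abs_mul, abs_of_pos (by positivity : (0 : ℝ) < 2 * π)] at h2
      rw [Function.uncurry_def]
      simp only
      rw [← mul_assoc, ← Complex.ofReal_mul, norm_mul, Complex.norm_real]
      calc _ ≤ 2 * π * |z.2| * (z.1 * rho c z.1) * ‖g z.2‖ := by gcongr
        _ = _ := by ring
  have hrw : ∀ s : ℝ, (rho c s : ℂ) * (deriv f (x + s) - deriv f (x - s))
      = ∫ ξ : ℝ, (rho c s : ℂ) * ((sin (2 * π * ξ * s) : ℂ) * g ξ) := by
    intro s
    rw [deriv_sub_deriv_eq, integral_const_mul]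
  simp only [hrw]
  refine ⟨hF.integral_prod_left, ?_⟩
  rw [integral_integral_swap hF]
  refine integral_congr_ae (Filter.Eventually.of_forall fun ξ => ?_)
  simp only [← mul_assoc]
  rw [integral_mul_const, sineRho, ← integral_complex_ofReal]
  push_cast
  ring

end Kernel

/-! ### Identification of T ∂ₓ and T̃ ∂ₓ with Fourier multipliers -/

section Operators

open MeasureTheory Set Real
open scoped FourierTransform

/-- The kernel `coth (π s / 2δ)`. -/
def cothKernel (δ s : ℝ) : ℝ := cosh (π / (2 * δ) * s) / sinh (π / (2 * δ) * s)

theorem measurable_cothKernel (δ : ℝ) : Measurable (cothKernel δ) := by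
  have := Real.continuous_cosh.measurable
  have := Real.continuous_sinh.measurable
  unfold cothKernel
  fun_prop

theorem cothKernel_eq {δ s : ℝ} (hδ : 0 < δ) (hs : 0 < s) :
    cothKernel δ s = 1 + rho (π / δ) s := by
  set y := π / (2 * δ) * s with hy
  have hy0 : 0 < y := by positivity
  have h1 : π / δ * s = y + y := by rw [hy]; field_simp; ring
  have h2 : exp y * exp (-y) = 1 := by rw [← Real.exp_add]; simp
  have h3 : sinh y ≠ 0 := (Real.sinh_pos_iff.2 hy0).ne'
  have h4 : exp (y + y) - 1 ≠ 0 := by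
    have : 1 < exp (y + y) := by rw [Real.one_lt_exp_iff]; positivity
    linarith
  rw [cothKernel, rho, h1, ← hy, div_eq_iff h3]
  rw [one_add_div h4, div_mul_eq_mul_div, eq_div_iff h4, Real.cosh_eq, Real.sinh_eq, Real.exp_add]
  linear_combination exp y * h2

theorem integral_cothKernel {δ : ℝ} (hδ : 0 < δ) (f : 𝓢(ℝ, ℂ)) (x : ℝ) :
    IntegrableOn (fun s => (cothKernel δ s : ℂ) * (deriv f (x + s) - deriv f (x - s))) (Ioi 0) ∧
    ∫ s in Ioi (0 : ℝ), (cothKernel δ s : ℂ) * (deriv f (x + s) - deriv f (x - s))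
      = 2 * δ * Aop δ f x := by
  have hc : 0 < π / δ := by positivity
  have h1 := integral_deriv_sub_deriv f x
  have h2 := integral_rho_deriv hc f x
  have h3 : EqOn (fun s => (cothKernel δ s : ℂ) * (deriv f (x + s) - deriv f (x - s)))
      (fun s => (deriv f (x + s) - deriv f (x - s))
        + (rho (π / δ) s : ℂ) * (deriv f (x + s) - deriv f (x - s))) (Ioi 0) := by
    intro s hs
    simp only [cothKernel_eq hδ hs]
    push_cast
    ring
  refine ⟨(integrableOn_congr_fun h3 measurableSet_Ioi).2 (h1.1.add h2.1), ?_⟩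
  rw [setIntegral_congr_fun measurableSet_Ioi h3, integral_add h1.1 h2.1, h1.2, h2.2]
  have h4 : ∀ ξ : ℝ, (sineRho (π / δ) ξ : ℂ) *
        (-(4 * π * ξ) * (Complex.exp (2 * π * Complex.I * x * ξ) * 𝓕 f ξ))
      = 2 * δ * (Complex.exp (2 * π * Complex.I * x * ξ) * 𝓕 (Aop δ f) ξ)
        + 2 * (Complex.exp (2 * π * Complex.I * x * ξ) * 𝓕 f ξ) := by
    intro ξ
    rw [fourier_Aop hδ, symA]
    have : (δ : ℂ) ≠ 0 := by exact_mod_cast hδ.ne'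
    push_cast
    field_simp
    ring
  simp_rw [h4]
  rw [integral_add ((integrable_exp_mul _ _).const_mul _) ((integrable_exp_mul _ _).const_mul _),
    integral_const_mul, integral_const_mul, ← eq_integral_fourier, ← eq_integral_fourier]
  ring

theorem abs_cothKernel_le {δ ε s : ℝ} (hδ : 0 < δ) (hε : 0 < ε) (hs : ε < s) :
    |cothKernel δ s| ≤ 1 + rho (π / δ) ε := by
  have hc : 0 < π / δ := by positivity
  have h0 : 0 < s := hε.trans hs
  rw [cothKernel_eq hδ h0, abs_of_pos (by have := rho_pos hc h0; linarith)]
  have h1 : exp (π / δ * ε) ≤ exp (π / δ * s) := Real.exp_le_exp.2 (by gcongr)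
  have h2 : 1 < exp (π / δ * ε) := by rw [Real.one_lt_exp_iff]; positivity
  unfold rho
  have : 2 / (exp (π / δ * s) - 1) ≤ 2 / (exp (π / δ * ε) - 1) :=
    div_le_div_of_nonneg_left (by norm_num) (by linarith) (by linarith)
  linarith

/-- Folding around x turns the truncated integrals into integrals over (ε, ∞) of one function that
is integrable on (0, ∞), so the principal value is the full integral. -/
theorem T_deriv {δ : ℝ} (hδ : 0 < δ) (f : 𝓢(ℝ, ℂ)) (x : ℝ) : T δ (deriv f) x = Aop δ f x := by
  have hi : Integrable (deriv f) := (SchwartzMap.derivCLM ℂ ℂ f).integrable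
  obtain ⟨h1, h2⟩ := integral_cothKernel hδ f x
  rw [T]
  refine Filter.Tendsto.limUnder_eq ?_
  have h3 : Filter.Tendsto (fun ε : ℝ => ∫ s in Ioi ε, (cothKernel δ s : ℂ) *
      (deriv f (x + s) - deriv f (x - s))) (nhdsWithin 0 (Ioi 0))
      (nhds (2 * δ * Aop δ f x)) := by
    rw [← h2]
    have ha : AECover (volume.restrict (Ioi (0 : ℝ))) (nhdsWithin (0 : ℝ) (Ioi 0))
        fun ε : ℝ => Ioi ε := aecover_Ioi_of_Ioi (Filter.tendsto_id.mono_left nhdsWithin_le_nhds)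
    refine (ha.integral_tendsto_of_countably_generated h1).congr' ?_
    filter_upwards [self_mem_nhdsWithin] with ε hε
    rw [Measure.restrict_restrict measurableSet_Ioi, Ioi_inter_Ioi, max_eq_left (le_of_lt hε)]
  have h4 : (Aop δ f x) = (1 / (2 * δ) : ℂ) * (2 * δ * Aop δ f x) := by
    have : (δ : ℂ) ≠ 0 := by exact_mod_cast hδ.ne'
    field_simp
  rw [h4]
  refine (h3.const_mul _).congr' ?_
  filter_upwards [self_mem_nhdsWithin] with ε hε
  have hε' : 0 < ε := hε
  rw [← setIntegral_odd_kernel (C := 1 + rho (π / δ) ε) hε'.le (measurable_cothKernel δ) ?_ ?_ hi]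
  · rfl
  · intro s
    simp only [cothKernel, mul_neg, Real.cosh_neg, Real.sinh_neg, div_neg]
  · intro s hs
    exact abs_cothKernel_le hδ hε' hs

/-- The identity tanh y = 2 coth 2y - coth y expresses `T̃` for width δ as the difference of `T` for
the widths δ/2 and δ. -/
theorem Tt_deriv {δ : ℝ} (hδ : 0 < δ) (f : 𝓢(ℝ, ℂ)) (x : ℝ) : Tt δ (deriv f) x = Bop δ f x := by
  have hi : Integrable (deriv f) := (SchwartzMap.derivCLM ℂ ℂ f).integrable
  obtain ⟨h1, h2⟩ := integral_cothKernel hδ f x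
  obtain ⟨h3, h4⟩ := integral_cothKernel (half_pos hδ) f x
  have hδ' : (δ : ℂ) ≠ 0 := by exact_mod_cast hδ.ne'
  have h5 : ∫ y : ℝ, ((tanh (π / (2 * δ) * (y - x)) : ℝ) : ℂ) * deriv f y
      = ∫ s in Ioi (0 : ℝ), (tanh (π / (2 * δ) * s) : ℂ) *
        (deriv f (x + s) - deriv f (x - s)) := by
    rw [← setIntegral_odd_kernel (k := fun s => tanh (π / (2 * δ) * s)) (C := 1) le_rfl ?_ ?_ ?_ hi,
      ← setIntegral_univ]
    -- With ε = 0 the folded domain is the line without the point x, a null set.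
    · refine setIntegral_congr_set ?_
      have h0 : ∀ᵐ y : ℝ, y ≠ x := by simp [ae_iff]
      filter_upwards [h0] with y hy
      have : (0 : ℝ) < |y - x| := abs_pos.2 (sub_ne_zero.2 hy)
      exact propext ⟨fun _ => this, fun _ => trivial⟩
    · have : Measurable tanh := by
        have h : tanh = fun x => sinh x / cosh x := funext Real.tanh_eq_sinh_div_cosh
        rw [h]
        exact Real.continuous_sinh.measurable.div Real.continuous_cosh.measurable
      fun_prop
    · intro s; simp
    · intro s _
      exact (Real.abs_tanh_lt_one _).le
  have h6 : EqOn (fun s : ℝ => (tanh (π / (2 * δ) * s) : ℂ) * (deriv f (x + s) - deriv f (x - s)))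
      (fun s => 2 * ((cothKernel (δ / 2) s : ℂ) * (deriv f (x + s) - deriv f (x - s)))
        - (cothKernel δ s : ℂ) * (deriv f (x + s) - deriv f (x - s))) (Ioi 0) := by
    intro s hs
    have hs' : 0 < s := hs
    have e : tanh (π / (2 * δ) * s) = 2 * cothKernel (δ / 2) s - cothKernel δ s := by
      rw [cothKernel, cothKernel, show π / (2 * (δ / 2)) * s = 2 * (π / (2 * δ) * s) by field_simp]
      set y := π / (2 * δ) * s with hy
      have hy0 : 0 < y := by positivity
      have a1 : sinh y ≠ 0 := (Real.sinh_pos_iff.2 hy0).ne'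
      have a2 : cosh y ≠ 0 := (Real.cosh_pos y).ne'
      rw [Real.tanh_eq_sinh_div_cosh, Real.cosh_two_mul, Real.sinh_two_mul]
      field_simp
      ring
    simp only [e]
    push_cast
    ring
  rw [Tt, h5, setIntegral_congr_fun measurableSet_Ioi h6, integral_sub (h3.const_mul 2) h1,
    integral_const_mul, h2, h4, Bop, sub_apply]
  simp only [sub_apply]
  push_cast
  field_simp

theorem symA_eq {δ ξ : ℝ} (hδ : 0 < δ) (hξ : ξ ≠ 0) :
    symA δ ξ = -(2 * π * ξ) * (cosh (2 * π * δ * ξ) / sinh (2 * π * δ * ξ)) := by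
  rw [symA, sineRho_eq hδ hξ]
  have := Real.pi_pos
  field_simp
  ring

theorem symA_zero (δ : ℝ) : symA δ 0 = -(1 / δ) := by simp [symA]

theorem symA_neg (δ ξ : ℝ) : symA δ (-ξ) = symA δ ξ := by
  have : sineRho (π / δ) (-ξ) = -sineRho (π / δ) ξ := by
    rw [sineRho, sineRho, ← integral_neg]
    refine integral_congr_ae (Filter.Eventually.of_forall fun s => ?_)
    simp only [mul_neg, neg_mul, Real.sin_neg]
  rw [symA, symA, this]
  ring

/-- The symbol `-2πξ / sinh (2πδξ)` of `T̃ ∂ₓ`. -/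
def symB (δ ξ : ℝ) : ℝ := symA (δ / 2) ξ - symA δ ξ

theorem symB_eq {δ ξ : ℝ} (hδ : 0 < δ) (hξ : ξ ≠ 0) :
    symB δ ξ = -(2 * π * ξ) / sinh (2 * π * δ * ξ) := by
  rw [symB, symA_eq hδ hξ, symA_eq (half_pos hδ) hξ]
  have hpi := Real.pi_pos
  set y := π * δ * ξ with hy
  have hy0 : y ≠ 0 := by positivity
  rw [show 2 * π * (δ / 2) * ξ = y by rw [hy]; ring, show 2 * π * δ * ξ = 2 * y by rw [hy]; ring]
  have a1 : sinh y ≠ 0 := by rwa [Ne, Real.sinh_eq_zero]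
  have a2 : cosh y ≠ 0 := (Real.cosh_pos y).ne'
  rw [Real.cosh_two_mul, Real.sinh_two_mul]
  have := Real.cosh_sq y
  field_simp
  rw [this]
  ring

theorem symB_zero {δ : ℝ} : symB δ 0 = -(1 / δ) := by
  rw [symB, symA_zero, symA_zero]
  field_simp
  ring

theorem symB_neg (δ ξ : ℝ) : symB δ (-ξ) = symB δ ξ := by
  rw [symB, symB, symA_neg, symA_neg]

theorem fourier_Bop {δ : ℝ} (hδ : 0 < δ) (f : 𝓢(ℝ, ℂ)) (ξ : ℝ) :
    𝓕 (Bop δ f) ξ = symB δ ξ * 𝓕 f ξ := by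
  rw [Bop, sub_apply, sub_eq_add_neg, FourierTransform.fourier_add, FourierTransform.fourier_neg, add_apply,
    neg_apply,
    fourier_Aop hδ, fourier_Aop (half_pos hδ), symB]
  push_cast
  ring

end Operators

/-! ### Products, symmetric multipliers and strip functions -/

section Algebra

open MeasureTheory Set Real
open scoped FourierTransform

/-- The derivative as an operator on Schwartz functions. -/
abbrev Dop : 𝓢(ℝ, ℂ) →L[ℂ] 𝓢(ℝ, ℂ) := SchwartzMap.derivCLM ℂ ℂ

theorem Dop_apply (f : 𝓢(ℝ, ℂ)) (x : ℝ) : Dop f x = deriv f x := SchwartzMap.derivCLM_apply ℂ f x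

theorem coe_Dop (f : 𝓢(ℝ, ℂ)) : ⇑(Dop f) = deriv f := funext (Dop_apply f)

/-- The product of two Schwartz functions. -/
def mulS (f g : 𝓢(ℝ, ℂ)) : 𝓢(ℝ, ℂ) := SchwartzMap.pairing (ContinuousLinearMap.mul ℂ ℂ) f g

@[simp] theorem mulS_apply (f g : 𝓢(ℝ, ℂ)) (x : ℝ) : mulS f g x = f x * g x := by
  simp [mulS, SchwartzMap.pairing_apply_apply]

theorem Dop_mulS (f g : 𝓢(ℝ, ℂ)) : Dop (mulS f g) = mulS (Dop f) g + mulS f (Dop g) := by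
  ext x
  have h : ⇑(mulS f g) = fun x => f x * g x := funext (mulS_apply f g)
  rw [Dop_apply, h, deriv_fun_mul f.differentiableAt g.differentiableAt, add_apply, mulS_apply,
    mulS_apply, Dop_apply, Dop_apply]

theorem seminorm_mulS_le (k l : ℕ) (f g : 𝓢(ℝ, ℂ)) :
    SchwartzMap.seminorm ℂ k l (mulS f g) ≤ ∑ i ∈ Finset.range (l + 1),
      (l.choose i : ℝ) * (SchwartzMap.seminorm ℂ k i f * SchwartzMap.seminorm ℂ 0 (l - i) g) := by
  refine SchwartzMap.seminorm_le_bound ℂ k l _ (by positivity) fun x => ?_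
  have h : ⇑(mulS f g) = fun x => f x * g x := funext (mulS_apply f g)
  rw [h]
  refine (mul_le_mul_of_nonneg_left (norm_iteratedFDeriv_mul_le (N := ((⊤ : ℕ∞) : WithTop ℕ∞)) (n := l) (f.smooth ⊤)
    (g.smooth ⊤) x (by exact_mod_cast le_top)) (by positivity)).trans ?_
  rw [Finset.mul_sum]
  refine Finset.sum_le_sum fun i _ => ?_
  have h1 := SchwartzMap.le_seminorm ℂ k i f x
  have h2 := SchwartzMap.norm_iteratedFDeriv_le_seminorm ℂ g (l - i) x
  calc _ = (l.choose i : ℝ) * ((‖x‖ ^ k * ‖iteratedFDeriv ℝ i (⇑f) x‖)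
        * ‖iteratedFDeriv ℝ (l - i) (⇑g) x‖) := by ring
    _ ≤ _ := by gcongr

/-- The difference of two products splits bilinearly into three terms. The Leibniz bound
`seminorm_mulS_le` controls each by a continuous expression in seminorms that vanishes at the limit.
-/
theorem continuous_mulS : Continuous fun p : 𝓢(ℝ, ℂ) × 𝓢(ℝ, ℂ) => mulS p.1 p.2 := by
  have hw := schwartz_withSeminorms ℂ ℝ ℂ
  rw [continuous_iff_continuousAt]
  rintro ⟨f₀, g₀⟩
  refine (hw.tendsto_nhds _ _).2 ?_
  rintro ⟨k, l⟩ ε hε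
  have hc : ∀ i j, Continuous fun f : 𝓢(ℝ, ℂ) => SchwartzMap.seminorm ℂ i j f := fun i j =>
    hw.continuous_seminorm (i, j)
  obtain ⟨B, hB⟩ : ∃ B : 𝓢(ℝ, ℂ) → 𝓢(ℝ, ℂ) → ℝ, ∀ f g, B f g = ∑ i ∈ Finset.range (l + 1),
      (l.choose i : ℝ) * (SchwartzMap.seminorm ℂ k i f * SchwartzMap.seminorm ℂ 0 (l - i) g) :=
    ⟨_, fun _ _ => rfl⟩
  have hcB : Continuous fun p : 𝓢(ℝ, ℂ) × 𝓢(ℝ, ℂ) => B p.1 p.2 := by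
    simp only [hB]
    exact continuous_finsetSum _ fun i _ => continuous_const.mul
      (((hc k i).comp continuous_fst).mul ((hc 0 (l - i)).comp continuous_snd))
  have hB1 : ∀ g, B 0 g = 0 := fun g => by rw [hB]; simp
  have hB2 : ∀ f, B f 0 = 0 := fun f => by rw [hB]; simp
  have t1 : Filter.Tendsto (fun p : 𝓢(ℝ, ℂ) × 𝓢(ℝ, ℂ) => p.1 - f₀) (nhds (f₀, g₀)) (nhds 0) := by
    have := (continuous_fst.tendsto (f₀, g₀)).sub_const f₀
    rwa [sub_self] at this
  have t2 : Filter.Tendsto (fun p : 𝓢(ℝ, ℂ) × 𝓢(ℝ, ℂ) => p.2 - g₀) (nhds (f₀, g₀)) (nhds 0) := by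
    have := (continuous_snd.tendsto (f₀, g₀)).sub_const g₀
    rwa [sub_self] at this
  have hlim : Filter.Tendsto (fun p : 𝓢(ℝ, ℂ) × 𝓢(ℝ, ℂ) => B (p.1 - f₀) (p.2 - g₀)
      + B f₀ (p.2 - g₀) + B (p.1 - f₀) g₀) (nhds (f₀, g₀)) (nhds 0) := by
    have s1 := (hcB.tendsto (0, 0)).comp (t1.prodMk_nhds t2)
    have s2 := (hcB.tendsto (f₀, 0)).comp ((tendsto_const_nhds (x := f₀)).prodMk_nhds t2)
    have s3 := (hcB.tendsto (0, g₀)).comp (t1.prodMk_nhds (tendsto_const_nhds (x := g₀)))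
    have := (s1.add s2).add s3
    simp only [hB1, hB2, add_zero] at this
    exact this
  filter_upwards [hlim.eventually (gt_mem_nhds hε)] with p hp
  change SchwartzMap.seminorm ℂ k l _ < ε
  have e : mulS p.1 p.2 - mulS f₀ g₀
      = mulS (p.1 - f₀) (p.2 - g₀) + mulS f₀ (p.2 - g₀) + mulS (p.1 - f₀) g₀ := by
    ext x
    simp only [sub_apply, add_apply, mulS_apply]
    ring
  rw [e]
  refine lt_of_le_of_lt ?_ hp
  refine (map_add_le_add _ _ _).trans (add_le_add ((map_add_le_add _ _ _).trans (add_le_add ?_ ?_)) ?_)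
  all_goals
    rw [hB]
    exact seminorm_mulS_le _ _ _ _

theorem fourier_neg_eq_fourierInv (f : 𝓢(ℝ, ℂ)) (ξ : ℝ) : 𝓕 f ξ = 𝓕⁻ f (-ξ) := by
  rw [SchwartzMap.fourierInv_coe, SchwartzMap.fourier_coe, Real.fourierInv_eq_fourier_neg, neg_neg]

/-- The convolution is written so that the frequencies -t and ξ + t add up to ξ. Exponential weights
then factor, and at ξ = 0 it is a bilinear Parseval formula. -/
theorem fourier_mulS (f g : 𝓢(ℝ, ℂ)) (ξ : ℝ) :
    𝓕 (mulS f g) ξ = ∫ t, 𝓕 f (-t) * 𝓕 g (ξ + t) := by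
  have h1 : 𝓕⁻ (mulS f g) = SchwartzMap.convolution (ContinuousLinearMap.mul ℂ ℂ) (𝓕⁻ f) (𝓕⁻ g) := by
    rw [← FourierTransform.fourierInv_fourier_eq (F := 𝓢(ℝ,ℂ))
      (SchwartzMap.convolution (ContinuousLinearMap.mul ℂ ℂ) (𝓕⁻ f) (𝓕⁻ g)),
      SchwartzMap.fourier_convolution, FourierTransform.fourier_fourierInv_eq,
      FourierTransform.fourier_fourierInv_eq, mulS]
  rw [fourier_neg_eq_fourierInv, h1, SchwartzMap.convolution_apply, convolution_def]
  refine integral_congr_ae (Filter.Eventually.of_forall fun t => ?_)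
  simp only [ContinuousLinearMap.mul_apply', fourier_neg_eq_fourierInv, neg_neg]
  ring_nf

theorem fourier_zero_eq_integral (f : 𝓢(ℝ, ℂ)) : 𝓕 f 0 = ∫ x, f x := by
  rw [SchwartzMap.fourier_coe, Real.fourier_real_eq_integral_exp_smul]
  simp

theorem ext_fourier {f g : 𝓢(ℝ, ℂ)} (h : ∀ ξ, 𝓕 f ξ = 𝓕 g ξ) : f = g := by
  rw [← FourierTransform.fourierInv_fourier_eq (F := 𝓢(ℝ,ℂ)) f,
    ← FourierTransform.fourierInv_fourier_eq (F := 𝓢(ℝ,ℂ)) g, SchwartzMap.ext h]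

theorem fourier_add_apply (f g : 𝓢(ℝ, ℂ)) (ξ : ℝ) : 𝓕 (f + g) ξ = 𝓕 f ξ + 𝓕 g ξ := by
  rw [FourierTransform.fourier_add, add_apply]

theorem fourier_neg_apply (f : 𝓢(ℝ, ℂ)) (ξ : ℝ) : 𝓕 (-f) ξ = -𝓕 f ξ := by
  rw [FourierTransform.fourier_neg, neg_apply]

theorem fourier_sub_apply (f g : 𝓢(ℝ, ℂ)) (ξ : ℝ) : 𝓕 (f - g) ξ = 𝓕 f ξ - 𝓕 g ξ := by
  rw [sub_eq_add_neg, fourier_add_apply, fourier_neg_apply, sub_eq_add_neg]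

theorem fourier_smul_apply (c : ℂ) (f : 𝓢(ℝ, ℂ)) (ξ : ℝ) : 𝓕 (c • f) ξ = c * 𝓕 f ξ := by
  rw [FourierTransform.fourier_smul, smul_apply, smul_eq_mul]

/-- By Parseval both integrals are ∫ f̂(-t) m(t) ĝ(t) dt up to t ↦ -t, and an even multiplier does
not see that reflection. -/
theorem integral_mulS_comm_of_even {L : 𝓢(ℝ, ℂ) → 𝓢(ℝ, ℂ)} {m : ℝ → ℂ}
    (hL : ∀ f ξ, 𝓕 (L f) ξ = m ξ * 𝓕 f ξ) (hm : ∀ ξ, m (-ξ) = m ξ) (f g : 𝓢(ℝ, ℂ)) :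
    ∫ x, f x * L g x = ∫ x, g x * L f x := by
  simp_rw [← mulS_apply]
  rw [← fourier_zero_eq_integral, ← fourier_zero_eq_integral, fourier_mulS, fourier_mulS,
    ← integral_neg_eq_self]
  refine integral_congr_ae (Filter.Eventually.of_forall fun t => ?_)
  simp only [hL, zero_add, neg_neg, hm]
  ring

theorem integral_mul_Aop {δ : ℝ} (hδ : 0 < δ) (f g : 𝓢(ℝ, ℂ)) :
    ∫ x, f x * Aop δ g x = ∫ x, g x * Aop δ f x :=
  integral_mulS_comm_of_even (fourier_Aop hδ) (fun ξ => by rw [symA_neg]) f g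

theorem integral_mul_Bop {δ : ℝ} (hδ : 0 < δ) (f g : 𝓢(ℝ, ℂ)) :
    ∫ x, f x * Bop δ g x = ∫ x, g x * Bop δ f x :=
  integral_mulS_comm_of_even (fourier_Bop hδ) (fun ξ => by rw [symB_neg]) f g

theorem integral_Aop {δ : ℝ} (hδ : 0 < δ) (f : 𝓢(ℝ, ℂ)) :
    ∫ x, Aop δ f x = -(1 / δ) * ∫ x, f x := by
  rw [← fourier_zero_eq_integral, ← fourier_zero_eq_integral, fourier_Aop hδ, symA_zero]
  push_cast
  rfl

theorem integral_Bop {δ : ℝ} (hδ : 0 < δ) (f : 𝓢(ℝ, ℂ)) :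
    ∫ x, Bop δ f x = -(1 / δ) * ∫ x, f x := by
  rw [← fourier_zero_eq_integral, ← fourier_zero_eq_integral, fourier_Bop hδ, symB_zero]
  push_cast
  rfl

theorem integral_Dop (f : 𝓢(ℝ, ℂ)) : ∫ x, Dop f x = 0 := by
  rw [← fourier_zero_eq_integral, fourier_derivCLM]
  simp

theorem Dop_Aop {δ : ℝ} (hδ : 0 < δ) (f : 𝓢(ℝ, ℂ)) : Dop (Aop δ f) = Aop δ (Dop f) :=
  ext_fourier fun ξ => by
    rw [fourier_derivCLM, fourier_Aop hδ, fourier_Aop hδ, fourier_derivCLM]; ring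

theorem Dop_Bop {δ : ℝ} (hδ : 0 < δ) (f : 𝓢(ℝ, ℂ)) : Dop (Bop δ f) = Bop δ (Dop f) :=
  ext_fourier fun ξ => by
    rw [fourier_derivCLM, fourier_Bop hδ, fourier_Bop hδ, fourier_derivCLM]; ring

theorem deriv_conjS (f : 𝓢(ℝ, ℂ)) (x : ℝ) : deriv (conjS f) x = (starRingEnd ℂ) (deriv f x) := by
  have h := (Complex.conjCLE : ℂ →L[ℝ] ℂ).hasFDerivAt.comp_hasDerivAt x (f.hasDerivAt x)
  exact h.deriv

theorem Dop_conjS (f : 𝓢(ℝ, ℂ)) : Dop (conjS f) = conjS (Dop f) := by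
  ext x
  rw [Dop_apply, deriv_conjS, conjS_apply, Dop_apply]

/-- The singular integral that represents `Aop` has a real kernel. -/
theorem Aop_conjS {δ : ℝ} (hδ : 0 < δ) (f : 𝓢(ℝ, ℂ)) : Aop δ (conjS f) = conjS (Aop δ f) := by
  ext x
  have hδ' : (δ : ℂ) ≠ 0 := by exact_mod_cast hδ.ne'
  have h1 := (integral_cothKernel hδ f x).2
  have h2 := (integral_cothKernel hδ (conjS f) x).2
  have h3 := congrArg (starRingEnd ℂ) h1
  rw [← integral_conj] at h3
  simp only [deriv_conjS] at h2
  simp only [map_mul, map_sub, Complex.conj_ofReal, map_ofNat] at h3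
  rw [h2] at h3
  rw [conjS_apply]
  exact mul_left_cancel₀ (mul_ne_zero two_ne_zero hδ') h3

theorem conjS_sub (f g : 𝓢(ℝ, ℂ)) : conjS (f - g) = conjS f - conjS g := by
  ext x; simp [conjS_apply]

theorem conjS_add (f g : 𝓢(ℝ, ℂ)) : conjS (f + g) = conjS f + conjS g := by
  ext x; simp [conjS_apply]

theorem conjS_conjS (f : 𝓢(ℝ, ℂ)) : conjS (conjS f) = f := by
  ext x; simp [conjS_apply]

theorem Bop_conjS {δ : ℝ} (hδ : 0 < δ) (f : 𝓢(ℝ, ℂ)) : Bop δ (conjS f) = conjS (Bop δ f) := by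
  rw [Bop, sub_apply, sub_apply, Aop_conjS hδ, Aop_conjS (half_pos hδ), conjS_sub]

/-- `f` and `g` are the boundary values, at the bottom and at the top, of a function that is
analytic in the strip `0 < Im z < δ`. -/
def IsStripPair (δ : ℝ) (f g : 𝓢(ℝ, ℂ)) : Prop :=
  ∀ ξ : ℝ, 𝓕 g ξ = (exp (-(2 * π * δ * ξ)) : ℝ) * 𝓕 f ξ

namespace IsStripPair

variable {δ : ℝ} {f g f' g' : 𝓢(ℝ, ℂ)}

theorem add (h : IsStripPair δ f g) (h' : IsStripPair δ f' g') :
    IsStripPair δ (f + f') (g + g') := fun ξ => by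
  rw [fourier_add_apply, fourier_add_apply, h, h', mul_add]

theorem sub (h : IsStripPair δ f g) (h' : IsStripPair δ f' g') :
    IsStripPair δ (f - f') (g - g') := fun ξ => by
  rw [fourier_sub_apply, fourier_sub_apply, h, h', mul_sub]

theorem smul (h : IsStripPair δ f g) (c : ℂ) : IsStripPair δ (c • f) (c • g) := fun ξ => by
  rw [fourier_smul_apply, fourier_smul_apply, h]; ring

theorem zero : IsStripPair δ 0 0 := fun ξ => by simp [FourierTransform.fourier_zero]

theorem sum {ι : Type*} (s : Finset ι) {F G : ι → 𝓢(ℝ, ℂ)}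
    (h : ∀ i ∈ s, IsStripPair δ (F i) (G i)) : IsStripPair δ (∑ i ∈ s, F i) (∑ i ∈ s, G i) := by
  classical
  induction s using Finset.induction_on with
  | empty => simpa using zero
  | insert a s ha ih =>
    rw [Finset.sum_insert ha, Finset.sum_insert ha]
    exact (h a (Finset.mem_insert_self a s)).add
      (ih fun i hi => h i (Finset.mem_insert_of_mem hi))

theorem map_Dop (h : IsStripPair δ f g) : IsStripPair δ (Dop f) (Dop g) := fun ξ => by
  rw [fourier_derivCLM, fourier_derivCLM, h]; ring

/-- The weight e^{-2πδξ} is multiplicative in ξ, so it factors through the convolution. -/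
theorem mul (h : IsStripPair δ f g) (h' : IsStripPair δ f' g') :
    IsStripPair δ (mulS f f') (mulS g g') := fun ξ => by
  rw [fourier_mulS, fourier_mulS, ← integral_const_mul]
  refine integral_congr_ae (Filter.Eventually.of_forall fun t => ?_)
  simp only [h (-t), h' (ξ + t)]
  have : exp (-(2 * π * δ * ξ)) = exp (-(2 * π * δ * -t)) * exp (-(2 * π * δ * (ξ + t))) := by
    rw [← Real.exp_add]; ring_nf
  rw [this]
  push_cast
  ring

/-- Cauchy's theorem for shifting the contour: the weight equals 1 at ξ = 0. All conservation laws
rest on this. -/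
theorem integral_eq (h : IsStripPair δ f g) : ∫ x, g x = ∫ x, f x := by
  rw [← fourier_zero_eq_integral, ← fourier_zero_eq_integral, h]
  simp

/-- A function analytic on the cylinder that decays at infinity vanishes. -/
theorem eq_zero_of_no_jump (hδ : 0 < δ) (h : IsStripPair δ f g) (h' : IsStripPair δ g f) :
    f = 0 := by
  have h1 : ∀ ξ ≠ 0, 𝓕 f ξ = 0 := by
    intro ξ hξ
    have e := h' ξ
    rw [h ξ, ← mul_assoc, ← Complex.ofReal_mul, ← Real.exp_add] at e
    have hne : exp (-(2 * π * δ * ξ) + -(2 * π * δ * ξ)) ≠ 1 := by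
      rw [Ne, Real.exp_eq_one_iff]
      have : 2 * π * δ * ξ ≠ 0 := by have := Real.pi_pos; positivity
      intro h0
      apply this
      linarith
    have h2 : (1 - ((exp (-(2 * π * δ * ξ) + -(2 * π * δ * ξ)) : ℝ) : ℂ)) * 𝓕 f ξ = 0 := by
      rw [sub_mul, ← e, one_mul, sub_self]
    refine (mul_eq_zero.1 h2).resolve_left (sub_ne_zero.2 ?_)
    exact_mod_cast hne.symm
  have h2 : ⇑(𝓕 f : 𝓢(ℝ, ℂ)) = fun _ => (0 : ℂ) :=
    Continuous.ext_on (dense_compl_singleton (0 : ℝ)) (𝓕 f : 𝓢(ℝ, ℂ)).continuous continuous_const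
      fun ξ hξ => h1 ξ hξ
  refine ext_fourier fun ξ => ?_
  rw [h2, FourierTransform.fourier_zero]
  rfl

end IsStripPair

/-- The boundary values at the top of the derivatives of the functions with jumps `f` and `g`. -/
def liftTop (δ : ℝ) (f g : 𝓢(ℝ, ℂ)) : 𝓢(ℝ, ℂ) :=
  (1 / 2 : ℂ) • (Dop f + Complex.I • (Aop δ f + Bop δ g))

/-- The boundary values at the bottom of the derivatives of the functions with jumps `f` and `g`. -/
def liftBot (δ : ℝ) (f g : 𝓢(ℝ, ℂ)) : 𝓢(ℝ, ℂ) :=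
  (1 / 2 : ℂ) • (-Dop f + Complex.I • (Aop δ f + Bop δ g))

theorem liftTop_sub_liftBot (δ : ℝ) (f g : 𝓢(ℝ, ℂ)) :
    liftTop δ f g - liftBot δ f g = Dop f := by
  ext x
  simp only [liftTop, liftBot, sub_apply, smul_apply, add_apply, neg_apply, smul_eq_mul]
  ring

/-- Matching the coefficients of the two transforms leaves two identities between the symbols A, B:
2πξ + A = e^{-2πδξ} B and B = e^{-2πδξ} (A - 2πξ). The second is cosh² - sinh² = 1. -/
theorem isStripPair_lift {δ : ℝ} (hδ : 0 < δ) (f g : 𝓢(ℝ, ℂ)) :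
    IsStripPair δ (liftBot δ g f) (liftTop δ f g) := by
  intro ξ
  simp only [liftTop, liftBot, fourier_smul_apply, fourier_add_apply, fourier_neg_apply,
    fourier_derivCLM, fourier_Aop hδ, fourier_Bop hδ]
  by_cases hξ : ξ = 0
  · subst hξ
    simp [symA_zero, symB_zero]
    ring
  · have hy : 2 * π * δ * ξ ≠ 0 := by have := Real.pi_pos; positivity
    have hs : sinh (2 * π * δ * ξ) ≠ 0 := by rwa [Ne, Real.sinh_eq_zero]
    have e1 : 2 * π * ξ + symA δ ξ = exp (-(2 * π * δ * ξ)) * symB δ ξ := by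
      rw [symA_eq hδ hξ, symB_eq hδ hξ, ← Real.cosh_sub_sinh]
      field_simp
      ring
    have e2 : symB δ ξ = exp (-(2 * π * δ * ξ)) * (-(2 * π * ξ) + symA δ ξ) := by
      rw [symA_eq hδ hξ, symB_eq hδ hξ, ← Real.cosh_sub_sinh]
      have := Real.cosh_sq (2 * π * δ * ξ)
      generalize cosh (2 * π * δ * ξ) = C at *
      generalize sinh (2 * π * δ * ξ) = S at *
      field_simp
      linear_combination this
    have h1 : (2 * π * ξ + symA δ ξ : ℂ) = (exp (-(2 * π * δ * ξ)) : ℝ) * symB δ ξ := by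
      exact_mod_cast e1
    have h2 : (symB δ ξ : ℂ) = (exp (-(2 * π * δ * ξ)) : ℝ) * (-(2 * π * ξ) + symA δ ξ) := by
      exact_mod_cast e2
    linear_combination (1 / 2 * Complex.I * 𝓕 f ξ) * h1 + (1 / 2 * Complex.I * 𝓕 g ξ) * h2

/-- Uniqueness of the lift: it is determined by the jumps. -/
theorem IsStripPair.eq_lift {δ : ℝ} (hδ : 0 < δ) {p₁ q₁ p₂ q₂ f g : 𝓢(ℝ, ℂ)}
    (h₁ : IsStripPair δ p₁ q₁) (h₂ : IsStripPair δ p₂ q₂)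
    (hf : q₂ - p₁ = Dop f) (hg : q₁ - p₂ = Dop g) :
    q₂ = liftTop δ f g ∧ p₂ = liftBot δ g f := by
  have a1 := h₁.sub (isStripPair_lift hδ g f)
  have a2 := h₂.sub (isStripPair_lift hδ f g)
  have b1 : q₂ - liftTop δ f g = p₁ - liftBot δ f g := by
    rw [sub_eq_sub_iff_sub_eq_sub, hf, liftTop_sub_liftBot]
  have b2 : q₁ - liftTop δ g f = p₂ - liftBot δ g f := by
    rw [sub_eq_sub_iff_sub_eq_sub, hg, liftTop_sub_liftBot]
  -- The differences from the lifts have no jumps, so they form strip pairs in both orders.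
  rw [← b1, b2] at a1
  have c1 := IsStripPair.eq_zero_of_no_jump hδ a1 a2
  have c2 := IsStripPair.eq_zero_of_no_jump hδ a2 a1
  exact ⟨sub_eq_zero.1 c1, sub_eq_zero.1 c2⟩

end Algebra

/-! ### The recursive solution of the exponential relations -/

section Recursion

open PowerSeries

/-- The top coefficient of f is split off. The index `n - 1 - k + 1` is n - k for k < n, written so
that it matches an exponential of the form 1 + X e. -/
theorem coeff_succ_fexp_eq {f : PowerSeries ℂ} (hf : constantCoeff f = 0) (n : ℕ) :
    coeff (n + 1) (fexp f) = coeff (n + 1) f + (1 / (n + 1) : ℂ) * ∑ k ∈ Finset.range n,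
      ((k : ℂ) + 1) * (coeff (k + 1) f * coeff (n - 1 - k + 1) (fexp f)) := by
  rw [coeff_succ_fexp hf, ← Finset.Nat.sum_antidiagonal_swap,
    Finset.Nat.sum_antidiagonal_eq_sum_range_succ_mk, Finset.sum_range_succ]
  have h : (n + 1 : ℂ) ≠ 0 := Nat.cast_add_one_ne_zero n
  simp only [Prod.swap_prod_mk, Nat.sub_self, coeff_zero_eq_constantCoeff, constantCoeff_fexp hf]
  rw [mul_add, add_comm]
  congr 1
  · field_simp
  · congr 1
    refine Finset.sum_congr rfl fun k hk => ?_
    have : n - 1 - k + 1 = n - k := by have := Finset.mem_range.1 hk; omega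
    rw [this]
    ring

theorem coeff_fexp_congr {f g : PowerSeries ℂ} (hf : constantCoeff f = 0)
    (hg : constantCoeff g = 0) {n : ℕ} (h : ∀ m ≤ n, coeff m f = coeff m g) :
    coeff n (fexp f) = coeff n (fexp g) := by
  induction n using Nat.strong_induction_on with
  | _ n ih =>
    cases n with
    | zero => simp [constantCoeff_fexp hf, constantCoeff_fexp hg]
    | succ n =>
      rw [coeff_succ_fexp_eq hf, coeff_succ_fexp_eq hg, h _ le_rfl]
      congr 2
      refine Finset.sum_congr rfl fun k hk => ?_
      have := Finset.mem_range.1 hk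
      rw [h (k + 1) (by omega), ih (n - 1 - k + 1) (by omega) fun m hm => h m (by omega)]

/-- The coefficient with index n + 1 enters linearly and with factor 1; the rest sees only the
truncated series. -/
theorem coeff_fexp_truncation {f : ℕ → ℂ} (hf : f 0 = 0) (n : ℕ) :
    coeff (n + 1) (fexp (ser f))
      = f (n + 1) + coeff (n + 1) (fexp (ser fun m => if m ≤ n then f m else 0)) := by
  have h1 : constantCoeff (ser f) = 0 := by rw [constantCoeff_ser, hf]
  have h2 : constantCoeff (ser fun m => if m ≤ n then f m else 0) = 0 := by
    rw [constantCoeff_ser]; simp [hf]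
  rw [coeff_succ_fexp_eq h1, coeff_succ_fexp_eq h2, coeff_ser, coeff_ser, if_neg (by omega),
    zero_add]
  congr 2
  refine Finset.sum_congr rfl fun k hk => ?_
  have := Finset.mem_range.1 hk
  rw [coeff_ser, coeff_ser, if_pos (by omega)]
  congr 2
  refine coeff_fexp_congr h1 h2 fun m hm => ?_
  rw [coeff_ser, coeff_ser, if_pos (by omega)]

/-- Recursion for the logarithm of a formal power series. -/
theorem fexp_ser_eq_iff {w e : ℕ → ℂ} (hw : w 0 = 0) :
    fexp (ser w) = 1 + X * ser e ↔ ∀ n, w (n + 1) = e n - (1 / (n + 1) : ℂ) *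
      ∑ k ∈ Finset.range n, ((k : ℂ) + 1) * (w (k + 1) * e (n - 1 - k)) := by
  have h1 : constantCoeff (ser w) = 0 := by rw [constantCoeff_ser, hw]
  have h2 : fexp (ser w) = 1 + X * ser e ↔ ∀ n, coeff (n + 1) (fexp (ser w)) = e n := by
    constructor
    · intro h n
      rw [h, map_add, coeff_succ_X_mul, coeff_ser, coeff_one, if_neg (by omega), zero_add]
    · intro h
      ext n
      cases n with
      | zero => simp [constantCoeff_fexp h1]
      | succ n => rw [h, map_add, coeff_succ_X_mul, coeff_ser, coeff_one, if_neg (by omega), zero_add]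
  rw [h2]
  have h3 := coeff_succ_fexp_eq h1
  simp only [coeff_ser] at h3
  constructor
  · intro h n
    have := h3 n
    simp only [h] at this
    rw [this]
    ring
  · intro h n
    induction n using Nat.strong_induction_on with
    | _ n ih =>
      rw [h3, h n, sub_add_eq_add_sub, add_sub_assoc, ← mul_sub, ← Finset.sum_sub_distrib]
      rw [Finset.sum_eq_zero, mul_zero, add_zero]
      intro k hk
      have := Finset.mem_range.1 hk
      rw [ih (n - 1 - k) (by omega), sub_self]

/-- The nonlocal linear part of the first relation. -/
def linU (δ : ℝ) (ι : ℂ) (p : 𝓢(ℝ, ℂ) × 𝓢(ℝ, ℂ)) : 𝓢(ℝ, ℂ) :=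
  (ι / 2) • Dop p.1 - (1 / 2 : ℂ) • (Aop δ p.1 + Bop δ p.2)

/-- The nonlocal linear part of the second relation. -/
def linV (δ : ℝ) (ι : ℂ) (p : 𝓢(ℝ, ℂ) × 𝓢(ℝ, ℂ)) : 𝓢(ℝ, ℂ) :=
  (ι / 2) • Dop p.2 + (1 / 2 : ℂ) • (Aop δ p.2 + Bop δ p.1)

/-- The coefficients of `(exp (-s₁) - 1) / X`, in terms of those of the solution. -/
def expU (δ : ℝ) (ι : ℂ) (u : 𝓢(ℝ, ℂ)) (n : ℕ) (p : 𝓢(ℝ, ℂ) × 𝓢(ℝ, ℂ)) : 𝓢(ℝ, ℂ) :=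
  linU δ ι p - if n = 0 then u else 0

/-- The coefficients of `(exp s₂ - 1) / X`, in terms of those of the solution. -/
def expV (δ : ℝ) (ι : ℂ) (v : 𝓢(ℝ, ℂ)) (n : ℕ) (p : 𝓢(ℝ, ℂ) × 𝓢(ℝ, ℂ)) : 𝓢(ℝ, ℂ) :=
  (if n = 0 then v else 0) - linV δ ι p

/-- The recursive solution of the relations. -/
def sol (δ : ℝ) (ι : ℂ) (u v : 𝓢(ℝ, ℂ)) : ℕ → 𝓢(ℝ, ℂ) × 𝓢(ℝ, ℂ)
  | 0 => 0
  | n + 1 =>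
    (-expU δ ι u n (sol δ ι u v n) - (1 / (n + 1) : ℂ) • ∑ k : Fin n,
      ((k : ℂ) + 1) • mulS (sol δ ι u v (k + 1)).1 (expU δ ι u (n - 1 - k) (sol δ ι u v (n - 1 - k))),
    expV δ ι v n (sol δ ι u v n) - (1 / (n + 1) : ℂ) • ∑ k : Fin n,
      ((k : ℂ) + 1) • mulS (sol δ ι u v (k + 1)).2 (expV δ ι v (n - 1 - k) (sol δ ι u v (n - 1 - k))))
termination_by n => n
decreasing_by all_goals omega

theorem sol_zero (δ : ℝ) (ι : ℂ) (u v : 𝓢(ℝ, ℂ)) : sol δ ι u v 0 = 0 := by rw [sol]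

theorem sol_succ_fst (δ : ℝ) (ι : ℂ) (u v : 𝓢(ℝ, ℂ)) (n : ℕ) : (sol δ ι u v (n + 1)).1
    = -expU δ ι u n (sol δ ι u v n) - (1 / (n + 1) : ℂ) • ∑ k ∈ Finset.range n, ((k : ℂ) + 1) •
      mulS (sol δ ι u v (k + 1)).1 (expU δ ι u (n - 1 - k) (sol δ ι u v (n - 1 - k))) := by
  rw [sol, Finset.sum_range]

theorem sol_succ_snd (δ : ℝ) (ι : ℂ) (u v : 𝓢(ℝ, ℂ)) (n : ℕ) : (sol δ ι u v (n + 1)).2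
    = expV δ ι v n (sol δ ι u v n) - (1 / (n + 1) : ℂ) • ∑ k ∈ Finset.range n, ((k : ℂ) + 1) •
      mulS (sol δ ι u v (k + 1)).2 (expV δ ι v (n - 1 - k) (sol δ ι u v (n - 1 - k))) := by
  rw [sol, Finset.sum_range]

theorem linU_zero (δ : ℝ) (ι : ℂ) : linU δ ι 0 = 0 := by simp [linU]

theorem linV_zero (δ : ℝ) (ι : ℂ) : linV δ ι 0 = 0 := by simp [linV]

theorem sol_one (δ : ℝ) (ι : ℂ) (u v : 𝓢(ℝ, ℂ)) : sol δ ι u v 1 = (u, v) := by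
  refine Prod.ext ?_ ?_
  · rw [sol_succ_fst]; simp [sol_zero, expU, linU_zero]
  · rw [sol_succ_snd]; simp [sol_zero, expV, linV_zero]

/-- The relations between `(u, v)` and the two formal power series, in exponential form. -/
structure IsSol (δ : ℝ) (ι : ℂ) (u v : 𝓢(ℝ, ℂ)) (s : ℕ → 𝓢(ℝ, ℂ) × 𝓢(ℝ, ℂ)) : Prop where
  zero : s 0 = 0
  eq_u : ∀ x, fexp (-ser fun n => (s n).1 x) = 1 + X * ser fun n => expU δ ι u n (s n) x
  eq_v : ∀ x, fexp (ser fun n => (s n).2 x) = 1 + X * ser fun n => expV δ ι v n (s n) x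

/-- By `fexp_ser_eq_iff`, applied to the series of -s₁ and of s₂, the relations are a recursion
giving index n + 1 from indices at most n. Existence and uniqueness follow together. -/
theorem isSol_iff (δ : ℝ) (ι : ℂ) (u v : 𝓢(ℝ, ℂ)) (s : ℕ → 𝓢(ℝ, ℂ) × 𝓢(ℝ, ℂ)) :
    IsSol δ ι u v s ↔ ∀ n, s n = sol δ ι u v n := by
  have key : s 0 = 0 → (IsSol δ ι u v s ↔ ∀ n,
      (s (n + 1)).1 = -expU δ ι u n (s n) - (1 / (n + 1) : ℂ) • ∑ k ∈ Finset.range n,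
        ((k : ℂ) + 1) • mulS (s (k + 1)).1 (expU δ ι u (n - 1 - k) (s (n - 1 - k))) ∧
      (s (n + 1)).2 = expV δ ι v n (s n) - (1 / (n + 1) : ℂ) • ∑ k ∈ Finset.range n,
        ((k : ℂ) + 1) • mulS (s (k + 1)).2 (expV δ ι v (n - 1 - k) (s (n - 1 - k)))) := by
    intro h0
    have a1 : ∀ x, (fexp (-ser fun n => (s n).1 x) = 1 + X * ser fun n => expU δ ι u n (s n) x) ↔
        ∀ n, (s (n + 1)).1 x = (-expU δ ι u n (s n) - (1 / (n + 1) : ℂ) • ∑ k ∈ Finset.range n,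
        ((k : ℂ) + 1) • mulS (s (k + 1)).1 (expU δ ι u (n - 1 - k) (s (n - 1 - k)))) x := by
      intro x
      rw [← ser_neg, fexp_ser_eq_iff (by simp [h0])]
      refine forall_congr' fun n => ?_
      simp only [sub_apply, neg_apply, smul_apply, sum_apply, mulS_apply, smul_eq_mul, neg_mul,
        mul_neg, Finset.sum_neg_distrib, sub_neg_eq_add]
      constructor
      · intro h; linear_combination -h
      · intro h; linear_combination -h
    have a2 : ∀ x, (fexp (ser fun n => (s n).2 x) = 1 + X * ser fun n => expV δ ι v n (s n) x) ↔
        ∀ n, (s (n + 1)).2 x = (expV δ ι v n (s n) - (1 / (n + 1) : ℂ) • ∑ k ∈ Finset.range n,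
        ((k : ℂ) + 1) • mulS (s (k + 1)).2 (expV δ ι v (n - 1 - k) (s (n - 1 - k)))) x := by
      intro x
      rw [fexp_ser_eq_iff (by simp [h0])]
      refine forall_congr' fun n => ?_
      simp only [sub_apply, smul_apply, sum_apply, mulS_apply, smul_eq_mul]
    constructor
    · intro h n
      exact ⟨SchwartzMap.ext fun x => (a1 x).1 (h.eq_u x) n,
        SchwartzMap.ext fun x => (a2 x).1 (h.eq_v x) n⟩
    · intro h
      exact ⟨h0, fun x => (a1 x).2 fun n => by rw [(h n).1], fun x => (a2 x).2 fun n => by rw [(h n).2]⟩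
  constructor
  · intro h n
    have h1 := (key h.zero).1 h
    induction n using Nat.strong_induction_on with
    | _ n ih =>
      cases n with
      | zero => rw [h.zero, sol_zero]
      | succ n =>
        refine Prod.ext ?_ ?_
        · rw [(h1 n).1, sol_succ_fst, ih n (by omega)]
          congr 2
          refine Finset.sum_congr rfl fun k hk => ?_
          have := Finset.mem_range.1 hk
          rw [ih (k + 1) (by omega), ih (n - 1 - k) (by omega)]
        · rw [(h1 n).2, sol_succ_snd, ih n (by omega)]
          congr 2
          refine Finset.sum_congr rfl fun k hk => ?_
          have := Finset.mem_range.1 hk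
          rw [ih (k + 1) (by omega), ih (n - 1 - k) (by omega)]
  · intro h
    obtain rfl : s = sol δ ι u v := funext h
    exact (key (sol_zero _ _ _ _)).2 fun n => ⟨sol_succ_fst _ _ _ _ _, sol_succ_snd _ _ _ _ _⟩

theorem isSol_sol (δ : ℝ) (ι : ℂ) (u v : 𝓢(ℝ, ℂ)) : IsSol δ ι u v (sol δ ι u v) :=
  (isSol_iff δ ι u v _).2 fun _ => rfl

theorem continuous_linU (δ : ℝ) (ι : ℂ) : Continuous (linU δ ι) := by
  unfold linU
  fun_prop

theorem continuous_linV (δ : ℝ) (ι : ℂ) : Continuous (linV δ ι) := by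
  unfold linV
  fun_prop

/-- The coefficients of the solution depend continuously on `(u, v)`. -/
theorem continuous_sol (δ : ℝ) (ι : ℂ) (n : ℕ) :
    Continuous fun p : 𝓢(ℝ, ℂ) × 𝓢(ℝ, ℂ) => sol δ ι p.1 p.2 n := by
  induction n using Nat.strong_induction_on with
  | _ n ih =>
    have hU : ∀ m, m < n → Continuous fun p : 𝓢(ℝ, ℂ) × 𝓢(ℝ, ℂ) =>
        expU δ ι p.1 m (sol δ ι p.1 p.2 m) := fun m hm => by
      unfold expU
      refine ((continuous_linU δ ι).comp (ih m hm)).sub ?_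
      split_ifs
      · exact continuous_fst
      · exact continuous_const
    have hV : ∀ m, m < n → Continuous fun p : 𝓢(ℝ, ℂ) × 𝓢(ℝ, ℂ) =>
        expV δ ι p.2 m (sol δ ι p.1 p.2 m) := fun m hm => by
      unfold expV
      refine Continuous.sub ?_ ((continuous_linV δ ι).comp (ih m hm))
      split_ifs
      · exact continuous_snd
      · exact continuous_const
    cases n with
    | zero => simp only [sol_zero]; exact continuous_const
    | succ n =>
      have h1 : Continuous fun p : 𝓢(ℝ, ℂ) × 𝓢(ℝ, ℂ) => (sol δ ι p.1 p.2 (n + 1)).1 := by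
        refine (continuous_congr fun p : 𝓢(ℝ, ℂ) × 𝓢(ℝ, ℂ) => sol_succ_fst δ ι p.1 p.2 n).mpr ?_
        refine (hU n (by omega)).neg.sub (continuous_const.fun_smul (continuous_finsetSum _ fun k hk => ?_))
        have := Finset.mem_range.1 hk
        exact continuous_const.fun_smul (continuous_mulS.comp
          ((continuous_fst.comp (ih (k + 1) (by omega))).prodMk (hU (n - 1 - k) (by omega))))
      have h2 : Continuous fun p : 𝓢(ℝ, ℂ) × 𝓢(ℝ, ℂ) => (sol δ ι p.1 p.2 (n + 1)).2 := by
        refine (continuous_congr fun p : 𝓢(ℝ, ℂ) × 𝓢(ℝ, ℂ) => sol_succ_snd δ ι p.1 p.2 n).mpr ?_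
        refine (hV n (by omega)).sub (continuous_const.fun_smul (continuous_finsetSum _ fun k hk => ?_))
        have := Finset.mem_range.1 hk
        exact continuous_const.fun_smul (continuous_mulS.comp
          ((continuous_snd.comp (ih (k + 1) (by omega))).prodMk (hV (n - 1 - k) (by omega))))
      exact h1.prodMk h2

theorem conjS_smul (c : ℂ) (f : 𝓢(ℝ, ℂ)) : conjS (c • f) = (starRingEnd ℂ) c • conjS f := by
  ext x; simp [conjS_apply]

theorem conjS_neg (f : 𝓢(ℝ, ℂ)) : conjS (-f) = -conjS f := by
  ext x; simp [conjS_apply]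

theorem conjS_zero : conjS 0 = 0 := by
  ext x; simp [conjS_apply]

theorem conjS_mulS (f g : 𝓢(ℝ, ℂ)) : conjS (mulS f g) = mulS (conjS f) (conjS g) := by
  ext x; simp [conjS_apply]

theorem conjS_sum {α : Type*} (s : Finset α) (f : α → 𝓢(ℝ, ℂ)) :
    conjS (∑ i ∈ s, f i) = ∑ i ∈ s, conjS (f i) := by
  ext x; simp [conjS_apply]

/-- Complex conjugation exchanges the solutions for `ι` and for its conjugate. -/
theorem conjS_sol {δ : ℝ} (hδ : 0 < δ) (ι : ℂ) (u v : 𝓢(ℝ, ℂ)) (n : ℕ) :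
    sol δ ((starRingEnd ℂ) ι) (conjS u) (conjS v) n
      = (conjS (sol δ ι u v n).1, conjS (sol δ ι u v n).2) := by
  have hl : ∀ p : 𝓢(ℝ, ℂ) × 𝓢(ℝ, ℂ), linU δ ((starRingEnd ℂ) ι) (conjS p.1, conjS p.2)
      = conjS (linU δ ι p) := fun p => by
    simp only [linU, conjS_sub, conjS_smul, conjS_add, Dop_conjS, Aop_conjS hδ, Bop_conjS hδ,
      map_div₀, map_ofNat, map_one]
  have hr : ∀ p : 𝓢(ℝ, ℂ) × 𝓢(ℝ, ℂ), linV δ ((starRingEnd ℂ) ι) (conjS p.1, conjS p.2)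
      = conjS (linV δ ι p) := fun p => by
    simp only [linV, conjS_smul, conjS_add, Dop_conjS, Aop_conjS hδ, Bop_conjS hδ,
      map_div₀, map_ofNat, map_one]
  have hU : ∀ m (p : 𝓢(ℝ, ℂ) × 𝓢(ℝ, ℂ)), expU δ ((starRingEnd ℂ) ι) (conjS u) m (conjS p.1, conjS p.2)
      = conjS (expU δ ι u m p) := fun m p => by
    simp only [expU, hl, conjS_sub, apply_ite conjS, conjS_zero]
  have hV : ∀ m (p : 𝓢(ℝ, ℂ) × 𝓢(ℝ, ℂ)), expV δ ((starRingEnd ℂ) ι) (conjS v) m (conjS p.1, conjS p.2)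
      = conjS (expV δ ι v m p) := fun m p => by
    simp only [expV, hr, conjS_sub, apply_ite conjS, conjS_zero]
  induction n using Nat.strong_induction_on with
  | _ n ih =>
    cases n with
    | zero => simp only [sol_zero, Prod.fst_zero, Prod.snd_zero, conjS_zero]; rfl
    | succ n =>
      refine Prod.ext ?_ ?_
      · rw [sol_succ_fst, sol_succ_fst δ ι u v n]
        simp only [conjS_sub, conjS_neg, conjS_smul, conjS_sum, conjS_mulS]
        rw [ih n (by omega), hU]
        simp only [map_div₀, map_add, map_one, map_natCast]
        congr 2
        refine Finset.sum_congr rfl fun k hk => ?_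
        have := Finset.mem_range.1 hk
        rw [ih (k + 1) (by omega), ih (n - 1 - k) (by omega), hU]
      · rw [sol_succ_snd, sol_succ_snd δ ι u v n]
        simp only [conjS_sub, conjS_smul, conjS_sum, conjS_mulS]
        rw [ih n (by omega), hV]
        simp only [map_div₀, map_add, map_one, map_natCast]
        congr 2
        refine Finset.sum_congr rfl fun k hk => ?_
        have := Finset.mem_range.1 hk
        rw [ih (k + 1) (by omega), ih (n - 1 - k) (by omega), hV]

end Recursion

/-! ### The relations of part (a) as the case ι = -i -/

section Backlund

open PowerSeries

/-- Since i P₋ = (T + i)/2, the operator in the first relation is the linear part with `ι = -i`, up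
to sign. -/
theorem I_mul_Pminus_add {δ : ℝ} (hδ : 0 < δ) (f g : 𝓢(ℝ, ℂ)) (x : ℝ) :
    Complex.I * Pminus δ (deriv f) x + 1 / 2 * Tt δ (deriv g) x
      = -linU δ (-Complex.I) (f, g) x := by
  simp only [Pminus, T_deriv hδ, Tt_deriv hδ, linU, sub_apply, smul_apply, add_apply, smul_eq_mul,
    Dop_apply]
  linear_combination (-(1 / 2) * Aop δ f x) * Complex.I_sq

theorem I_mul_Pplus_add {δ : ℝ} (hδ : 0 < δ) (f g : 𝓢(ℝ, ℂ)) (x : ℝ) :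
    Complex.I * Pplus δ (deriv g) x + 1 / 2 * Tt δ (deriv f) x
      = linV δ (-Complex.I) (f, g) x := by
  simp only [Pplus, T_deriv hδ, Tt_deriv hδ, linV, smul_apply, add_apply, smul_eq_mul, Dop_apply]
  linear_combination (-(1 / 2) * Aop δ g x) * Complex.I_sq

theorem ser_expU (δ : ℝ) (ι : ℂ) (u : 𝓢(ℝ, ℂ)) (s : ℕ → 𝓢(ℝ, ℂ) × 𝓢(ℝ, ℂ)) (x : ℝ) :
    (ser fun n => expU δ ι u n (s n) x) = (ser fun n => linU δ ι (s n) x) - C (u x) := by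
  ext n
  rw [map_sub, coeff_ser, coeff_ser, coeff_C, expU, sub_apply]
  split_ifs <;> simp

theorem ser_expV (δ : ℝ) (ι : ℂ) (v : 𝓢(ℝ, ℂ)) (s : ℕ → 𝓢(ℝ, ℂ) × 𝓢(ℝ, ℂ)) (x : ℝ) :
    (ser fun n => expV δ ι v n (s n) x) = C (v x) - ser fun n => linV δ ι (s n) x := by
  ext n
  rw [map_sub, coeff_ser, coeff_ser, coeff_C, expV, sub_apply]
  split_ifs <;> simp

theorem C_mul_ser (c : ℂ) (f : ℕ → ℂ) : C c * ser f = ser fun n => c * f n := by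
  ext n; rw [coeff_C_mul, coeff_ser, coeff_ser]

theorem isBacklundExpansion_iff {δ : ℝ} (hδ : 0 < δ) (u v : 𝓢(ℝ, ℂ)) (w z : ℕ → 𝓢(ℝ, ℂ)) :
    IsBacklundExpansion δ u v w z ↔ IsSol δ (-Complex.I) u v fun n => (w n, z n) := by
  have h1 : ∀ x, (C Complex.I * ser fun n => Pminus δ (deriv (w n)) x)
      + (C (1 / 2) * ser fun n => Tt δ (deriv (z n)) x)
      = -ser fun n => linU δ (-Complex.I) (w n, z n) x := by
    intro x
    rw [C_mul_ser, C_mul_ser, ← ser_add, ← ser_neg]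
    simp only [I_mul_Pminus_add hδ]
  have h2 : ∀ x, (C Complex.I * ser fun n => Pplus δ (deriv (z n)) x)
      + (C (1 / 2) * ser fun n => Tt δ (deriv (w n)) x)
      = ser fun n => linV δ (-Complex.I) (w n, z n) x := by
    intro x
    rw [C_mul_ser, C_mul_ser, ← ser_add]
    simp only [I_mul_Pplus_add hδ]
  constructor
  · intro h
    refine ⟨?_, fun x => ?_, fun x => ?_⟩
    · simp only [h.W_zero, h.Z_zero]; rfl
    · rw [ser_expU]
      linear_combination h.eq_u x - X * h1 x
    · rw [ser_expV]
      linear_combination -h.eq_v x - X * h2 x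
  · intro h
    refine ⟨congrArg Prod.fst h.zero, congrArg Prod.snd h.zero, fun x => ?_, fun x => ?_⟩
    · have := h.eq_u x
      rw [ser_expU] at this
      linear_combination this + X * h1 x
    · have := h.eq_v x
      rw [ser_expV] at this
      linear_combination -this - X * h2 x

theorem sol_recursion {δ : ℝ} (hδ : 0 < δ) (u v : 𝓢(ℝ, ℂ)) {n : ℕ} (hn : 1 ≤ n) (x : ℝ) :
    (sol δ (-Complex.I) u v (n + 1)).1 x
      = coeff (n + 1) (fexp (-ser fun m => if m ≤ n then (sol δ (-Complex.I) u v m).1 x else 0))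
        + Complex.I * Pminus δ (deriv (sol δ (-Complex.I) u v n).1) x
        + 1 / 2 * Tt δ (deriv (sol δ (-Complex.I) u v n).2) x ∧
    (sol δ (-Complex.I) u v (n + 1)).2 x
      = -coeff (n + 1) (fexp (ser fun m => if m ≤ n then (sol δ (-Complex.I) u v m).2 x else 0))
        - Complex.I * Pplus δ (deriv (sol δ (-Complex.I) u v n).2) x
        - 1 / 2 * Tt δ (deriv (sol δ (-Complex.I) u v n).1) x := by
  have h := isSol_sol δ (-Complex.I) u v
  have e1 := congrArg (coeff (n + 1)) (h.eq_u x)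
  have e2 := congrArg (coeff (n + 1)) (h.eq_v x)
  have hn0 : n ≠ 0 := by omega
  rw [← ser_neg, coeff_fexp_truncation (by simp [sol_zero]), map_add, coeff_succ_X_mul, coeff_ser,
    coeff_one, if_neg (by omega), expU, if_neg hn0, sub_zero] at e1
  rw [coeff_fexp_truncation (by simp [sol_zero]), map_add, coeff_succ_X_mul, coeff_ser,
    coeff_one, if_neg (by omega), expV, if_neg hn0, zero_sub, neg_apply] at e2
  have a1 := I_mul_Pminus_add hδ (sol δ (-Complex.I) u v n).1 (sol δ (-Complex.I) u v n).2 x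
  have a2 := I_mul_Pplus_add hδ (sol δ (-Complex.I) u v n).1 (sol δ (-Complex.I) u v n).2 x
  rw [← ser_neg]
  have e3 : (fun m => if m ≤ n then -(sol δ (-Complex.I) u v m).1 x else 0)
      = fun m => -if m ≤ n then (sol δ (-Complex.I) u v m).1 x else 0 := by
    funext m; split_ifs <;> simp
  rw [e3] at e1
  constructor
  · linear_combination -e1 - a1
  · linear_combination e2 + a2

end Backlund

/-! ### Differentiable curves of Schwartz functions -/

section Curves

open MeasureTheory Set
open scoped FourierTransform

/-- `f` is a curve of Schwartz functions that is pointwise differentiable on `J`, with derivative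
`f'`, both continuous in the Schwartz topology. -/
structure IsCurve (J : Set ℝ) (f f' : ℝ → 𝓢(ℝ, ℂ)) : Prop where
  cont : ContinuousOn f J
  cont' : ContinuousOn f' J
  deriv : ∀ t ∈ J, ∀ x, HasDerivAt (fun s => f s x) (f' t x) t

/-- Continuity of the seminorms of orders 0 and 2 bounds nearby values uniformly by an integrable
function of x; this dominates the differentiation under integrals. -/
theorem eventually_norm_le {J : Set ℝ} (hJ : IsOpen J) {g : ℝ → 𝓢(ℝ, ℂ)} (hg : ContinuousOn g J)
    {t : ℝ} (ht : t ∈ J) : ∃ C : ℝ, ∀ᶠ s in nhds t, ∀ x : ℝ, ‖g s x‖ ≤ C * (1 + x ^ 2)⁻¹ := by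
  have hw := schwartz_withSeminorms ℂ ℝ ℂ
  have hc : ∀ i, ContinuousAt (fun s => SchwartzMap.seminorm ℂ i 0 (g s)) t := fun i =>
    ((hw.continuous_seminorm (i, 0)).continuousAt).comp (hg.continuousAt (hJ.mem_nhds ht))
  refine ⟨(SchwartzMap.seminorm ℂ 0 0 (g t) + 1) + (SchwartzMap.seminorm ℂ 2 0 (g t) + 1), ?_⟩
  filter_upwards [(hc 0).eventually (gt_mem_nhds (lt_add_one _)),
    (hc 2).eventually (gt_mem_nhds (lt_add_one _))] with s h0 h2 x
  have a0 := SchwartzMap.norm_le_seminorm ℂ (g s) x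
  have a2 := SchwartzMap.norm_pow_mul_le_seminorm ℂ (g s) 2 x
  rw [Real.norm_eq_abs, sq_abs] at a2
  rw [← div_eq_mul_inv, le_div_iff₀ (by positivity)]
  nlinarith

namespace IsCurve

variable {J : Set ℝ} {f f' g g' : ℝ → 𝓢(ℝ, ℂ)}

theorem fourier (hJ : IsOpen J) (h : IsCurve J f f') :
    IsCurve J (fun t => 𝓕 (f t)) (fun t => 𝓕 (f' t)) := by
  have hF : Continuous fun f : 𝓢(ℝ, ℂ) => 𝓕 f := (FourierTransform.fourierCLM ℂ 𝓢(ℝ, ℂ)).continuous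
  refine ⟨hF.comp_continuousOn h.cont, hF.comp_continuousOn h.cont', fun t ht ξ => ?_⟩
  simp only [SchwartzMap.fourier_coe, Real.fourier_real_eq_integral_exp_smul]
  obtain ⟨C, hC⟩ := eventually_norm_le hJ h.cont' ht
  have hU : {s | s ∈ J ∧ ∀ x : ℝ, ‖f' s x‖ ≤ C * (1 + x ^ 2)⁻¹} ∈ nhds t :=
    Filter.inter_mem (hJ.mem_nhds ht) hC
  have hn : ∀ v : ℝ, ‖Complex.exp (((-2 * Real.pi * v * ξ : ℝ) : ℂ) * Complex.I)‖ = 1 := fun v =>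
    Complex.norm_exp_ofReal_mul_I _
  refine (hasDerivAt_integral_of_dominated_loc_of_deriv_le hU
    (F' := fun s v => Complex.exp (((-2 * Real.pi * v * ξ : ℝ) : ℂ) * Complex.I) • f' s v)
    (bound := fun x => C * (1 + x ^ 2)⁻¹)
    (Filter.Eventually.of_forall fun s => by fun_prop) ?_ (by fun_prop) ?_
    (integrable_inv_one_add_sq.const_mul C) ?_).2
  · refine (f t).integrable.norm.mono' (by fun_prop) (Filter.Eventually.of_forall fun v => ?_)
    rw [norm_smul, hn, one_mul]
  · refine Filter.Eventually.of_forall fun v s hs => ?_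
    rw [norm_smul, hn, one_mul]
    exact hs.2 v
  · exact Filter.Eventually.of_forall fun v s hs => (h.deriv s hs.1 v).fun_const_smul _

theorem fourierInv (hJ : IsOpen J) (h : IsCurve J f f') :
    IsCurve J (fun t => 𝓕⁻ (f t)) (fun t => 𝓕⁻ (f' t)) := by
  have hF : Continuous fun f : 𝓢(ℝ, ℂ) => 𝓕⁻ f :=
    (FourierTransform.fourierInvCLM ℂ 𝓢(ℝ, ℂ)).continuous
  refine ⟨hF.comp_continuousOn h.cont, hF.comp_continuousOn h.cont', fun t ht ξ => ?_⟩
  have h1 := (h.fourier hJ).deriv t ht (-ξ)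
  simpa only [fourier_neg_eq_fourierInv, neg_neg] using h1

theorem integral (hJ : IsOpen J) (h : IsCurve J f f') {t : ℝ} (ht : t ∈ J) :
    HasDerivAt (fun s => ∫ x, f s x) (∫ x, f' t x) t := by
  have h1 := (h.fourier hJ).deriv t ht 0
  simpa only [fourier_zero_eq_integral] using h1

/-- Pointwise differentiability does not pass directly through a nonlocal operator. On the Fourier
side the operator is multiplication by `m ξ`, and the Fourier transform and its inverse preserve
curves. -/
theorem map (hJ : IsOpen J) (h : IsCurve J f f') {L : 𝓢(ℝ, ℂ) →L[ℂ] 𝓢(ℝ, ℂ)} {m : ℝ → ℂ}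
    (hL : ∀ f ξ, 𝓕 (L f) ξ = m ξ * 𝓕 f ξ) : IsCurve J (fun t => L (f t)) (fun t => L (f' t)) := by
  have hF : Continuous fun f : 𝓢(ℝ, ℂ) => 𝓕 f := (FourierTransform.fourierCLM ℂ 𝓢(ℝ, ℂ)).continuous
  have h1 : IsCurve J (fun t => 𝓕 (L (f t))) (fun t => 𝓕 (L (f' t))) := by
    refine ⟨(hF.comp L.continuous).comp_continuousOn h.cont,
      (hF.comp L.continuous).comp_continuousOn h.cont', fun t ht ξ => ?_⟩
    simp only [hL]
    exact ((h.fourier hJ).deriv t ht ξ).const_mul _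
  have h2 := h1.fourierInv hJ
  simpa only [FourierTransform.fourierInv_fourier_eq] using h2

theorem add (h : IsCurve J f f') (h' : IsCurve J g g') :
    IsCurve J (fun t => f t + g t) (fun t => f' t + g' t) :=
  ⟨h.cont.fun_add h'.cont, h.cont'.fun_add h'.cont', fun t ht x => by
    simp only [add_apply]; exact (h.deriv t ht x).fun_add (h'.deriv t ht x)⟩

theorem sub (h : IsCurve J f f') (h' : IsCurve J g g') :
    IsCurve J (fun t => f t - g t) (fun t => f' t - g' t) :=
  ⟨h.cont.fun_sub h'.cont, h.cont'.fun_sub h'.cont', fun t ht x => by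
    simp only [sub_apply]; exact (h.deriv t ht x).fun_sub (h'.deriv t ht x)⟩

theorem neg (h : IsCurve J f f') : IsCurve J (fun t => -f t) (fun t => -f' t) :=
  ⟨h.cont.fun_neg, h.cont'.fun_neg, fun t ht x => by
    simp only [neg_apply]; exact (h.deriv t ht x).fun_neg⟩

theorem smul (h : IsCurve J f f') (c : ℂ) : IsCurve J (fun t => c • f t) (fun t => c • f' t) :=
  ⟨h.cont.fun_const_smul c, h.cont'.fun_const_smul c, fun t ht x => by
    simp only [smul_apply]; exact (h.deriv t ht x).fun_const_smul c⟩

theorem zero : IsCurve J (fun _ => 0) (fun _ => 0) :=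
  ⟨continuousOn_const, continuousOn_const, fun t _ _ => hasDerivAt_const t (0 : ℂ)⟩

theorem mul (h : IsCurve J f f') (h' : IsCurve J g g') :
    IsCurve J (fun t => mulS (f t) (g t)) (fun t => mulS (f' t) (g t) + mulS (f t) (g' t)) := by
  have hc : ∀ {a b : ℝ → 𝓢(ℝ, ℂ)}, ContinuousOn a J → ContinuousOn b J →
      ContinuousOn (fun t => mulS (a t) (b t)) J := fun {a b} ha hb =>
    Continuous.comp_continuousOn (g := fun p : 𝓢(ℝ, ℂ) × 𝓢(ℝ, ℂ) => mulS p.1 p.2)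
      (f := fun t => (a t, b t)) continuous_mulS (ha.prodMk hb)
  refine ⟨hc h.cont h'.cont, (hc h.cont' h'.cont).fun_add (hc h.cont h'.cont'),
    fun t ht x => ?_⟩
  simp only [mulS_apply, add_apply]
  exact (h.deriv t ht x).fun_mul (h'.deriv t ht x)

theorem sum {α : Type*} (s : Finset α) {F F' : α → ℝ → 𝓢(ℝ, ℂ)}
    (h : ∀ i ∈ s, IsCurve J (F i) (F' i)) :
    IsCurve J (fun t => ∑ i ∈ s, F i t) (fun t => ∑ i ∈ s, F' i t) := by
  refine ⟨continuousOn_finsetSum s fun i hi => (h i hi).cont,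
    continuousOn_finsetSum s fun i hi => (h i hi).cont', fun t ht x => ?_⟩
  simp only [sum_apply]
  exact HasDerivAt.fun_sum fun i hi => (h i hi).deriv t ht x

end IsCurve

variable {J : Set ℝ} {δ : ℝ} {f f' g g' : ℝ → 𝓢(ℝ, ℂ)}

theorem IsCurve.linU (hJ : IsOpen J) (hδ : 0 < δ) (ι : ℂ) (h : IsCurve J f f')
    (h' : IsCurve J g g') :
    IsCurve J (fun t => linU δ ι (f t, g t)) (fun t => linU δ ι (f' t, g' t)) :=
  ((h.map hJ fourier_derivCLM).smul (ι / 2)).sub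
    (((h.map hJ (fourier_Aop hδ)).add (h'.map hJ (fourier_Bop hδ))).smul (1 / 2))

theorem IsCurve.linV (hJ : IsOpen J) (hδ : 0 < δ) (ι : ℂ) (h : IsCurve J f f')
    (h' : IsCurve J g g') :
    IsCurve J (fun t => linV δ ι (f t, g t)) (fun t => linV δ ι (f' t, g' t)) :=
  ((h'.map hJ fourier_derivCLM).smul (ι / 2)).add
    (((h'.map hJ (fourier_Aop hδ)).add (h.map hJ (fourier_Bop hδ))).smul (1 / 2))

/-- The coefficients of the solution are differentiable along a differentiable curve `(u, v)`. -/
theorem exists_isCurve_sol (hJ : IsOpen J) (hδ : 0 < δ) (ι : ℂ) {u u' v v' : ℝ → 𝓢(ℝ, ℂ)}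
    (hu : IsCurve J u u') (hv : IsCurve J v v') (n : ℕ) :
    ∃ d : ℝ → 𝓢(ℝ, ℂ) × 𝓢(ℝ, ℂ),
      IsCurve J (fun t => (sol δ ι (u t) (v t) n).1) (fun t => (d t).1) ∧
      IsCurve J (fun t => (sol δ ι (u t) (v t) n).2) (fun t => (d t).2) := by
  induction n using Nat.strong_induction_on with
  | _ n ih =>
    have hU : ∀ m, m < n → ∃ e, IsCurve J (fun t => expU δ ι (u t) m (sol δ ι (u t) (v t) m)) e := by
      intro m hm
      obtain ⟨d, h1, h2⟩ := ih m hm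
      by_cases h0 : m = 0
      · subst h0
        exact ⟨_, (h1.linU hJ hδ ι h2).sub hu⟩
      · simp only [expU, if_neg h0, sub_zero]
        exact ⟨_, h1.linU hJ hδ ι h2⟩
    have hV : ∀ m, m < n → ∃ e, IsCurve J (fun t => expV δ ι (v t) m (sol δ ι (u t) (v t) m)) e := by
      intro m hm
      obtain ⟨d, h1, h2⟩ := ih m hm
      by_cases h0 : m = 0
      · subst h0
        exact ⟨_, hv.sub (h1.linV hJ hδ ι h2)⟩
      · simp only [expV, if_neg h0, zero_sub]
        exact ⟨_, (h1.linV hJ hδ ι h2).neg⟩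
    choose! d hd using ih
    choose! eU heU using hU
    choose! eV heV using hV
    cases n with
    | zero =>
      refine ⟨fun _ => 0, ?_, ?_⟩
      · simp only [sol_zero]; exact IsCurve.zero
      · simp only [sol_zero]; exact IsCurve.zero
    | succ n =>
      have h1 : ∃ e, IsCurve J (fun t => (sol δ ι (u t) (v t) (n + 1)).1) e := by
        have e : (fun t => (sol δ ι (u t) (v t) (n + 1)).1) = _ :=
          funext fun t => sol_succ_fst δ ι (u t) (v t) n
        rw [e]
        exact ⟨_, (heU n (by omega)).neg.sub ((IsCurve.sum _ fun k hk =>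
          ((hd (k + 1) (by have := Finset.mem_range.1 hk; omega)).1.mul
            (heU (n - 1 - k) (by have := Finset.mem_range.1 hk; omega))).smul _).smul _)⟩
      have h2 : ∃ e, IsCurve J (fun t => (sol δ ι (u t) (v t) (n + 1)).2) e := by
        have e : (fun t => (sol δ ι (u t) (v t) (n + 1)).2) = _ :=
          funext fun t => sol_succ_snd δ ι (u t) (v t) n
        rw [e]
        exact ⟨_, (heV n (by omega)).sub ((IsCurve.sum _ fun k hk =>
          ((hd (k + 1) (by have := Finset.mem_range.1 hk; omega)).2.mul
            (heV (n - 1 - k) (by have := Finset.mem_range.1 hk; omega))).smul _).smul _)⟩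
      obtain ⟨e1, h1⟩ := h1
      obtain ⟨e2, h2⟩ := h2
      exact ⟨fun t => (e1 t, e2 t), h1, h2⟩

end Curves

/-! ### Derivatives of formal series depending on a parameter -/

section SeriesDerivative

open PowerSeries

/-- Coefficientwise derivative of a formal power series depending on a parameter. -/
def HasSerDeriv (F : ℝ → PowerSeries ℂ) (F' : PowerSeries ℂ) (t : ℝ) : Prop :=
  ∀ n, HasDerivAt (fun s => coeff n (F s)) (coeff n F') t

namespace HasSerDeriv

variable {F G : ℝ → PowerSeries ℂ} {F' G' : PowerSeries ℂ} {t : ℝ}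

theorem unique (h : HasSerDeriv F F' t) (h' : HasSerDeriv F G' t) : F' = G' := by
  ext n; exact (h n).unique (h' n)

theorem add (h : HasSerDeriv F F' t) (h' : HasSerDeriv G G' t) :
    HasSerDeriv (fun s => F s + G s) (F' + G') t := fun n => by
  simp only [map_add]; exact (h n).fun_add (h' n)

theorem sub (h : HasSerDeriv F F' t) (h' : HasSerDeriv G G' t) :
    HasSerDeriv (fun s => F s - G s) (F' - G') t := fun n => by
  simp only [map_sub]; exact (h n).fun_sub (h' n)

theorem mul (h : HasSerDeriv F F' t) (h' : HasSerDeriv G G' t) :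
    HasSerDeriv (fun s => F s * G s) (F' * G t + F t * G') t := fun n => by
  simp only [coeff_mul, map_add, ← Finset.sum_add_distrib]
  exact HasDerivAt.fun_sum fun p _ => (h p.1).fun_mul (h' p.2)

theorem const (G : PowerSeries ℂ) : HasSerDeriv (fun _ => G) 0 t := fun n => by
  simpa using hasDerivAt_const t (coeff n G)

theorem const_mul (G : PowerSeries ℂ) (h : HasSerDeriv F F' t) :
    HasSerDeriv (fun s => G * F s) (G * F') t := by
  simpa using (const G).mul h

theorem const_add (G : PowerSeries ℂ) (h : HasSerDeriv F F' t) :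
    HasSerDeriv (fun s => G + F s) F' t := by
  simpa using (const G).add h

theorem ser {f : ℕ → ℝ → ℂ} {f' : ℕ → ℂ} (h : ∀ n, HasDerivAt (f n) (f' n) t) :
    HasSerDeriv (fun s => ser fun n => f n s) (NcILW.ser f') t := fun n => by
  simpa only [coeff_ser] using h n

theorem C {f : ℝ → ℂ} {f' : ℂ} (h : HasDerivAt f f' t) :
    HasSerDeriv (fun s => PowerSeries.C (f s)) (PowerSeries.C f') t := fun n => by
  simp only [coeff_C]
  split_ifs
  · exact h
  · exact hasDerivAt_const t (0 : ℂ)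

theorem fexp {f : ℕ → ℝ → ℂ} {f' : ℕ → ℂ} (h0 : f 0 = 0) (h : ∀ n, HasDerivAt (f n) (f' n) t) :
    HasSerDeriv (fun s => fexp (NcILW.ser fun n => f n s))
      (NcILW.fexp (NcILW.ser fun n => f n t) * NcILW.ser f') t :=
  hasDerivAt_coeff_fexp h0 h

end HasSerDeriv

end SeriesDerivative

/-! ### The time part of the Lax pair -/

section Flow

open PowerSeries MeasureTheory

theorem hasSerDeriv_schwartz (p : ℕ → 𝓢(ℝ, ℂ)) (x : ℝ) :
    HasSerDeriv (fun y => ser fun n => p n y) (ser fun n => Dop (p n) x) x :=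
  HasSerDeriv.ser fun n => by
    rw [Dop_apply]; exact (p n).differentiableAt.hasDerivAt

theorem hasDerivAt_schwartz (f : 𝓢(ℝ, ℂ)) (x : ℝ) : HasDerivAt f (Dop f x) x := by
  rw [Dop_apply]; exact f.differentiableAt.hasDerivAt

/-- The coefficients of `-2 p - i X (Dop p + p ^ 2) + X q`. -/
def gam (p : ℕ → 𝓢(ℝ, ℂ)) (q : 𝓢(ℝ, ℂ)) : ℕ → 𝓢(ℝ, ℂ)
  | 0 => (-2 : ℂ) • p 0
  | n + 1 => (-2 : ℂ) • p (n + 1) + (-Complex.I) • (Dop (p n)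
      + ∑ k ∈ Finset.HasAntidiagonal.antidiagonal n, mulS (p k.1) (p k.2)) + if n = 0 then q else 0

theorem ser_gam (p : ℕ → 𝓢(ℝ, ℂ)) (q : 𝓢(ℝ, ℂ)) (x : ℝ) : (ser fun n => gam p q n x)
    = C (-2) * (ser fun n => p n x) + X * (C (-Complex.I) * ((ser fun n => Dop (p n) x)
      + (ser fun n => p n x) * (ser fun n => p n x)) + C (q x)) := by
  ext n
  rw [coeff_ser, map_add, coeff_C_mul, coeff_ser]
  cases n with
  | zero => simp [gam]
  | succ n =>
    rw [coeff_succ_X_mul, map_add, coeff_C_mul, map_add, coeff_ser, coeff_mul, coeff_C, gam]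
    simp only [coeff_ser, add_apply, smul_apply, smul_eq_mul, sum_apply, mulS_apply]
    split_ifs
    · ring
    · rw [zero_apply]; ring

theorem ser_Dop_gam (p : ℕ → 𝓢(ℝ, ℂ)) (q : 𝓢(ℝ, ℂ)) (x : ℝ) : (ser fun n => Dop (gam p q n) x)
    = C (-2) * (ser fun n => Dop (p n) x)
      + X * (C (-Complex.I) * ((ser fun n => Dop (Dop (p n)) x)
        + 2 * (ser fun n => p n x) * (ser fun n => Dop (p n) x)) + C (Dop q x)) := by
  have h1 := hasSerDeriv_schwartz (gam p q) x
  simp only [ser_gam] at h1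
  have hp := hasSerDeriv_schwartz p x
  have h2 := (hp.const_mul (C (-2))).add (HasSerDeriv.const_mul X
    (((((hasSerDeriv_schwartz (fun n => Dop (p n)) x).add (hp.mul hp)).const_mul
      (C (-Complex.I)))).add (HasSerDeriv.C (hasDerivAt_schwartz q x))))
  rw [h1.unique h2]
  ring

/-- `gam` uses only linear combinations, derivatives and products, all of which preserve strip
pairs. -/
theorem isStripPair_gam {δ : ℝ} {p p' : ℕ → 𝓢(ℝ, ℂ)} {q q' : 𝓢(ℝ, ℂ)}
    (hp : ∀ n, IsStripPair δ (p n) (p' n)) (hq : IsStripPair δ q q') (n : ℕ) :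
    IsStripPair δ (gam p q n) (gam p' q' n) := by
  cases n with
  | zero => exact (hp 0).smul _
  | succ n =>
    have h0 : IsStripPair δ (if n = 0 then q else 0) (if n = 0 then q' else 0) := by
      split_ifs
      · exact hq
      · exact IsStripPair.zero
    exact (((hp _).smul _).add (((hp n).map_Dop.add
      (IsStripPair.sum _ fun k _ => (hp k.1).mul (hp k.2))).smul _)).add h0

/-- For `ι = i` the linear parts are boundary values of strip functions. With p = (log M₂)ₓ at the
top, the first relation reads M₁⁺ / M₂⁻ = 1 + ζ⁻¹ (i p - u), the first Lax equation. -/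
theorem linU_I (δ : ℝ) (p : 𝓢(ℝ, ℂ) × 𝓢(ℝ, ℂ)) :
    linU δ Complex.I p = Complex.I • liftTop δ p.1 p.2 := by
  ext x
  simp only [linU, liftTop, sub_apply, smul_apply, add_apply, smul_eq_mul]
  linear_combination (-(1 / 2) * (Aop δ p.1 x + Bop δ p.2 x)) * Complex.I_sq

theorem linV_I (δ : ℝ) (p : 𝓢(ℝ, ℂ) × 𝓢(ℝ, ℂ)) :
    linV δ Complex.I p = -Complex.I • liftBot δ p.2 p.1 := by
  ext x
  simp only [linV, liftBot, smul_apply, add_apply, neg_apply, smul_eq_mul]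
  linear_combination ((1 / 2) * (Aop δ p.2 x + Bop δ p.1 x)) * Complex.I_sq

/-- The first relation, with its first two derivatives in `x`. -/
theorem relation_u (δ : ℝ) (u v : 𝓢(ℝ, ℂ)) (s : ℕ → 𝓢(ℝ, ℂ) × 𝓢(ℝ, ℂ))
    (hs : IsSol δ Complex.I u v s) (x : ℝ) :
    fexp (-ser fun n => (s n).1 x) = 1 + X * (C Complex.I *
      (ser fun n => liftTop δ (s n).1 (s n).2 x) - C (u x)) ∧
    fexp (-ser fun n => (s n).1 x) * (-ser fun n => Dop (s n).1 x) = X * (C Complex.I *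
      (ser fun n => Dop (liftTop δ (s n).1 (s n).2) x) - C (Dop u x)) ∧
    fexp (-ser fun n => (s n).1 x) * (-ser fun n => Dop (s n).1 x) * (-ser fun n => Dop (s n).1 x)
      + fexp (-ser fun n => (s n).1 x) * (-ser fun n => Dop (Dop (s n).1) x) = X * (C Complex.I *
      (ser fun n => Dop (Dop (liftTop δ (s n).1 (s n).2)) x) - C (Dop (Dop u) x)) := by
  have h0 : ∀ x, fexp (-ser fun n => (s n).1 x) = 1 + X * (C Complex.I *
      (ser fun n => liftTop δ (s n).1 (s n).2 x) - C (u x)) := by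
    intro x
    rw [hs.eq_u x, ser_expU]
    simp only [linU_I, smul_apply, smul_eq_mul, C_mul_ser]
  have hE : ∀ x, HasSerDeriv (fun y => fexp (-ser fun n => (s n).1 y))
      (fexp (-ser fun n => (s n).1 x) * (-ser fun n => Dop (s n).1 x)) x := by
    intro x
    simp only [← ser_neg]
    refine HasSerDeriv.fexp (f := fun n y => -(s n).1 y) ?_ fun n =>
      (hasDerivAt_schwartz (s n).1 x).fun_neg
    funext y
    simp [hs.zero]
  have h1 : ∀ x, fexp (-ser fun n => (s n).1 x) * (-ser fun n => Dop (s n).1 x) = X * (C Complex.I *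
      (ser fun n => Dop (liftTop δ (s n).1 (s n).2) x) - C (Dop u x)) := by
    intro x
    have a := hE x
    simp only [h0] at a
    have b := HasSerDeriv.const_add 1 (HasSerDeriv.const_mul X
      (((hasSerDeriv_schwartz (fun n => liftTop δ (s n).1 (s n).2) x).const_mul
        (C Complex.I)).sub (HasSerDeriv.C (hasDerivAt_schwartz u x))))
    rw [h0]
    exact a.unique b
  have hD : HasSerDeriv (fun y => -ser fun n => Dop (s n).1 y) (-ser fun n => Dop (Dop (s n).1) x) x := by
    simp only [← ser_neg]
    exact HasSerDeriv.ser fun n => (hasDerivAt_schwartz (Dop (s n).1) x).fun_neg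
  refine ⟨h0 x, h1 x, ?_⟩
  have a := (hE x).mul hD
  simp only [h1] at a
  have b := (HasSerDeriv.const_mul X
      (((hasSerDeriv_schwartz (fun n => Dop (liftTop δ (s n).1 (s n).2)) x).const_mul
        (C Complex.I)).sub (HasSerDeriv.C (hasDerivAt_schwartz (Dop u) x))))
  rw [h1]
  exact a.unique b

/-- The second relation, with its first two derivatives in `x`. -/
theorem relation_v (δ : ℝ) (u v : 𝓢(ℝ, ℂ)) (s : ℕ → 𝓢(ℝ, ℂ) × 𝓢(ℝ, ℂ))
    (hs : IsSol δ Complex.I u v s) (x : ℝ) :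
    fexp (ser fun n => (s n).2 x) = 1 + X * (C (v x) + C Complex.I *
      (ser fun n => liftBot δ (s n).2 (s n).1 x)) ∧
    fexp (ser fun n => (s n).2 x) * (ser fun n => Dop (s n).2 x) = X * (C (Dop v x) + C Complex.I *
      (ser fun n => Dop (liftBot δ (s n).2 (s n).1) x)) ∧
    fexp (ser fun n => (s n).2 x) * (ser fun n => Dop (s n).2 x) * (ser fun n => Dop (s n).2 x)
      + fexp (ser fun n => (s n).2 x) * (ser fun n => Dop (Dop (s n).2) x)
      = X * (C (Dop (Dop v) x) + C Complex.I *
      (ser fun n => Dop (Dop (liftBot δ (s n).2 (s n).1)) x)) := by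
  have h0 : ∀ x, fexp (ser fun n => (s n).2 x) = 1 + X * (C (v x) + C Complex.I *
      (ser fun n => liftBot δ (s n).2 (s n).1 x)) := by
    intro x
    rw [hs.eq_v x, ser_expV]
    simp only [linV_I, smul_apply, smul_eq_mul, C_mul_ser, neg_mul, ser_neg, sub_neg_eq_add]
  have hE : ∀ x, HasSerDeriv (fun y => fexp (ser fun n => (s n).2 y))
      (fexp (ser fun n => (s n).2 x) * (ser fun n => Dop (s n).2 x)) x := by
    intro x
    refine HasSerDeriv.fexp (f := fun n y => (s n).2 y) ?_ fun n =>
      (hasDerivAt_schwartz (s n).2 x)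
    funext y
    simp [hs.zero]
  have h1 : ∀ x, fexp (ser fun n => (s n).2 x) * (ser fun n => Dop (s n).2 x) = X * (C (Dop v x)
      + C Complex.I * (ser fun n => Dop (liftBot δ (s n).2 (s n).1) x)) := by
    intro x
    have a := hE x
    simp only [h0] at a
    have b := HasSerDeriv.const_add 1 (HasSerDeriv.const_mul X
      ((HasSerDeriv.C (hasDerivAt_schwartz v x)).add
      ((hasSerDeriv_schwartz (fun n => liftBot δ (s n).2 (s n).1) x).const_mul
        (C Complex.I))))
    rw [h0]
    exact a.unique b
  refine ⟨h0 x, h1 x, ?_⟩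
  have a := (hE x).mul (hasSerDeriv_schwartz (fun n => Dop (s n).2) x)
  simp only [h1] at a
  have b := (HasSerDeriv.const_mul X
      ((HasSerDeriv.C (hasDerivAt_schwartz (Dop v) x)).add
      ((hasSerDeriv_schwartz (fun n => Dop (liftBot δ (s n).2 (s n).1)) x).const_mul
        (C Complex.I))))
  rw [h1]
  exact a.unique b

/-- Uniqueness for the linearised relations. -/
theorem linearised_unique {δ : ℝ} {ι : ℂ} {E F : ℝ → PowerSeries ℂ}
    (hE : ∀ x, constantCoeff (E x) = 1) (hF : ∀ x, constantCoeff (F x) = 1)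
    {y z : ℕ → 𝓢(ℝ, ℂ) × 𝓢(ℝ, ℂ)}
    (h₁ : ∀ x, E x * (ser fun n => (y n).1 x) + X * (ser fun n => linU δ ι (y n) x)
      = E x * (ser fun n => (z n).1 x) + X * (ser fun n => linU δ ι (z n) x))
    (h₂ : ∀ x, F x * (ser fun n => (y n).2 x) + X * (ser fun n => linV δ ι (y n) x)
      = F x * (ser fun n => (z n).2 x) + X * (ser fun n => linV δ ι (z n) x)) (n : ℕ) :
    y n = z n := by
  induction n using Nat.strong_induction_on with
  | _ n ih =>
    have key : ∀ (E : PowerSeries ℂ) (hE : constantCoeff E = 1) (a b c d : ℕ → ℂ)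
        (_ : ∀ m < n, a m = b m) (_ : ∀ m < n, c m = d m)
        (_ : E * ser a + X * ser c = E * ser b + X * ser d), a n = b n := by
      intro E hE a b c d h h' e
      have e' := congrArg (coeff n) e
      have hX : coeff n (X * ser c) = coeff n (X * ser d) := by
        cases n with
        | zero => simp
        | succ n => rw [coeff_succ_X_mul, coeff_succ_X_mul, coeff_ser, coeff_ser, h' n n.lt_succ_self]
      rw [map_add, map_add, hX, add_left_inj, coeff_mul, coeff_mul,
        Finset.Nat.sum_antidiagonal_eq_sum_range_succ_mk,
        Finset.Nat.sum_antidiagonal_eq_sum_range_succ_mk, Finset.sum_range_succ',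
        Finset.sum_range_succ'] at e'
      have : ∀ k ∈ Finset.range n, coeff (k + 1) E * coeff (n - (k + 1)) (ser a)
          = coeff (k + 1) E * coeff (n - (k + 1)) (ser b) := fun k hk => by
        rw [coeff_ser, coeff_ser, h _ (by have := Finset.mem_range.1 hk; omega)]
      rw [Finset.sum_congr rfl this, add_right_inj] at e'
      simpa [hE, coeff_ser] using e'
    refine Prod.ext ?_ ?_
    · ext x
      exact key _ (hE x) _ _ _ _ (fun m hm => by rw [ih m hm]) (fun m hm => by rw [ih m hm]) (h₁ x)
    · ext x
      exact key _ (hF x) _ _ _ _ (fun m hm => by rw [ih m hm]) (fun m hm => by rw [ih m hm]) (h₂ x)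

/-- The time derivative of `u` prescribed by the equation. -/
def flowU (δ : ℝ) (u v : 𝓢(ℝ, ℂ)) : 𝓢(ℝ, ℂ) :=
  -((2 : ℂ) • mulS u (Dop u) + Aop δ (Dop u) + Bop δ (Dop v))

/-- The time derivative of `v` prescribed by the equation. -/
def flowV (δ : ℝ) (u v : 𝓢(ℝ, ℂ)) : 𝓢(ℝ, ℂ) :=
  (2 : ℂ) • mulS v (Dop v) + Aop δ (Dop v) + Bop δ (Dop u)

/-- The equation of motion in terms of boundary values: the terms T uₓₓ + T̃ vₓₓ are absorbed by the
lift of (u, v). This fixes q as twice that lift. -/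
theorem I_smul_Dop_liftTop {δ : ℝ} (hδ : 0 < δ) (u v : 𝓢(ℝ, ℂ)) (x : ℝ) :
    Complex.I * (2 * Dop (liftTop δ u v) x)
      = Complex.I * Dop (Dop u) x + flowU δ u v x + 2 * u x * Dop u x := by
  simp only [liftTop, flowU, map_smul, map_add, Dop_Aop hδ, Dop_Bop hδ, smul_apply, add_apply, neg_apply,
    mulS_apply, smul_eq_mul]
  linear_combination (Aop δ (Dop u) x + Bop δ (Dop v) x) * Complex.I_sq

theorem I_smul_Dop_liftBot {δ : ℝ} (hδ : 0 < δ) (u v : 𝓢(ℝ, ℂ)) (x : ℝ) :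
    Complex.I * (2 * Dop (liftBot δ v u) x)
      = -(Complex.I * Dop (Dop v) x) - flowV δ u v x + 2 * v x * Dop v x := by
  simp only [liftBot, flowV, map_smul, map_add, map_neg, Dop_Aop hδ, Dop_Bop hδ, smul_apply, add_apply,
    neg_apply, mulS_apply, smul_eq_mul]
  linear_combination (Aop δ (Dop v) x + Bop δ (Dop u) x) * Complex.I_sq

/-- The time derivatives of the coefficients along the flow have total integral zero. -/
theorem integral_linearised_eq_zero {δ : ℝ} (hδ : 0 < δ) (u v : 𝓢(ℝ, ℂ))
    {s d : ℕ → 𝓢(ℝ, ℂ) × 𝓢(ℝ, ℂ)} (hs : IsSol δ Complex.I u v s)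
    (h₁ : ∀ x, fexp (-ser fun n => (s n).1 x) * (ser fun n => (d n).1 x)
      + X * (ser fun n => linU δ Complex.I (d n) x) = X * C (flowU δ u v x))
    (h₂ : ∀ x, fexp (ser fun n => (s n).2 x) * (ser fun n => (d n).2 x)
      + X * (ser fun n => linV δ Complex.I (d n) x) = X * C (flowV δ u v x)) (n : ℕ) :
    ∫ x, ((d n).1 x + (d n).2 x) = 0 := by
  -- These four series are the expected boundary values, top (t) and bottom (b), of ζ⁻¹ (log M_j)_t
  -- for j = 2, 1.
  set g2t := gam (fun n => liftTop δ (s n).1 (s n).2) ((2 : ℂ) • liftTop δ u v) with hg2t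
  set g1b := gam (fun n => liftBot δ (s n).1 (s n).2) ((2 : ℂ) • liftBot δ u v) with hg1b
  set g1t := gam (fun n => liftTop δ (s n).2 (s n).1) ((2 : ℂ) • liftTop δ v u) with hg1t
  set g2b := gam (fun n => liftBot δ (s n).2 (s n).1) ((2 : ℂ) • liftBot δ v u) with hg2b
  have p2 : ∀ n, IsStripPair δ (g2b n) (g2t n) :=
    isStripPair_gam (fun n => isStripPair_lift hδ _ _) ((isStripPair_lift hδ _ _).smul _)
  have p1 : ∀ n, IsStripPair δ (g1b n) (g1t n) :=
    isStripPair_gam (fun n => isStripPair_lift hδ _ _) ((isStripPair_lift hδ _ _).smul _)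
  set G : ℕ → 𝓢(ℝ, ℂ) × 𝓢(ℝ, ℂ) := fun n => (g2t n - g1b n, g1t n - g2b n) with hG
  have hlift : ∀ n, Dop (g2t n) = liftTop δ (G n).1 (G n).2 ∧
      Dop (g2b n) = liftBot δ (G n).2 (G n).1 := fun n =>
    IsStripPair.eq_lift hδ (p1 n).map_Dop (p2 n).map_Dop (map_sub _ _ _).symm (map_sub _ _ _).symm
  have hI : (C Complex.I * C Complex.I : PowerSeries ℂ) = -1 := by
    rw [← map_mul, Complex.I_mul_I, map_neg, map_one]
  have hIn : (C (-Complex.I) : PowerSeries ℂ) = -C Complex.I := map_neg _ _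
  have h2n : (C (-2) : PowerSeries ℂ) = -2 := by rw [map_neg, map_ofNat]
  -- The series of z is X times that of d, to match the factor ζ⁻¹ carried by `gam`.
  set z : ℕ → 𝓢(ℝ, ℂ) × 𝓢(ℝ, ℂ) := fun n => match n with
    | 0 => 0
    | n + 1 => d n with hz
  have hser : ∀ f : 𝓢(ℝ, ℂ) × 𝓢(ℝ, ℂ) → ℂ, f 0 = 0 →
      (ser fun n => f (z n)) = X * ser fun n => f (d n) := by
    intro f hf
    ext n
    cases n with
    | zero => simp [coeff_ser, hz, hf]
    | succ n => rw [coeff_succ_X_mul, coeff_ser, coeff_ser]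
  have hGz : ∀ n, G n = z n := by
    refine linearised_unique (δ := δ) (ι := Complex.I)
      (E := fun x => fexp (-ser fun n => (s n).1 x)) (F := fun x => fexp (ser fun n => (s n).2 x))
      (fun x => ?_) (fun x => ?_) (fun x => ?_) (fun x => ?_)
    · rw [constantCoeff_fexp]; simp [constantCoeff_ser, hs.zero]
    · rw [constantCoeff_fexp]; simp [constantCoeff_ser, hs.zero]
    · obtain ⟨e0, e1, e2⟩ := relation_u δ u v s hs x
      rw [hser (fun p => p.1 x) rfl, hser (fun p => linU δ Complex.I p x) (by rw [linU_zero]; rfl)]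
      have hb : ∀ n, liftBot δ (s n).1 (s n).2 = liftTop δ (s n).1 (s n).2 - Dop (s n).1 := fun n => by
        rw [← liftTop_sub_liftBot δ (s n).1 (s n).2, sub_sub_cancel]
      have hb' : liftBot δ u v = liftTop δ u v - Dop u := by
        rw [← liftTop_sub_liftBot δ u v, sub_sub_cancel]
      have a1 := ser_gam (fun n => liftTop δ (s n).1 (s n).2) ((2 : ℂ) • liftTop δ u v) x
      have a2 := ser_gam (fun n => liftBot δ (s n).1 (s n).2) ((2 : ℂ) • liftBot δ u v) x
      have a3 := ser_Dop_gam (fun n => liftTop δ (s n).1 (s n).2) ((2 : ℂ) • liftTop δ u v) x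
      simp only [hb, hb', map_sub, sub_apply, ser_sub, map_smul, smul_apply, smul_eq_mul, map_mul,
        hIn, h2n, map_ofNat] at a1 a2 a3
      have a4 := congrArg (C (R := ℂ)) (I_smul_Dop_liftTop hδ u v x)
      simp only [map_add, map_mul, map_ofNat] at a4
      have hG1 : (ser fun n => (G n).1 x) = (ser fun n => g2t n x) - ser fun n => g1b n x := by
        rw [← ser_sub]; rfl
      have hG2 : (ser fun n => linU δ Complex.I (G n) x)
          = C Complex.I * ser fun n => Dop (g2t n) x := by
        rw [C_mul_ser]
        simp only [linU_I, ← (hlift _).1, smul_apply, smul_eq_mul]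
      rw [hG1, hG2, hg2t, hg1b]
      simp only [hb, hb']
      rw [a1, a2, a3]
      -- The relation `e0` and its x-derivatives `e1`, `e2` eliminate the exponential; `a4` brings
      -- in the equation for u.
      linear_combination
        (2 + 2 * C Complex.I * X * (ser fun n => liftTop δ (s n).1 (s n).2 x)) * e1
          + C Complex.I * X * e2 + 2 * X * C (Dop u x) * e0 + X ^ 2 * a4 - X * h₁ x
    · obtain ⟨e0, e1, e2⟩ := relation_v δ u v s hs x
      rw [hser (fun p => p.2 x) rfl, hser (fun p => linV δ Complex.I p x) (by rw [linV_zero]; rfl)]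
      have hb : ∀ n, liftTop δ (s n).2 (s n).1 = liftBot δ (s n).2 (s n).1 + Dop (s n).2 := fun n => by
        rw [← liftTop_sub_liftBot δ (s n).2 (s n).1, add_sub_cancel]
      have hb' : liftTop δ v u = liftBot δ v u + Dop v := by
        rw [← liftTop_sub_liftBot δ v u, add_sub_cancel]
      have a1 := ser_gam (fun n => liftBot δ (s n).2 (s n).1) ((2 : ℂ) • liftBot δ v u) x
      have a2 := ser_gam (fun n => liftTop δ (s n).2 (s n).1) ((2 : ℂ) • liftTop δ v u) x
      have a3 := ser_Dop_gam (fun n => liftBot δ (s n).2 (s n).1) ((2 : ℂ) • liftBot δ v u) x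
      simp only [hb, hb', map_add, add_apply, ser_add, map_smul, smul_apply, smul_eq_mul, map_mul,
        hIn, h2n, map_ofNat] at a1 a2 a3
      have a4 := congrArg (C (R := ℂ)) (I_smul_Dop_liftBot hδ u v x)
      simp only [map_add, map_mul, map_ofNat, map_sub, map_neg] at a4
      have hG1 : (ser fun n => (G n).2 x) = (ser fun n => g1t n x) - ser fun n => g2b n x := by
        rw [← ser_sub]; rfl
      have hG2 : (ser fun n => linV δ Complex.I (G n) x)
          = -C Complex.I * ser fun n => Dop (g2b n) x := by
        rw [← hIn, C_mul_ser]
        simp only [linV_I, ← (hlift _).2, smul_apply, smul_eq_mul]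
      rw [hG1, hG2, hg1t, hg2b]
      simp only [hb, hb']
      rw [a1, a2, a3]
      linear_combination
        (-2 - 2 * C Complex.I * X * (ser fun n => liftBot δ (s n).2 (s n).1 x)) * e1
          - C Complex.I * X * e2 + 2 * X * C (Dop v x) * e0 - X ^ 2 * a4 - X * h₂ x
  -- The jumps compare different strip functions, but their sum regroups into top minus bottom of
  -- each single one.
  have e : ∀ x, (d n).1 x + (d n).2 x = (g2t (n + 1) x - g2b (n + 1) x)
      + (g1t (n + 1) x - g1b (n + 1) x) := by
    intro x
    have h := hGz (n + 1)
    have h1 := congrArg (fun p => p.1 x) h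
    have h2 := congrArg (fun p => p.2 x) h
    simp only [hG, hz, sub_apply] at h1 h2
    rw [← h1, ← h2]
    ring
  simp only [e]
  rw [integral_add, integral_sub, integral_sub, (p2 _).integral_eq, (p1 _).integral_eq]
  · ring
  all_goals first | exact SchwartzMap.integrable _ | exact (SchwartzMap.integrable _).sub (SchwartzMap.integrable _)

end Flow

/-! ### Conservation along solutions -/

section Conservation

open PowerSeries MeasureTheory

theorem continuous_flowU (δ : ℝ) : Continuous fun p : 𝓢(ℝ, ℂ) × 𝓢(ℝ, ℂ) => flowU δ p.1 p.2 := by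
  have h : Continuous fun p : 𝓢(ℝ, ℂ) × 𝓢(ℝ, ℂ) => mulS p.1 (Dop p.1) :=
    continuous_mulS.comp (continuous_fst.prodMk ((Dop).continuous.comp continuous_fst))
  exact (((h.fun_const_smul (2 : ℂ)).fun_add
    (((Aop δ).comp Dop).continuous.comp continuous_fst)).fun_add
    (((Bop δ).comp Dop).continuous.comp continuous_snd)).fun_neg

theorem flowV_eq (δ : ℝ) (u v : 𝓢(ℝ, ℂ)) : flowV δ u v = -flowU δ v u := (neg_neg _).symm

theorem continuous_flowV (δ : ℝ) : Continuous fun p : 𝓢(ℝ, ℂ) × 𝓢(ℝ, ℂ) => flowV δ p.1 p.2 := by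
  simp only [flowV_eq]
  exact ((continuous_flowU δ).comp continuous_swap).fun_neg

theorem flowU_apply {δ : ℝ} (hδ : 0 < δ) (u v : 𝓢(ℝ, ℂ)) (x : ℝ) : flowU δ u v x
    = -(2 * u x * deriv u x) - T δ (deriv (deriv u)) x - Tt δ (deriv (deriv v)) x := by
  have hu := T_deriv hδ (Dop u) x
  have hv := Tt_deriv hδ (Dop v) x
  rw [coe_Dop] at hu hv
  rw [hu, hv, ← Dop_apply u]
  simp only [flowU, neg_apply, add_apply, smul_apply, mulS_apply, smul_eq_mul]
  ring

theorem flowV_apply {δ : ℝ} (hδ : 0 < δ) (u v : 𝓢(ℝ, ℂ)) (x : ℝ) : flowV δ u v x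
    = 2 * v x * deriv v x + T δ (deriv (deriv v)) x + Tt δ (deriv (deriv u)) x := by
  have hu := T_deriv hδ (Dop v) x
  have hv := Tt_deriv hδ (Dop u) x
  rw [coe_Dop] at hu hv
  rw [hu, hv, ← Dop_apply v]
  simp only [flowV, add_apply, smul_apply, mulS_apply, smul_eq_mul]
  ring

theorem IsSolution.isCurve {δ : ℝ} (hδ : 0 < δ) {J : Set ℝ} {u v : ℝ → 𝓢(ℝ, ℂ)}
    (h : IsSolution δ J u v) :
    IsCurve (interior J) u (fun t => flowU δ (u t) (v t)) ∧
      IsCurve (interior J) v (fun t => flowV δ (u t) (v t)) := by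
  have hu := h.continuousOn_u.mono interior_subset
  have hv := h.continuousOn_v.mono interior_subset
  have huv : ContinuousOn (fun t => (u t, v t)) (interior J) := hu.prodMk hv
  have hU : ContinuousOn (fun t => flowU δ (u t) (v t)) (interior J) := by
    have h1 := (continuous_flowU δ).comp_continuousOn huv
    simpa only [Function.comp_def] using h1
  have hV : ContinuousOn (fun t => flowV δ (u t) (v t)) (interior J) := by
    have h1 := (continuous_flowV δ).comp_continuousOn huv
    simpa only [Function.comp_def] using h1
  refine ⟨⟨hu, hU, fun t ht x => ?_⟩, ⟨hv, hV, fun t ht x => ?_⟩⟩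
  · have h1 := (h.eq_u t (interior_subset ht) x).hasDerivAt (mem_interior_iff_mem_nhds.1 ht)
    rwa [← flowU_apply hδ] at h1
  · have h1 := (h.eq_v t (interior_subset ht) x).hasDerivAt (mem_interior_iff_mem_nhds.1 ht)
    rwa [← flowV_apply hδ] at h1

theorem integral_mulS_Dop_self (f : 𝓢(ℝ, ℂ)) : ∫ x, mulS f (Dop f) x = 0 := by
  have h := integral_Dop (mulS f f)
  rw [Dop_mulS] at h
  have h2 : ∫ x, (mulS (Dop f) f + mulS f (Dop f)) x = ∫ x, (2 : ℂ) * mulS f (Dop f) x := by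
    refine integral_congr_ae (Filter.Eventually.of_forall fun x => ?_)
    simp only [add_apply, mulS_apply]
    ring
  rw [h2, integral_const_mul] at h
  exact (mul_eq_zero.1 h).resolve_left two_ne_zero

theorem integral_flowU {δ : ℝ} (hδ : 0 < δ) (u v : 𝓢(ℝ, ℂ)) : ∫ x, flowU δ u v x = 0 := by
  simp only [flowU, neg_apply, add_apply, smul_apply, smul_eq_mul]
  rw [integral_neg, integral_add, integral_add, integral_const_mul, integral_mulS_Dop_self,
    integral_Aop hδ, integral_Bop hδ, integral_Dop, integral_Dop]
  · simp
  · exact (SchwartzMap.integrable _).const_mul _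
  · exact SchwartzMap.integrable _
  · exact ((SchwartzMap.integrable _).const_mul _).add (SchwartzMap.integrable _)
  · exact SchwartzMap.integrable _

theorem integral_flowV {δ : ℝ} (hδ : 0 < δ) (u v : 𝓢(ℝ, ℂ)) : ∫ x, flowV δ u v x = 0 := by
  simp only [flowV_eq, neg_apply]
  rw [integral_neg, integral_flowU hδ, neg_zero]

/-- The time derivative of the sum of the `n`-th coefficients has integral zero. -/
theorem hasDerivAt_integral_sol {δ : ℝ} (hδ : 0 < δ) {J : Set ℝ} (hJ : IsOpen J)
    {u v : ℝ → 𝓢(ℝ, ℂ)} (hu : IsCurve J u (fun t => flowU δ (u t) (v t)))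
    (hv : IsCurve J v (fun t => flowV δ (u t) (v t))) {t : ℝ} (ht : t ∈ J) (n : ℕ) :
    HasDerivAt (fun r => ∫ x, ((sol δ Complex.I (u r) (v r) n).1
      + (sol δ Complex.I (u r) (v r) n).2) x) 0 t := by
  choose d hd using exists_isCurve_sol hJ hδ Complex.I hu hv
  refine (((hd n).1.add (hd n).2).integral hJ ht).congr_deriv ?_
  refine integral_linearised_eq_zero hδ (u t) (v t) (isSol_sol δ Complex.I (u t) (v t))
    (d := fun n => d n t) (fun x => ?_) (fun x => ?_) n
  · have a : HasSerDeriv (fun r => fexp (-ser fun n => (sol δ Complex.I (u r) (v r) n).1 x))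
        (fexp (-ser fun n => (sol δ Complex.I (u t) (v t) n).1 x) * (-ser fun n => (d n t).1 x)) t := by
      simp only [← ser_neg]
      refine HasSerDeriv.fexp (f := fun n r => -(sol δ Complex.I (u r) (v r) n).1 x) ?_ fun n =>
        ((hd n).1.deriv t ht x).fun_neg
      funext r
      simp [sol_zero]
    have b : HasSerDeriv (fun r => 1 + X * ((ser fun n => linU δ Complex.I
        (sol δ Complex.I (u r) (v r) n) x) - C (u r x))) (X * ((ser fun n => linU δ Complex.I
          (d n t) x) - C (flowU δ (u t) (v t) x))) t :=
      HasSerDeriv.const_add 1 (HasSerDeriv.const_mul X ((HasSerDeriv.ser fun n =>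
        (((hd n).1.linU hJ hδ Complex.I (hd n).2).deriv t ht x)).sub (HasSerDeriv.C (hu.deriv t ht x))))
    simp only [(isSol_sol δ Complex.I _ _).eq_u x, ser_expU] at a
    -- Both sides of the first relation are differentiated in time; equality of the derivatives is
    -- the linearised relation.
    have c := a.unique b
    rw [(isSol_sol δ Complex.I _ _).eq_u x, ser_expU]
    linear_combination -c
  · have a : HasSerDeriv (fun r => fexp (ser fun n => (sol δ Complex.I (u r) (v r) n).2 x))
        (fexp (ser fun n => (sol δ Complex.I (u t) (v t) n).2 x) * (ser fun n => (d n t).2 x)) t := by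
      refine HasSerDeriv.fexp (f := fun n r => (sol δ Complex.I (u r) (v r) n).2 x) ?_ fun n =>
        ((hd n).2.deriv t ht x)
      funext r
      simp [sol_zero]
    have b : HasSerDeriv (fun r => 1 + X * (C (v r x) - (ser fun n => linV δ Complex.I
        (sol δ Complex.I (u r) (v r) n) x))) (X * (C (flowV δ (u t) (v t) x) -
          (ser fun n => linV δ Complex.I (d n t) x))) t :=
      HasSerDeriv.const_add 1 (HasSerDeriv.const_mul X ((HasSerDeriv.C (hv.deriv t ht x)).sub
        (HasSerDeriv.ser fun n => (((hd n).1.linV hJ hδ Complex.I (hd n).2).deriv t ht x))))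
    simp only [(isSol_sol δ Complex.I _ _).eq_v x, ser_expV] at a
    have c := a.unique b
    rw [(isSol_sol δ Complex.I _ _).eq_v x, ser_expV]
    linear_combination c

/-- Time derivatives are used only in the interior of J; continuity carries the constancy to
endpoints that belong to J. -/
theorem eq_of_hasDerivAt_zero {J : Set ℝ} (hJ : J.OrdConnected) {f : ℝ → ℂ}
    (hc : ContinuousOn f J) (hd : ∀ t ∈ interior J, HasDerivAt f 0 t) {s t : ℝ} (hs : s ∈ J)
    (ht : t ∈ J) : f s = f t := by
  wlog hst : s ≤ t generalizing s t
  · exact (this ht hs (le_of_not_ge hst)).symm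
  rcases hst.eq_or_lt with rfl | hst
  · rfl
  have hsub : Set.Icc s t ⊆ J := hJ.out hs ht
  have hint : Set.Ioo s t ⊆ interior J :=
    interior_maximal (Set.Ioo_subset_Icc_self.trans hsub) isOpen_Ioo
  have hm : (s + t) / 2 ∈ Set.Ioo s t := ⟨by linarith, by linarith⟩
  have h1 : Set.EqOn f (fun _ => f ((s + t) / 2)) (Set.Ioo s t) := fun r hr =>
    isOpen_Ioo.is_const_of_deriv_eq_zero isPreconnected_Ioo
      (fun r hr => (hd r (hint hr)).differentiableAt.differentiableWithinAt)
      (fun r hr => (hd r (hint hr)).deriv) hr hm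
  have h2 : Set.EqOn f (fun _ => f ((s + t) / 2)) (Set.Icc s t) :=
    h1.of_subset_closure (hc.mono hsub) continuousOn_const Set.Ioo_subset_Icc_self
      (closure_Ioo hst.ne).ge
  rw [h2 (Set.left_mem_Icc.2 hst.le), h2 (Set.right_mem_Icc.2 hst.le)]

theorem continuous_integral_schwartz : Continuous fun f : 𝓢(ℝ, ℂ) => ∫ x, f x :=
  (SchwartzMap.integralCLM ℂ (volume : Measure ℝ)).continuous

theorem IsSolution.integral_sol_eq {δ : ℝ} (hδ : 0 < δ) {J : Set ℝ} (hJ : J.OrdConnected)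
    {u v : ℝ → 𝓢(ℝ, ℂ)} (h : IsSolution δ J u v) {s t : ℝ} (hs : s ∈ J) (ht : t ∈ J) (n : ℕ) :
    ∫ x, ((sol δ Complex.I (u s) (v s) n).1 x + (sol δ Complex.I (u s) (v s) n).2 x)
      = ∫ x, ((sol δ Complex.I (u t) (v t) n).1 x + (sol δ Complex.I (u t) (v t) n).2 x) := by
  obtain ⟨hu, hv⟩ := h.isCurve hδ
  refine eq_of_hasDerivAt_zero (f := fun r => ∫ x, ((sol δ Complex.I (u r) (v r) n).1
      + (sol δ Complex.I (u r) (v r) n).2) x) hJ ?_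
    (fun r hr => hasDerivAt_integral_sol hδ isOpen_interior hu hv hr n) hs ht
  have hc := continuous_sol δ Complex.I n
  exact (continuous_integral_schwartz.comp (hc.fst.add hc.snd)).comp_continuousOn
    (h.continuousOn_u.prodMk h.continuousOn_v)

theorem IsSolution.integral_u_eq {δ : ℝ} (hδ : 0 < δ) {J : Set ℝ} (hJ : J.OrdConnected)
    {u v : ℝ → 𝓢(ℝ, ℂ)} (h : IsSolution δ J u v) {s t : ℝ} (hs : s ∈ J) (ht : t ∈ J) :
    ∫ x, u s x = ∫ x, u t x :=
  eq_of_hasDerivAt_zero (f := fun r => ∫ x, u r x) hJ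
    (continuous_integral_schwartz.comp_continuousOn h.continuousOn_u)
    (fun _ hr => ((h.isCurve hδ).1.integral isOpen_interior hr).congr_deriv (integral_flowU hδ _ _))
    hs ht

theorem IsSolution.integral_v_eq {δ : ℝ} (hδ : 0 < δ) {J : Set ℝ} (hJ : J.OrdConnected)
    {u v : ℝ → 𝓢(ℝ, ℂ)} (h : IsSolution δ J u v) {s t : ℝ} (hs : s ∈ J) (ht : t ∈ J) :
    ∫ x, v s x = ∫ x, v t x :=
  eq_of_hasDerivAt_zero (f := fun r => ∫ x, v r x) hJ
    (continuous_integral_schwartz.comp_continuousOn h.continuousOn_v)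
    (fun _ hr => ((h.isCurve hδ).2.integral isOpen_interior hr).congr_deriv (integral_flowV hδ _ _))
    hs ht

/-- The equation is invariant under complex conjugation. -/
theorem IsSolution.conj {δ : ℝ} (hδ : 0 < δ) {J : Set ℝ} {u v : ℝ → 𝓢(ℝ, ℂ)}
    (h : IsSolution δ J u v) : IsSolution δ J (fun t => conjS (u t)) (fun t => conjS (v t)) := by
  have hc : Continuous conjS :=
    (SchwartzMap.postcompCLM (𝕜 := ℝ) (Complex.conjCLE : ℂ →L[ℝ] ℂ)).continuous
  have e : ∀ f : 𝓢(ℝ, ℂ), deriv f = Dop f := fun f => (coe_Dop f).symm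
  have hA : ∀ (f : 𝓢(ℝ, ℂ)) x, T δ (deriv (deriv (conjS f))) x
      = (starRingEnd ℂ) (T δ (deriv (deriv f)) x) := fun f x => by
    rw [e, Dop_conjS, T_deriv hδ, Aop_conjS hδ, e, T_deriv hδ, conjS_apply]
  have hB : ∀ (f : 𝓢(ℝ, ℂ)) x, Tt δ (deriv (deriv (conjS f))) x
      = (starRingEnd ℂ) (Tt δ (deriv (deriv f)) x) := fun f x => by
    rw [e, Dop_conjS, Tt_deriv hδ, Bop_conjS hδ, e, Tt_deriv hδ, conjS_apply]
  refine ⟨hc.comp_continuousOn h.continuousOn_u, hc.comp_continuousOn h.continuousOn_v,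
    fun t ht x => ?_, fun t ht x => ?_⟩
  · have a := (Complex.conjCLE : ℂ →L[ℝ] ℂ).hasFDerivAt.comp_hasDerivWithinAt t (h.eq_u t ht x)
    refine a.congr_deriv ?_
    rw [hA, hB, e (conjS _), Dop_conjS, conjS_apply, conjS_apply, e (u t)]
    simp [map_ofNat]
  · have a := (Complex.conjCLE : ℂ →L[ℝ] ℂ).hasFDerivAt.comp_hasDerivWithinAt t (h.eq_v t ht x)
    refine a.congr_deriv ?_
    rw [hA, hB, e (conjS _), Dop_conjS, conjS_apply, conjS_apply, e (v t)]
    simp [map_ofNat]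

theorem sol_conj {δ : ℝ} (hδ : 0 < δ) (u v : 𝓢(ℝ, ℂ)) (n : ℕ) :
    sol δ Complex.I u v n = (conjS (sol δ (-Complex.I) (conjS u) (conjS v) n).1,
      conjS (sol δ (-Complex.I) (conjS u) (conjS v) n).2) := by
  rw [← conjS_sol hδ, conjS_conjS, conjS_conjS, map_neg, Complex.conj_I, neg_neg]

theorem integral_sol_conj {δ : ℝ} (hδ : 0 < δ) (u v : 𝓢(ℝ, ℂ)) (n : ℕ) :
    ∫ x, ((sol δ Complex.I u v n).1 x + (sol δ Complex.I u v n).2 x)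
      = (starRingEnd ℂ) (∫ x, ((sol δ (-Complex.I) (conjS u) (conjS v) n).1 x
        + (sol δ (-Complex.I) (conjS u) (conjS v) n).2 x)) := by
  rw [sol_conj hδ, ← integral_conj]
  simp only [conjS_apply, map_add]

/-- The strip argument covers `ι = i`. Applied to the conjugate solution it gives `ι = -i`. -/
theorem IsSolution.integral_sol_neg_eq {δ : ℝ} (hδ : 0 < δ) {J : Set ℝ} (hJ : J.OrdConnected)
    {u v : ℝ → 𝓢(ℝ, ℂ)} (h : IsSolution δ J u v) {s t : ℝ} (hs : s ∈ J) (ht : t ∈ J) (n : ℕ) :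
    ∫ x, ((sol δ (-Complex.I) (u s) (v s) n).1 x + (sol δ (-Complex.I) (u s) (v s) n).2 x)
      = ∫ x, ((sol δ (-Complex.I) (u t) (v t) n).1 x + (sol δ (-Complex.I) (u t) (v t) n).2 x) := by
  have a := (h.conj hδ).integral_sol_eq hδ hJ hs ht n
  rw [integral_sol_conj hδ, integral_sol_conj hδ] at a
  simpa only [conjS_conjS] using (starRingEnd ℂ).injective a

end Conservation

/-! ### The first four conserved quantities -/

section ExplicitIntegrals

open MeasureTheory

theorem sol_two (δ : ℝ) (ι : ℂ) (u v : 𝓢(ℝ, ℂ)) (x : ℝ) :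
    (sol δ ι u v 2).1 x = u x ^ 2 / 2 - linU δ ι (u, v) x ∧
    (sol δ ι u v 2).2 x = -(v x ^ 2 / 2) - linV δ ι (u, v) x := by
  have h1 := sol_succ_fst δ ι u v 1
  have h2 := sol_succ_snd δ ι u v 1
  simp only [Finset.sum_range_one, Nat.reduceAdd, zero_add, sol_one, sol_zero, expU, expV,
    if_neg one_ne_zero, Nat.sub_self, linU_zero, linV_zero, if_true] at h1 h2
  constructor
  · rw [h1]; simp; ring
  · rw [h2]; simp; ring

theorem sol_three (δ : ℝ) (ι : ℂ) (u v : 𝓢(ℝ, ℂ)) (x : ℝ) :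
    (sol δ ι u v 3).1 x = u x ^ 3 / 3 - u x * linU δ ι (u, v) x - linU δ ι (sol δ ι u v 2) x ∧
    (sol δ ι u v 3).2 x = v x ^ 3 / 3 + v x * linV δ ι (u, v) x - linV δ ι (sol δ ι u v 2) x := by
  have h1 := congrArg (fun f : 𝓢(ℝ, ℂ) => f x) (sol_succ_fst δ ι u v 2)
  have h2 := congrArg (fun f : 𝓢(ℝ, ℂ) => f x) (sol_succ_snd δ ι u v 2)
  simp only [Finset.sum_range_succ, Finset.sum_range_zero, Nat.reduceAdd, Nat.reduceSub, zero_add,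
    sol_one, sol_zero, expU, expV, if_neg one_ne_zero, if_neg two_ne_zero, linU_zero, linV_zero,
    if_true, add_apply, sub_apply, neg_apply, smul_apply, zero_apply, smul_eq_mul, mulS_apply,
    (sol_two δ ι u v x).1, (sol_two δ ι u v x).2] at h1 h2
  constructor
  · rw [h1]; push_cast; ring
  · rw [h2]; push_cast; ring

theorem sol_four (δ : ℝ) (ι : ℂ) (u v : 𝓢(ℝ, ℂ)) (x : ℝ) :
    (sol δ ι u v 4).1 x = u x ^ 4 / 4 - u x ^ 2 * linU δ ι (u, v) x + linU δ ι (u, v) x ^ 2 / 2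
      - u x * linU δ ι (sol δ ι u v 2) x - linU δ ι (sol δ ι u v 3) x ∧
    (sol δ ι u v 4).2 x = -(v x ^ 4 / 4) - v x ^ 2 * linV δ ι (u, v) x - linV δ ι (u, v) x ^ 2 / 2
      + v x * linV δ ι (sol δ ι u v 2) x - linV δ ι (sol δ ι u v 3) x := by
  have h1 := congrArg (fun f : 𝓢(ℝ, ℂ) => f x) (sol_succ_fst δ ι u v 3)
  have h2 := congrArg (fun f : 𝓢(ℝ, ℂ) => f x) (sol_succ_snd δ ι u v 3)
  simp only [Finset.sum_range_succ, Finset.sum_range_zero, Nat.reduceAdd, Nat.reduceSub, zero_add,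
    sol_one, sol_zero, expU, expV, if_neg one_ne_zero, if_neg two_ne_zero, if_neg three_ne_zero,
    linU_zero, linV_zero, if_true, add_apply, sub_apply, neg_apply, smul_apply, zero_apply,
    smul_eq_mul, mulS_apply, (sol_two δ ι u v x).1, (sol_two δ ι u v x).2, (sol_three δ ι u v x).1,
    (sol_three δ ι u v x).2] at h1 h2
  constructor
  · rw [h1]; push_cast; ring
  · rw [h2]; push_cast; ring

theorem integral_schwartz_add (f g : 𝓢(ℝ, ℂ)) : ∫ x, (f + g) x = (∫ x, f x) + ∫ x, g x :=
  integral_add f.integrable g.integrable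

theorem integral_schwartz_sub (f g : 𝓢(ℝ, ℂ)) : ∫ x, (f - g) x = (∫ x, f x) - ∫ x, g x :=
  integral_sub f.integrable g.integrable

theorem integral_schwartz_smul (c : ℂ) (f : 𝓢(ℝ, ℂ)) : ∫ x, (c • f) x = c * ∫ x, f x :=
  integral_const_mul c f

/-- At zero frequency both symbols equal -1/δ and the derivative vanishes, so the two linear parts
cancel. This removes the last nonlocal term of each recursion step. -/
theorem integral_linU_add_linV {δ : ℝ} (hδ : 0 < δ) (ι : ℂ) (p : 𝓢(ℝ, ℂ) × 𝓢(ℝ, ℂ)) :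
    ∫ x, (linU δ ι p + linV δ ι p) x = 0 := by
  simp only [linU, linV, integral_schwartz_add, integral_schwartz_sub, integral_schwartz_smul,
    integral_Dop, integral_Aop hδ, integral_Bop hδ]
  ring

theorem integral_mul_Dop (f g : 𝓢(ℝ, ℂ)) :
    ∫ x, (mulS f (Dop g) + mulS (Dop f) g) x = 0 := by
  have h := integral_Dop (mulS f g)
  rw [Dop_mulS] at h
  rwa [add_comm]

theorem integral_sq_mul_Dop (f : 𝓢(ℝ, ℂ)) : ∫ x, mulS (mulS f f) (Dop f) x = 0 := by
  have h := integral_mul_Dop (mulS f f) f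
  rw [Dop_mulS] at h
  have e : ∀ x, (mulS (mulS f f) (Dop f) + mulS (mulS (Dop f) f + mulS f (Dop f)) f) x
      = ((3 : ℂ) • mulS (mulS f f) (Dop f)) x := by
    intro x
    simp only [add_apply, mulS_apply, smul_apply, smul_eq_mul]
    ring
  simp only [e, integral_schwartz_smul] at h
  exact (mul_eq_zero.1 h).resolve_left three_ne_zero

theorem integral_symm_Aop {δ : ℝ} (hδ : 0 < δ) (f g : 𝓢(ℝ, ℂ)) :
    ∫ x, (mulS f (Aop δ g) - mulS g (Aop δ f)) x = 0 := by
  rw [integral_schwartz_sub, sub_eq_zero]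
  simpa only [mulS_apply] using integral_mul_Aop hδ f g

theorem integral_symm_Bop {δ : ℝ} (hδ : 0 < δ) (f g : 𝓢(ℝ, ℂ)) :
    ∫ x, (mulS f (Bop δ g) - mulS g (Bop δ f)) x = 0 := by
  rw [integral_schwartz_sub, sub_eq_zero]
  simpa only [mulS_apply] using integral_mul_Bop hδ f g

/-- `Aop` is symmetric, `Dop` is skew and they commute, so their product is skew. -/
theorem integral_Dop_mul_Aop {δ : ℝ} (hδ : 0 < δ) (f : 𝓢(ℝ, ℂ)) :
    ∫ x, mulS (Dop f) (Aop δ f) x = 0 := by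
  have h1 := integral_symm_Aop hδ (Dop f) f
  have h2 := integral_mul_Dop f (Aop δ f)
  rw [Dop_Aop hδ] at h2
  rw [integral_schwartz_sub] at h1
  rw [integral_schwartz_add] at h2
  linear_combination (h1 + h2) / 2

theorem integral_Dop_mul_Bop {δ : ℝ} (hδ : 0 < δ) (f g : 𝓢(ℝ, ℂ)) :
    ∫ x, (mulS (Dop f) (Bop δ g) + mulS (Dop g) (Bop δ f)) x = 0 := by
  have h1 := integral_symm_Bop hδ (Dop f) g
  have h2 := integral_mul_Dop g (Bop δ f)
  rw [Dop_Bop hδ] at h2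
  rw [integral_schwartz_sub] at h1
  rw [integral_schwartz_add] at h2 ⊢
  linear_combination h1 + h2

theorem Aop_Bop {δ : ℝ} (hδ : 0 < δ) (f : 𝓢(ℝ, ℂ)) : Aop δ (Bop δ f) = Bop δ (Aop δ f) :=
  ext_fourier fun ξ => by
    rw [fourier_Aop hδ, fourier_Bop hδ, fourier_Bop hδ, fourier_Aop hδ]; ring

theorem integral_Aop_mul_Bop {δ : ℝ} (hδ : 0 < δ) (f g : 𝓢(ℝ, ℂ)) :
    ∫ x, (mulS (Aop δ f) (Bop δ g) - mulS (Aop δ g) (Bop δ f)) x = 0 := by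
  have h1 := integral_symm_Bop hδ (Aop δ f) g
  have h2 := integral_symm_Aop hδ (Bop δ f) g
  rw [← Aop_Bop hδ] at h1
  have h3 : ∀ a b : 𝓢(ℝ, ℂ), mulS a b = mulS b a := fun a b => by
    ext x; simp only [mulS_apply]; ring
  rw [integral_schwartz_sub] at h1 h2 ⊢
  rw [h3 (Bop δ f)] at h2
  linear_combination h1 - h2

/-- N collects the terms with vanishing integral. The density is then a difference of Schwartz
functions, which also yields its integrability. -/
theorem integrable_and_integral_eq {d : ℝ → ℂ} {f N : 𝓢(ℝ, ℂ)} (h : ∀ x, f x = d x + N x)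
    (hN : ∫ x, N x = 0) : Integrable d ∧ ∫ x, f x = ∫ x, d x := by
  have e : d = f - N := funext fun x => by simp [h x]
  rw [e]
  refine ⟨(f - N).integrable, ?_⟩
  have := integral_schwartz_sub f N
  rw [hN, sub_zero] at this
  exact this.symm

theorem integral_sol_two {δ : ℝ} (hδ : 0 < δ) (ι : ℂ) (u v : 𝓢(ℝ, ℂ)) :
    ∫ x, ((sol δ ι u v 2).1 x + (sol δ ι u v 2).2 x) = 1 / 2 * ∫ x, (u x ^ 2 - v x ^ 2) := by
  rw [← integral_const_mul]
  refine (integrable_and_integral_eq (f := (sol δ ι u v 2).1 + (sol δ ι u v 2).2)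
    (N := (-1 : ℂ) • (linU δ ι (u, v) + linV δ ι (u, v))) (fun x => ?_) ?_).2
  · simp only [add_apply, smul_apply, smul_eq_mul, (sol_two δ ι u v x).1, (sol_two δ ι u v x).2]
    ring
  · rw [integral_schwartz_smul, integral_linU_add_linV hδ, mul_zero]

theorem integral_sol_three {δ : ℝ} (hδ : 0 < δ) (ι : ℂ) (u v : 𝓢(ℝ, ℂ)) :
    Integrable (density₃ δ u v) ∧
    ∫ x, ((sol δ ι u v 3).1 x + (sol δ ι u v 3).2 x) = ∫ x, density₃ δ u v x := by
  refine integrable_and_integral_eq (f := (sol δ ι u v 3).1 + (sol δ ι u v 3).2)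
    (N := (-1 : ℂ) • (linU δ ι (sol δ ι u v 2) + linV δ ι (sol δ ι u v 2))
      + ((-(ι / 2)) • mulS u (Dop u) + (ι / 2) • mulS v (Dop v))) (fun x => ?_) ?_
  · simp only [density₃, T_deriv hδ, Tt_deriv hδ, add_apply, smul_apply, smul_eq_mul, mulS_apply,
      (sol_three δ ι u v x).1, (sol_three δ ι u v x).2, linU.eq_1 δ ι (u, v), linV.eq_1 δ ι (u, v),
      sub_apply]
    ring
  · simp only [integral_schwartz_add _ (_ + _), integral_schwartz_add (_ • mulS _ _),
      integral_schwartz_smul, integral_linU_add_linV hδ, integral_mulS_Dop_self]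
    ring

theorem integral_sol_four {δ : ℝ} (hδ : 0 < δ) {ι : ℂ} (hι : ι * ι = -1) (u v : 𝓢(ℝ, ℂ)) :
    Integrable (density₄ δ u v) ∧
    ∫ x, ((sol δ ι u v 4).1 x + (sol δ ι u v 4).2 x) = ∫ x, density₄ δ u v x := by
  set w := (sol δ ι u v 2).1 with hw
  set z := (sol δ ι u v 2).2 with hz
  -- In order: the last linear term, total derivatives, symmetry of A and B moving them off w and z,
  -- and the remaining terms in u, v that are total derivatives or vanish because of skewness or
  -- commutation of A and B.
  refine integrable_and_integral_eq (f := (sol δ ι u v 4).1 + (sol δ ι u v 4).2)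
    (N := (-1 : ℂ) • (linU δ ι (sol δ ι u v 3) + linV δ ι (sol δ ι u v 3))
      + ((-(ι / 2)) • (mulS u (Dop w) + mulS (Dop u) w)
      + ((ι / 2) • (mulS v (Dop z) + mulS (Dop v) z)
      + ((1 / 2 : ℂ) • (mulS u (Aop δ w) - mulS w (Aop δ u))
      + ((1 / 2 : ℂ) • (mulS u (Bop δ z) - mulS z (Bop δ u))
      + ((1 / 2 : ℂ) • (mulS v (Aop δ z) - mulS z (Aop δ v))
      + ((1 / 2 : ℂ) • (mulS v (Bop δ w) - mulS w (Bop δ v))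
      + ((-(ι / 4)) • mulS (mulS u u) (Dop u)
      + ((-(ι / 4)) • mulS (mulS v v) (Dop v)
      + ((-(ι / 4)) • mulS (Dop u) (Aop δ u)
      + ((-(ι / 4)) • mulS (Dop v) (Aop δ v)
      + ((-(ι / 4)) • (mulS (Dop u) (Bop δ v) + mulS (Dop v) (Bop δ u))
      + ((3 / 4 : ℂ) • (mulS (Aop δ u) (Bop δ v) - mulS (Aop δ v) (Bop δ u)))))))))))))))
      (fun x => ?_) ?_
  · have e1 := (sol_two δ ι u v x).1
    have e2 := (sol_two δ ι u v x).2
    rw [← hw] at e1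
    rw [← hz] at e2
    have e3 : ∀ f : 𝓢(ℝ, ℂ), deriv f x = Dop f x := fun f => (Dop_apply f x).symm
    simp only [density₄, T_deriv hδ, Tt_deriv hδ, add_apply, smul_apply, smul_eq_mul, mulS_apply,
      (sol_four δ ι u v x).1, (sol_four δ ι u v x).2, linU.eq_1 δ ι (u, v), linV.eq_1 δ ι (u, v),
      linU.eq_1 δ ι (sol δ ι u v 2), linV.eq_1 δ ι (sol δ ι u v 2), sub_apply, ← hw, ← hz, e3] at e1 e2 ⊢
    rw [e1, e2]
    -- The relation ι² = -1 is needed only for the terms in uₓ² and vₓ².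
    linear_combination ((Dop v x ^ 2 - Dop u x ^ 2) / 8) * hι
  · have hs := integral_schwartz_smul
    rw [integral_schwartz_add, hs, integral_linU_add_linV hδ, integral_schwartz_add, hs,
      integral_mul_Dop, integral_schwartz_add, hs, integral_mul_Dop, integral_schwartz_add, hs,
      integral_symm_Aop hδ, integral_schwartz_add, hs, integral_symm_Bop hδ, integral_schwartz_add,
      hs, integral_symm_Aop hδ, integral_schwartz_add, hs, integral_symm_Bop hδ,
      integral_schwartz_add, hs, integral_sq_mul_Dop, integral_schwartz_add, hs,
      integral_sq_mul_Dop, integral_schwartz_add, hs, integral_Dop_mul_Aop hδ,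
      integral_schwartz_add, hs, integral_Dop_mul_Aop hδ, integral_schwartz_add, hs,
      integral_Dop_mul_Bop hδ, hs, integral_Aop_mul_Bop hδ]
    ring

end ExplicitIntegrals

/-! ### Linear independence by scaling -/

section Independence

open MeasureTheory Filter Topology

theorem linU_smul (δ : ℝ) (ι c : ℂ) (p : 𝓢(ℝ, ℂ) × 𝓢(ℝ, ℂ)) :
    linU δ ι (c • p) = c • linU δ ι p := by
  ext x
  simp only [linU, Prod.smul_fst, Prod.smul_snd, map_smul, sub_apply, add_apply, smul_apply,
    smul_eq_mul]
  ring

theorem linV_smul (δ : ℝ) (ι c : ℂ) (p : 𝓢(ℝ, ℂ) × 𝓢(ℝ, ℂ)) :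
    linV δ ι (c • p) = c • linV δ ι p := by
  ext x
  simp only [linV, Prod.smul_fst, Prod.smul_snd, map_smul, add_apply, smul_apply, smul_eq_mul]
  ring

/-- The coefficients of `-log (1 - X u)`. -/
def logCoeff (u : 𝓢(ℝ, ℂ)) : ℕ → 𝓢(ℝ, ℂ)
  | 0 => 0
  | 1 => u
  | n + 2 => ((n + 1 : ℂ) / (n + 2)) • mulS (logCoeff u (n + 1)) u

theorem logCoeff_succ_apply (u : 𝓢(ℝ, ℂ)) (n : ℕ) (x : ℝ) :
    logCoeff u (n + 1) x = u x ^ (n + 1) / (n + 1) := by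
  induction n with
  | zero => simp [logCoeff]
  | succ n ih =>
    rw [logCoeff, smul_apply, mulS_apply, ih, smul_eq_mul]
    have h1 : (n + 1 : ℂ) ≠ 0 := Nat.cast_add_one_ne_zero n
    have h2 : (n + 2 : ℂ) ≠ 0 := by exact_mod_cast (Nat.succ_ne_zero (n + 1))
    push_cast
    have h3 : (n + 1 + 1 : ℂ) ≠ 0 := by convert h2 using 1; ring
    field_simp
    ring

theorem tendsto_mulS {α : Type*} {l : Filter α} {a b : α → 𝓢(ℝ, ℂ)} {a₀ b₀ : 𝓢(ℝ, ℂ)}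
    (ha : Tendsto a l (𝓝 a₀)) (hb : Tendsto b l (𝓝 b₀)) :
    Tendsto (fun r => mulS (a r) (b r)) l (𝓝 (mulS a₀ b₀)) := by
  have h := (continuous_mulS.tendsto (a₀, b₀)).comp (ha.prodMk_nhds hb)
  simpa only [Function.comp_def] using h

/-- For large amplitudes the nonlocal terms are negligible. -/
theorem tendsto_scaled_sol (δ : ℝ) (ι : ℂ) (u : 𝓢(ℝ, ℂ)) (n : ℕ) :
    Tendsto (fun r : ℝ => ((r : ℂ)⁻¹) ^ n • sol δ ι ((r : ℂ) • u) 0 n) atTop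
      (𝓝 (logCoeff u n, 0)) := by
  induction n using Nat.strong_induction_on with
  | _ n ih =>
    have hinv : Tendsto (fun r : ℝ => (r : ℂ)⁻¹) atTop (𝓝 0) := by
      have := (Complex.continuous_ofReal.tendsto 0).comp tendsto_inv_atTop_zero
      simpa [Function.comp_def] using this
    -- The scaling leaves a spare factor r⁻¹ in front of the nonlocal term; only the source -u at m
    -- = 0 survives.
    have hU : ∀ m < n, Tendsto (fun r : ℝ => ((r : ℂ)⁻¹) ^ (m + 1) •
        expU δ ι ((r : ℂ) • u) m (sol δ ι ((r : ℂ) • u) 0 m)) atTop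
        (𝓝 (-(if m = 0 then u else 0))) := by
      intro m hm
      have h1 := (hinv.smul (((continuous_linU δ ι).tendsto _).comp (ih m hm))).sub
        (tendsto_const_nhds (x := if m = 0 then u else 0))
      rw [zero_smul, zero_sub] at h1
      refine h1.congr' ?_
      filter_upwards [eventually_gt_atTop 0] with r hr
      have hr' : (r : ℂ) ≠ 0 := by exact_mod_cast hr.ne'
      simp only [Function.comp_apply, linU_smul, expU, smul_sub, smul_smul]
      congr 1
      · rw [pow_succ']
      · split_ifs with h0
        · rw [h0, zero_add, pow_one, smul_smul, inv_mul_cancel₀ hr', one_smul]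
        · rw [smul_zero]
    have hV : ∀ m < n, Tendsto (fun r : ℝ => ((r : ℂ)⁻¹) ^ (m + 1) •
        expV δ ι 0 m (sol δ ι ((r : ℂ) • u) 0 m)) atTop (𝓝 0) := by
      intro m hm
      have h1 := (hinv.smul (((continuous_linV δ ι).tendsto _).comp (ih m hm))).neg
      rw [zero_smul, neg_zero] at h1
      refine h1.congr fun r => ?_
      simp only [Function.comp_apply, linV_smul, expV, ite_self, zero_sub, smul_neg, smul_smul]
      rw [pow_succ']
    have hsm : ∀ (c d : ℂ) (f g : 𝓢(ℝ, ℂ)), mulS (c • f) (d • g) = (c * d) • mulS f g := by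
      intro c d f g
      ext x
      simp only [mulS_apply, smul_apply, smul_eq_mul]
      ring
    cases n with
    | zero => simp [sol_zero, logCoeff, Prod.zero_eq_mk]
    | succ n =>
      have hpow : ∀ (r : ℝ) (k : ℕ), k ∈ Finset.range n → ((r : ℂ)⁻¹) ^ (k + 1) *
          ((r : ℂ)⁻¹) ^ (n - 1 - k + 1) = ((r : ℂ)⁻¹) ^ (n + 1) := fun r k hk => by
        rw [← pow_add]
        congr 1
        have := Finset.mem_range.1 hk
        omega
      refine Tendsto.prodMk_nhds ?_ ?_
      · have h1 := (hU n n.lt_succ_self).neg.sub ((tendsto_finsetSum (Finset.range n) fun k hk =>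
          (tendsto_mulS (ih (k + 1) (by have := Finset.mem_range.1 hk; omega)).fst_nhds
            (hU (n - 1 - k) (by have := Finset.mem_range.1 hk; omega))).const_smul
              ((k : ℂ) + 1)).const_smul (1 / (n + 1) : ℂ))
        convert h1 using 1
        · funext r
          rw [sol_succ_fst]
          simp only [Prod.smul_fst, hsm, smul_sub, smul_neg, Finset.smul_sum]
          congr 1
          refine Finset.sum_congr rfl fun k hk => ?_
          rw [hpow r k hk]
          simp only [smul_smul]
          congr 1
          ring
        · congr 1
          cases n with
          | zero => simp [logCoeff]
          | succ n =>
            -- In the limit the second factor is nonzero only at index 0, that is k = n, and this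
            -- term is the recursion of `logCoeff`.
            rw [Finset.sum_eq_single n]
            · ext x
              simp [logCoeff]
              ring
            · intro k hk hne
              have h0 : n + 1 - 1 - k ≠ 0 := by have := Finset.mem_range.1 hk; omega
              rw [if_neg h0]
              ext x
              simp
            · simp
      · have h1 := (hV n n.lt_succ_self).sub ((tendsto_finsetSum (Finset.range n) fun k hk =>
          (tendsto_mulS (ih (k + 1) (by have := Finset.mem_range.1 hk; omega)).snd_nhds
            (hV (n - 1 - k) (by have := Finset.mem_range.1 hk; omega))).const_smul
              ((k : ℂ) + 1)).const_smul (1 / (n + 1) : ℂ))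
        convert h1 using 1
        · funext r
          rw [sol_succ_snd]
          simp only [Prod.smul_snd, hsm, smul_sub, Finset.smul_sum]
          congr 1
          refine Finset.sum_congr rfl fun k hk => ?_
          rw [hpow r k hk]
          simp only [smul_smul]
          congr 1
          ring
        · congr 1
          ext x
          simp

/-- A nonnegative bump function works: all its powers have positive integral. -/
theorem exists_schwartz_integral_pow_ne_zero :
    ∃ u : 𝓢(ℝ, ℂ), ∀ n : ℕ, ∫ x, u x ^ (n + 1) ≠ 0 := by
  let b : ContDiffBump (0 : ℝ) := ⟨1, 2, one_pos, one_lt_two⟩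
  have hs : HasCompactSupport fun x => ((b x : ℝ) : ℂ) :=
    b.hasCompactSupport.comp_left (g := fun y : ℝ => (y : ℂ)) (by simp)
  have hd : ContDiff ℝ (⊤ : ℕ∞) fun x => ((b x : ℝ) : ℂ) :=
    Complex.ofRealCLM.contDiff.comp b.contDiff
  refine ⟨hs.toSchwartzMap hd, fun n => ?_⟩
  have e : ∀ x, (hs.toSchwartzMap hd) x ^ (n + 1) = ((b x ^ (n + 1) : ℝ) : ℂ) := fun x => by
    push_cast; rfl
  simp only [e]
  rw [integral_complex_ofReal]
  have hpos : 0 < ∫ x, b x ^ (n + 1) := by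
    refine Continuous.integral_pos_of_hasCompactSupport_nonneg_nonzero (x := 0)
      (b.continuous.pow _) (b.hasCompactSupport.comp_left (g := fun y : ℝ => y ^ (n + 1)) (by simp))
      (fun x => pow_nonneg b.nonneg _) ?_
    rw [b.one_of_mem_closedBall (Metric.mem_closedBall_self zero_le_one), one_pow]
    exact one_ne_zero
  exact_mod_cast hpos.ne'

/-- A linear relation is evaluated at (ru, 0) and divided by r^{N+1}, where N is the largest index
with nonzero coefficient. As r → ∞ only the term N remains, with the nonzero limit g_N ∫ u^{N+1} /
(N+1). -/
theorem linearIndependent_integral_sol (δ : ℝ) (ι : ℂ) :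
    LinearIndependent ℂ (fun (n : ℕ) (p : 𝓢(ℝ, ℂ) × 𝓢(ℝ, ℂ)) =>
      ∫ x, ((sol δ ι p.1 p.2 (n + 1)).1 x + (sol δ ι p.1 p.2 (n + 1)).2 x)) := by
  obtain ⟨u, hu⟩ := exists_schwartz_integral_pow_ne_zero
  set F : ℕ → 𝓢(ℝ, ℂ) × 𝓢(ℝ, ℂ) → ℂ := fun n p =>
    ∫ x, ((sol δ ι p.1 p.2 (n + 1)).1 x + (sol δ ι p.1 p.2 (n + 1)).2 x) with hF
  have hinv : Tendsto (fun r : ℝ => (r : ℂ)⁻¹) atTop (𝓝 0) := by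
    have := (Complex.continuous_ofReal.tendsto 0).comp tendsto_inv_atTop_zero
    simpa [Function.comp_def] using this
  have hlim : ∀ n, Tendsto (fun r : ℝ => ((r : ℂ)⁻¹) ^ (n + 1) * F n ((r : ℂ) • u, 0)) atTop
      (𝓝 (∫ x, logCoeff u (n + 1) x)) := by
    intro n
    have h1 := tendsto_scaled_sol δ ι u (n + 1)
    have h2 := (continuous_integral_schwartz.tendsto _).comp (h1.fst_nhds.add h1.snd_nhds)
    rw [add_zero] at h2
    refine h2.congr fun r => ?_
    simp only [Function.comp_apply, Prod.smul_fst, Prod.smul_snd]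
    rw [← smul_add, integral_schwartz_smul]
    rfl
  have hne : ∀ n, ∫ x, logCoeff u (n + 1) x ≠ 0 := by
    intro n
    simp only [logCoeff_succ_apply, integral_div]
    exact div_ne_zero (hu n) (Nat.cast_add_one_ne_zero n)
  rw [linearIndependent_iff']
  intro s g hsum
  by_contra! hcon
  obtain ⟨i, hi, hgi⟩ := hcon
  have hnon : (s.filter fun i => g i ≠ 0).Nonempty := ⟨i, Finset.mem_filter.2 ⟨hi, hgi⟩⟩
  obtain ⟨N, hN, hmax⟩ := Finset.exists_max_image _ id hnon
  obtain ⟨hNs, hgN⟩ := Finset.mem_filter.1 hN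
  have hterm : ∀ j ∈ s, Tendsto (fun r : ℝ => ((r : ℂ)⁻¹) ^ (N + 1) * (g j * F j ((r : ℂ) • u, 0)))
      atTop (𝓝 (if j = N then g N * ∫ x, logCoeff u (N + 1) x else 0)) := by
    intro j hj
    split_ifs with h
    · subst h
      exact ((hlim j).const_mul (g j)).congr fun r => by ring
    · by_cases h0 : g j = 0
      · simp only [h0, zero_mul, mul_zero]
        exact tendsto_const_nhds
      · have hlt : j < N := lt_of_le_of_ne (hmax j (Finset.mem_filter.2 ⟨hj, h0⟩)) h
        obtain ⟨k, rfl⟩ := Nat.exists_eq_add_of_lt hlt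
        have h1 := ((hinv.pow (k + 1)).mul (hlim j)).const_mul (g j)
        rw [zero_pow (Nat.succ_ne_zero k), zero_mul, mul_zero] at h1
        refine h1.congr fun r => ?_
        rw [show j + k + 1 + 1 = (k + 1) + (j + 1) by ring, pow_add]
        ring
  have hlim2 := tendsto_finsetSum s hterm
  rw [Finset.sum_ite_eq' s N, if_pos hNs] at hlim2
  have hzero : ∀ r : ℝ, ∑ j ∈ s, ((r : ℂ)⁻¹) ^ (N + 1) * (g j * F j ((r : ℂ) • u, 0)) = 0 := by
    intro r
    have := congrFun hsum ((r : ℂ) • u, 0)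
    rw [Finset.sum_apply] at this
    simp only [Pi.smul_apply, smul_eq_mul, Pi.zero_apply] at this
    rw [← Finset.mul_sum, this, mul_zero]
  simp only [hzero] at hlim2
  exact mul_ne_zero hgN (hne N) (tendsto_nhds_unique hlim2 tendsto_const_nhds)

end Independence

/-! ### Analytic extension of strip pairs and its decay -/

section StripExtension

open MeasureTheory Filter Topology Set
open scoped FourierTransform Real

theorem exists_decay (f : 𝓢(ℝ, ℂ)) : ∃ C : ℝ, 0 ≤ C ∧ ∀ x : ℝ, ‖f x‖ ≤ C * (1 + x ^ 2)⁻¹ := by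
  obtain ⟨C, hC⟩ := eventually_norm_le isOpen_univ (continuousOn_const (c := f)) (mem_univ (0 : ℝ))
  have h := hC.self_of_nhds
  refine ⟨C, ?_, h⟩
  have := (norm_nonneg _).trans (h 0)
  simpa using this

/-- The constant comes from b² ≤ 2a² + 2(a-b)² ≤ 2a² + 2. It makes the decay bound uniform on unit
balls. -/
theorem inv_one_add_sq_le {a b : ℝ} (h : |a - b| ≤ 1) : (1 + a ^ 2)⁻¹ ≤ 3 * (1 + b ^ 2)⁻¹ := by
  have h1 : (a - b) ^ 2 ≤ 1 := by rw [← sq_abs]; exact pow_le_one₀ (abs_nonneg _) h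
  rw [← div_eq_mul_inv, ← one_div, div_le_div_iff₀ (by positivity) (by positivity)]
  nlinarith [sq_nonneg (a + (a - b))]

theorem integrable_decay (C x : ℝ) : Integrable fun s : ℝ => C * (1 + (x + s) ^ 2)⁻¹ :=
  (integrable_inv_one_add_sq.comp_add_left x).const_mul C

theorem integral_Iic_Dop (f : 𝓢(ℝ, ℂ)) (x : ℝ) : ∫ s in Iic (0 : ℝ), Dop f (x + s) = f x := by
  have h := integral_Iic_of_hasDerivAt_of_tendsto' (a := (0 : ℝ)) (f := fun s => f (x + s))
    (f' := fun s => Dop f (x + s)) (m := 0)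
    (fun s _ => (hasDerivAt_schwartz f (x + s)).comp_const_add x s)
    ((Dop f).integrable.comp_add_left x).integrableOn
    ((f.tendsto_cocompact.mono_left atBot_le_cocompact).comp (tendsto_atBot_add_const_left _ x tendsto_id))
  simpa using h

theorem hasDerivAt_integral_Iic (f : 𝓢(ℝ, ℂ)) (x : ℝ) :
    HasDerivAt (fun y => ∫ s in Iic (0 : ℝ), f (y + s)) (f x) x := by
  obtain ⟨C, hC0, hC⟩ := exists_decay (Dop f)
  have h := (hasDerivAt_integral_of_dominated_loc_of_deriv_le (μ := volume.restrict (Iic (0 : ℝ)))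
    (F := fun y s => f (y + s)) (F' := fun y s => Dop f (y + s)) (x₀ := x)
    (bound := fun s => C * 3 * (1 + (x + s) ^ 2)⁻¹) (Metric.closedBall_mem_nhds x one_pos)
    (Eventually.of_forall fun y => by fun_prop) (f.integrable.comp_add_left x).integrableOn
    (by fun_prop) (Eventually.of_forall fun s y hy => ?_)
    (integrable_decay _ x).integrableOn
    (Eventually.of_forall fun s y _ => (hasDerivAt_schwartz f (y + s)).comp_add_const y s)).2
  · rwa [integral_Iic_Dop] at h
  · refine (hC _).trans ?_
    rw [mul_assoc]
    refine mul_le_mul_of_nonneg_left (inv_one_add_sq_le ?_) hC0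
    rw [add_sub_add_right_eq_sub]
    exact mem_closedBall_iff_norm.1 hy

/-- The function in the strip with boundary values `f` at the bottom. -/
def stripExt (f : 𝓢(ℝ, ℂ)) (z : ℂ) : ℂ := ∫ ξ : ℝ, Complex.exp (2 * π * Complex.I * z * ξ) * 𝓕 f ξ

variable {δ : ℝ} {f g : 𝓢(ℝ, ℂ)}

theorem stripExt_ofReal (f : 𝓢(ℝ, ℂ)) (x : ℝ) : stripExt f x = f x := (eq_integral_fourier f x).symm

theorem IsStripPair.stripExt_top (h : IsStripPair δ f g) (x : ℝ) :
    stripExt f (x + δ * Complex.I) = g x := by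
  rw [eq_integral_fourier g x, stripExt]
  refine integral_congr_ae (Eventually.of_forall fun ξ => ?_)
  simp only [h ξ]
  rw [← mul_assoc, Complex.ofReal_exp, ← Complex.exp_add]
  congr 2
  push_cast
  linear_combination (2 * π * δ * ξ) * Complex.I_sq

/-- The exponential has modulus e^{-2πξ Im z}, at most 1 for ξ ≥ 0 and at most e^{-2πδξ} for ξ ≤ 0.
The bound is independent of z in the closed strip. -/
theorem IsStripPair.norm_integrand_le (h : IsStripPair δ f g) {z : ℂ} (hz : z ∈ strip δ) (ξ : ℝ) :
    ‖Complex.exp (2 * π * Complex.I * z * ξ) * 𝓕 f ξ‖ ≤ ‖𝓕 f ξ‖ + ‖𝓕 g ξ‖ := by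
  have hre : (2 * π * Complex.I * z * ξ).re = -(2 * π * z.im * ξ) := by
    simp [Complex.mul_re, Complex.mul_im]
  rw [h ξ, norm_mul, norm_mul, Complex.norm_exp, hre, Complex.norm_real, Real.norm_eq_abs,
    Real.abs_exp, ← one_add_mul]
  refine mul_le_mul_of_nonneg_right ?_ (norm_nonneg _)
  rcases le_total 0 ξ with hξ | hξ
  · have h1 : Real.exp (-(2 * π * z.im * ξ)) ≤ 1 := Real.exp_le_one_iff.2 (by
      have := hz.1; have := Real.pi_pos; have : 0 ≤ 2 * π * z.im * ξ := by positivity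
      linarith)
    linarith [Real.exp_pos (-(2 * π * δ * ξ))]
  · have h1 : Real.exp (-(2 * π * z.im * ξ)) ≤ Real.exp (-(2 * π * δ * ξ)) := Real.exp_le_exp.2 (by
      have h2 := mul_le_mul_of_nonpos_right hz.2 hξ
      nlinarith [Real.pi_pos])
    linarith

theorem IsStripPair.continuousOn_stripExt (h : IsStripPair δ f g) :
    ContinuousOn (stripExt f) (strip δ) := by
  intro z hz
  refine continuousWithinAt_of_dominated (bound := fun ξ => ‖𝓕 f ξ‖ + ‖𝓕 g ξ‖)
    (Eventually.of_forall fun z => by fun_prop)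
    (eventually_nhdsWithin_of_forall fun w hw => Eventually.of_forall fun ξ =>
      h.norm_integrand_le hw ξ)
    ((𝓕 f).integrable.norm.add (𝓕 g).integrable.norm)
    (Eventually.of_forall fun ξ => Continuous.continuousWithinAt (by fun_prop))

theorem strip_mem_nhds {z : ℂ} (h0 : 0 < z.im) (h1 : z.im < δ) : strip δ ∈ 𝓝 z :=
  mem_of_superset ((isOpen_Ioo.preimage Complex.continuous_im).mem_nhds ⟨h0, h1⟩)
    fun _ hw => ⟨hw.1.le, hw.2.le⟩

theorem IsStripPair.hasDerivAt_stripExt (h : IsStripPair δ f g) {z : ℂ} (h0 : 0 < z.im)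
    (h1 : z.im < δ) : HasDerivAt (stripExt f) (stripExt (Dop f) z) z := by
  refine (hasDerivAt_integral_of_dominated_loc_of_deriv_le
    (F := fun z (ξ : ℝ) => Complex.exp (2 * π * Complex.I * z * ξ) * 𝓕 f ξ)
    (F' := fun z (ξ : ℝ) => Complex.exp (2 * π * Complex.I * z * ξ) * 𝓕 (Dop f) ξ)
    (bound := fun ξ => ‖𝓕 (Dop f) ξ‖ + ‖𝓕 (Dop g) ξ‖) (strip_mem_nhds h0 h1)
    (Eventually.of_forall fun z => by fun_prop) ?_ (by fun_prop)
    (Eventually.of_forall fun ξ w hw => h.map_Dop.norm_integrand_le hw ξ)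
    ((𝓕 (Dop f)).integrable.norm.add (𝓕 (Dop g)).integrable.norm)
    (Eventually.of_forall fun ξ w _ => ?_)).2
  · exact ((𝓕 f).integrable.norm.add (𝓕 g).integrable.norm).mono' (by fun_prop)
      (Eventually.of_forall fun ξ => h.norm_integrand_le ⟨h0.le, h1.le⟩ ξ)
  · have e : HasDerivAt (fun w : ℂ => 2 * π * Complex.I * w * ξ) (2 * π * Complex.I * ξ) w := by
      simpa using ((hasDerivAt_id w).const_mul (2 * π * Complex.I)).mul_const (ξ : ℂ)
    refine (e.cexp.mul_const (𝓕 f ξ)).congr_deriv ?_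
    rw [fourier_derivCLM]
    ring

theorem IsStripPair.diffContOnCl (hδ : 0 < δ) (h : IsStripPair δ f g) :
    DiffContOnCl ℂ (stripExt f) (Complex.im ⁻¹' Ioo 0 δ) := by
  refine ⟨fun z hz => (h.hasDerivAt_stripExt hz.1 hz.2).differentiableAt.differentiableWithinAt, ?_⟩
  rw [Complex.closure_preimage_im, closure_Ioo hδ.ne]
  exact h.continuousOn_stripExt

/-- Phragmén–Lindelöf applies to (z+i)² times the extension, which is bounded on both boundary lines
by Schwartz decay. In the strip |z+i|² ≥ 1 + (Re z)². -/
theorem IsStripPair.exists_decay_stripExt (hδ : 0 < δ) (h : IsStripPair δ f g) :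
    ∃ C : ℝ, 0 ≤ C ∧ ∀ z ∈ strip δ, ‖stripExt f z‖ ≤ C * (1 + z.re ^ 2)⁻¹ := by
  obtain ⟨A, hA0, hA⟩ := exists_decay f
  obtain ⟨B, hB0, hB⟩ := exists_decay g
  have hsq : ∀ z : ℂ, ‖(z + Complex.I) ^ 2‖ = z.re ^ 2 + (z.im + 1) ^ 2 := by
    intro z
    rw [norm_pow, ← Complex.normSq_eq_norm_sq, Complex.normSq_apply]
    simp
    ring
  have hC : ∀ z ∈ strip δ, ‖(z + Complex.I) ^ 2 * stripExt f z‖ ≤ max A (B * (1 + δ) ^ 2) := by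
    intro z hz
    have hd : Differentiable ℂ fun z : ℂ => (z + Complex.I) ^ 2 := by fun_prop
    refine PhragmenLindelof.horizontal_strip (a := 0) (b := δ) (z := z)
      (f := fun z => (z + Complex.I) ^ 2 • stripExt f z)
      (hd.diffContOnCl.smul (h.diffContOnCl hδ)) ?_ ?_ ?_ hz.1 hz.2
    · obtain ⟨D, hD⟩ : ∃ D : ℝ, ∀ z ∈ strip δ, ‖stripExt f z‖ ≤ D :=
        ⟨∫ ξ, (‖𝓕 f ξ‖ + ‖𝓕 g ξ‖), fun z hz => norm_integral_le_of_norm_le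
          ((𝓕 f).integrable.norm.add (𝓕 g).integrable.norm)
          (Eventually.of_forall fun ξ => h.norm_integrand_le hz ξ)⟩
      have hc : 0 < π / (2 * δ) := by have := Real.pi_pos; positivity
      -- Any exponent below π/δ is admissible; the extension is bounded, so only the quadratic
      -- factor must be dominated by the double exponential.
      refine ⟨π / (2 * δ), ?_, 1, ?_⟩
      · rw [sub_zero]
        exact div_lt_div_of_pos_left Real.pi_pos hδ (by linarith)
      refine Asymptotics.IsBigO.of_bound ((2 / (π / (2 * δ)) ^ 2 + (1 + δ) ^ 2) * D) ?_
      refine Eventually.filter_mono inf_le_right ?_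
      rw [eventually_principal]
      intro w hw
      have hws : w ∈ strip δ := ⟨hw.1.le, hw.2.le⟩
      have hD0 : 0 ≤ D := (norm_nonneg _).trans (hD w hws)
      rw [norm_smul, hsq, Real.norm_eq_abs, Real.abs_exp, one_mul]
      generalize π / (2 * δ) = c at hc
      have e1 := Real.quadratic_le_exp_of_nonneg (x := c * |w.re|) (by positivity)
      have e2 : Real.exp (c * |w.re|) ≤ Real.exp (Real.exp (c * |w.re|)) :=
        Real.exp_le_exp.2 (by linarith [Real.add_one_le_exp (c * |w.re|)])
      generalize Real.exp (Real.exp (c * |w.re|)) = Q at *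
      have e3 : 1 + (c * |w.re|) ^ 2 / 2 ≤ Q := by
        have : 0 ≤ c * |w.re| := by positivity
        linarith
      rw [mul_pow, sq_abs] at e3
      have h2 : 1 ≤ Q := by
        have : 0 ≤ c ^ 2 * w.re ^ 2 / 2 := by positivity
        linarith
      have e4 : w.re ^ 2 ≤ 2 / c ^ 2 * Q := by
        rw [div_mul_eq_mul_div, le_div_iff₀ (by positivity)]
        linarith
      have e5 : (w.im + 1) ^ 2 ≤ (1 + δ) ^ 2 * Q := by
        have h1 : (w.im + 1) ^ 2 ≤ (1 + δ) ^ 2 :=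
          pow_le_pow_left₀ (by linarith [hws.1]) (by linarith [hws.2]) 2
        nlinarith [sq_nonneg (1 + δ)]
      calc (w.re ^ 2 + (w.im + 1) ^ 2) * ‖stripExt f w‖
          ≤ (2 / c ^ 2 * Q + (1 + δ) ^ 2 * Q) * D :=
            mul_le_mul (add_le_add e4 e5) (hD w hws) (norm_nonneg _) (by positivity)
        _ = (2 / c ^ 2 + (1 + δ) ^ 2) * D * Q := by ring
    · intro w hw
      refine le_max_of_le_left ?_
      have e : w = (w.re : ℂ) := Complex.ext rfl (by simpa using hw)
      have h1 := hA w.re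
      rw [← div_eq_mul_inv, le_div_iff₀ (by positivity)] at h1
      rw [norm_smul, hsq, hw]
      conv_lhs => rw [e, stripExt_ofReal]
      simp only [Complex.ofReal_re]
      linarith
    · intro w hw
      refine le_max_of_le_right ?_
      have e : w = (w.re : ℂ) + δ * Complex.I := Complex.ext (by simp) (by simpa using hw)
      have h1 := hB w.re
      rw [← div_eq_mul_inv, le_div_iff₀ (by positivity)] at h1
      have h2 : stripExt f w = g w.re := by
        conv_lhs => rw [e]
        exact h.stripExt_top w.re
      rw [norm_smul, hsq, hw, h2]
      have h3 : w.re ^ 2 + (δ + 1) ^ 2 ≤ (1 + δ) ^ 2 * (1 + w.re ^ 2) := by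
        nlinarith [sq_nonneg w.re, mul_nonneg hδ.le (sq_nonneg w.re),
          mul_nonneg (sq_nonneg δ) (sq_nonneg w.re)]
      calc (w.re ^ 2 + (δ + 1) ^ 2) * ‖g w.re‖
          ≤ (1 + δ) ^ 2 * (1 + w.re ^ 2) * ‖g w.re‖ := mul_le_mul_of_nonneg_right h3 (norm_nonneg _)
        _ = (1 + δ) ^ 2 * (‖g w.re‖ * (1 + w.re ^ 2)) := by ring
        _ ≤ (1 + δ) ^ 2 * B := mul_le_mul_of_nonneg_left h1 (by positivity)
        _ = B * (1 + δ) ^ 2 := mul_comm _ _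
  refine ⟨max A (B * (1 + δ) ^ 2), le_max_of_le_left hA0, fun z hz => ?_⟩
  have h1 := hC z hz
  rw [norm_mul, hsq] at h1
  rw [← div_eq_mul_inv, le_div_iff₀ (by positivity)]
  refine le_trans ?_ h1
  rw [mul_comm]
  refine mul_le_mul_of_nonneg_right ?_ (norm_nonneg _)
  nlinarith [hz.1]

end StripExtension

/-! ### Primitives in the strip and formal eigenfunctions -/

section StripPrimitive

open MeasureTheory Filter Topology Set PowerSeries
open scoped FourierTransform Real

/-- The primitive, vanishing as `Re z → -∞`, of the function in the strip with boundary values `f`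
at the bottom. -/
def stripPrim (f : 𝓢(ℝ, ℂ)) (z : ℂ) : ℂ := ∫ s in Iic (0 : ℝ), stripExt f (z + s)

variable {δ : ℝ} {f g : 𝓢(ℝ, ℂ)}

theorem stripPrim_ofReal (f : 𝓢(ℝ, ℂ)) (x : ℝ) :
    stripPrim f x = ∫ s in Iic (0 : ℝ), f (x + s) := by
  simp only [stripPrim, ← Complex.ofReal_add, stripExt_ofReal]

theorem IsStripPair.stripPrim_top (h : IsStripPair δ f g) (x : ℝ) :
    stripPrim f (x + δ * Complex.I) = ∫ s in Iic (0 : ℝ), g (x + s) := by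
  simp only [stripPrim, ← h.stripExt_top]
  congr 1
  funext s
  congr 1
  push_cast
  ring

theorem hasDerivAt_stripPrim_bot (f : 𝓢(ℝ, ℂ)) (x : ℝ) :
    HasDerivAt (fun y : ℝ => stripPrim f y) (f x) x := by
  simp only [stripPrim_ofReal]
  exact hasDerivAt_integral_Iic f x

theorem IsStripPair.hasDerivAt_stripPrim_top (h : IsStripPair δ f g) (x : ℝ) :
    HasDerivAt (fun y : ℝ => stripPrim f (y + δ * Complex.I)) (g x) x := by
  simp only [h.stripPrim_top]
  exact hasDerivAt_integral_Iic g x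

theorem add_ofReal_mem_strip {z : ℂ} (hz : z ∈ strip δ) (s : ℝ) : z + s ∈ strip δ := by
  simpa [strip] using hz

theorem IsStripPair.aestronglyMeasurable_shift (h : IsStripPair δ f g) {z : ℂ} (hz : z ∈ strip δ)
    (μ : Measure ℝ) : AEStronglyMeasurable (fun s : ℝ => stripExt f (z + s)) μ := by
  refine Continuous.aestronglyMeasurable ?_
  exact h.continuousOn_stripExt.comp_continuous (by fun_prop) (add_ofReal_mem_strip hz)

theorem norm_shift_le {C : ℝ} (hC0 : 0 ≤ C) {φ : ℂ → ℂ}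
    (hC : ∀ z ∈ strip δ, ‖φ z‖ ≤ C * (1 + z.re ^ 2)⁻¹) {z w : ℂ} (hw : w ∈ strip δ)
    (hd : ‖w - z‖ ≤ 1) (s : ℝ) : ‖φ (w + s)‖ ≤ C * 3 * (1 + (z.re + s) ^ 2)⁻¹ := by
  refine (hC _ (add_ofReal_mem_strip hw s)).trans ?_
  rw [mul_assoc]
  refine mul_le_mul_of_nonneg_left (inv_one_add_sq_le ?_) hC0
  have h1 := (Complex.abs_re_le_norm (w - z)).trans hd
  simpa using h1

/-- The quadratic decay gives majorants for continuity and differentiation under the integral. It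
also gives the bound C (arctan(Re z) + π/2), hence boundedness and the limit 0 at -∞. -/
theorem isStripFunction_stripPrim (hδ : 0 < δ) (h : IsStripPair δ f g) :
    IsStripFunction δ (stripPrim f) 0 := by
  obtain ⟨C, hC0, hC⟩ := h.exists_decay_stripExt hδ
  obtain ⟨C', hC0', hC'⟩ := h.map_Dop.exists_decay_stripExt hδ
  have hball : ∀ z : ℂ, ∀ᶠ w in 𝓝 z, ‖w - z‖ ≤ 1 := fun z => by
    filter_upwards [Metric.closedBall_mem_nhds z one_pos] with w hw
    exact mem_closedBall_iff_norm.1 hw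
  have hbd : ∀ z ∈ strip δ, ‖stripPrim f z‖ ≤ C * (Real.arctan z.re + π / 2) := by
    intro z hz
    have e : ∫ s in Iic (0 : ℝ), C * (1 + (z.re + s) ^ 2)⁻¹ = C * (Real.arctan z.re + π / 2) := by
      rw [integral_const_mul]
      congr 1
      have h1 := integral_Iic_of_hasDerivAt_of_tendsto' (a := (0 : ℝ))
        (f := fun s => Real.arctan (z.re + s)) (f' := fun s => (1 + (z.re + s) ^ 2)⁻¹)
        (m := -(π / 2)) (fun s _ => (Real.hasDerivAt_arctan' (z.re + s)).comp_const_add z.re s)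
        (integrable_inv_one_add_sq.comp_add_left z.re).integrableOn
        ((Real.tendsto_arctan_atBot.mono_right nhdsWithin_le_nhds).comp
          (tendsto_atBot_add_const_left _ z.re tendsto_id))
      rw [h1, add_zero, sub_neg_eq_add]
    rw [← e]
    refine norm_integral_le_of_norm_le (integrable_decay C z.re).integrableOn
      (Eventually.of_forall fun s => ?_)
    simpa using hC _ (add_ofReal_mem_strip hz s)
  refine ⟨?_, ?_, ⟨C * π, fun z hz => ?_⟩, ?_, ?_, ?_⟩
  · intro z hz
    refine continuousWithinAt_of_dominated (bound := fun s => C * 3 * (1 + (z.re + s) ^ 2)⁻¹)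
      (eventually_nhdsWithin_of_forall fun w hw => h.aestronglyMeasurable_shift hw _) ?_
      (integrable_decay _ z.re).integrableOn (Eventually.of_forall fun s => ?_)
    · filter_upwards [self_mem_nhdsWithin, (hball z).filter_mono nhdsWithin_le_nhds] with w hw hd
      exact Eventually.of_forall fun s => norm_shift_le hC0 hC hw hd s
    · exact ContinuousWithinAt.comp (f := fun w : ℂ => w + (s : ℂ)) (s := strip δ)
        (h.continuousOn_stripExt (z + s) (add_ofReal_mem_strip hz s))
        (Continuous.continuousWithinAt (by fun_prop)) fun w hw => add_ofReal_mem_strip hw s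
  · intro z hz
    refine DifferentiableAt.differentiableWithinAt ?_
    have hzs : z ∈ strip δ := ⟨hz.1.le, hz.2.le⟩
    have hU : {w : ℂ | (0 < w.im ∧ w.im < δ) ∧ ‖w - z‖ ≤ 1} ∈ 𝓝 z :=
      Filter.inter_mem ((isOpen_Ioo.preimage Complex.continuous_im).mem_nhds hz) (hball z)
    refine (hasDerivAt_integral_of_dominated_loc_of_deriv_le (μ := volume.restrict (Iic (0 : ℝ)))
      (F := fun w (s : ℝ) => stripExt f (w + s)) (F' := fun w (s : ℝ) => stripExt (Dop f) (w + s))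
      (bound := fun s => C' * 3 * (1 + (z.re + s) ^ 2)⁻¹) hU ?_ ?_
      (h.map_Dop.aestronglyMeasurable_shift hzs _)
      (Eventually.of_forall fun s w hw => norm_shift_le hC0' hC' ⟨hw.1.1.le, hw.1.2.le⟩ hw.2 s)
      (integrable_decay _ z.re).integrableOn
      (Eventually.of_forall fun s w hw => ?_)).2.differentiableAt
    · filter_upwards [hU] with w hw
      exact h.aestronglyMeasurable_shift ⟨hw.1.1.le, hw.1.2.le⟩ _
    · exact (integrable_decay C z.re).integrableOn.mono' (h.aestronglyMeasurable_shift hzs _)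
        (Eventually.of_forall fun s => by simpa using hC _ (add_ofReal_mem_strip hzs s))
    · refine HasDerivAt.comp_add_const w (s : ℂ) (h.hasDerivAt_stripExt ?_ ?_)
      · simpa using hw.1.1
      · simpa using hw.1.2
  · refine (hbd z hz).trans (mul_le_mul_of_nonneg_left ?_ hC0)
    linarith [Real.arctan_lt_pi_div_two z.re]
  · exact fun x => (hasDerivAt_stripPrim_bot f x).differentiableAt
  · exact fun x => (h.hasDerivAt_stripPrim_top x).differentiableAt
  · refine squeeze_zero_norm' (a := fun z : ℂ => C * (Real.arctan z.re + π / 2)) ?_ ?_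
    · exact Eventually.filter_mono inf_le_right (eventually_principal.2 hbd)
    · have h1 : Tendsto (fun z : ℂ => Real.arctan z.re) (comap Complex.re atBot) (𝓝 (-(π / 2))) :=
        (Real.tendsto_arctan_atBot.mono_right nhdsWithin_le_nhds).comp tendsto_comap
      have h2 := (h1.add_const (π / 2)).const_mul C
      rw [neg_add_cancel, mul_zero] at h2
      exact h2.mono_left inf_le_left

namespace IsStripFunction

variable {F G : ℂ → ℂ} {a b : ℂ}

theorem const (δ : ℝ) (c : ℂ) : IsStripFunction δ (fun _ => c) c :=
  ⟨continuousOn_const, differentiableOn_const c, ⟨‖c‖, fun _ _ => le_rfl⟩,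
    differentiable_const c, differentiable_const c, tendsto_const_nhds⟩

theorem add (hF : IsStripFunction δ F a) (hG : IsStripFunction δ G b) :
    IsStripFunction δ (fun z => F z + G z) (a + b) := by
  obtain ⟨A, hA⟩ := hF.bounded
  obtain ⟨B, hB⟩ := hG.bounded
  exact ⟨hF.continuousOn.fun_add hG.continuousOn, hF.differentiableOn.fun_add hG.differentiableOn,
    ⟨A + B, fun z hz => (norm_add_le _ _).trans (add_le_add (hA z hz) (hB z hz))⟩,
    hF.bottom_differentiable.fun_add hG.bottom_differentiable,
    hF.top_differentiable.fun_add hG.top_differentiable, hF.tendsto.add hG.tendsto⟩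

theorem mul (hF : IsStripFunction δ F a) (hG : IsStripFunction δ G b) :
    IsStripFunction δ (fun z => F z * G z) (a * b) := by
  obtain ⟨A, hA⟩ := hF.bounded
  obtain ⟨B, hB⟩ := hG.bounded
  exact ⟨hF.continuousOn.fun_mul hG.continuousOn, hF.differentiableOn.fun_mul hG.differentiableOn,
    ⟨A * B, fun z hz => (norm_mul_le _ _).trans (mul_le_mul (hA z hz) (hB z hz) (norm_nonneg _)
      ((norm_nonneg _).trans (hA z hz)))⟩,
    hF.bottom_differentiable.fun_mul hG.bottom_differentiable,
    hF.top_differentiable.fun_mul hG.top_differentiable, hF.tendsto.mul hG.tendsto⟩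

theorem const_mul (c : ℂ) (hF : IsStripFunction δ F a) :
    IsStripFunction δ (fun z => c * F z) (c * a) := (const δ c).mul hF

theorem sub (hF : IsStripFunction δ F a) (hG : IsStripFunction δ G b) :
    IsStripFunction δ (fun z => F z - G z) (a - b) := by
  have h := hF.add (hG.const_mul (-1))
  simpa only [neg_one_mul, ← sub_eq_add_neg] using h

end IsStripFunction

/-- The algebra of strip functions that tend to zero as `Re z → -∞`. -/
def stripAlgebra (δ : ℝ) : NonUnitalSubalgebra ℂ (ℂ → ℂ) where
  carrier := {F | IsStripFunction δ F 0}
  add_mem' hF hG := by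
    have h := IsStripFunction.add hF hG
    rwa [add_zero] at h
  zero_mem' := IsStripFunction.const δ 0
  mul_mem' hF hG := by
    have h := IsStripFunction.mul hF hG
    rwa [mul_zero] at h
  smul_mem' c F hF := by
    have h := IsStripFunction.const_mul c hF
    rwa [mul_zero] at h

theorem isStripFunction_coeff_fexp {b : ℕ → ℂ → ℂ} (h0 : b 0 = 0)
    (hb : ∀ n, IsStripFunction δ (b n) 0) (n : ℕ) :
    IsStripFunction δ (fun z => coeff n (fexp (ser fun m => b m z))) (if n = 0 then 1 else 0) := by
  cases n with
  | zero =>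
    have h : ∀ z, coeff 0 (fexp (ser fun m => b m z)) = 1 := fun z => by
      rw [coeff_zero_eq_constantCoeff, constantCoeff_fexp]
      rw [constantCoeff_ser, h0]; rfl
    simp only [h, if_true]
    exact IsStripFunction.const δ 1
  | succ n => exact coeff_fexp_mem (stripAlgebra δ) b h0 hb n

/-- M_j is the exponential of b_j, the primitive of the lift. The jumps of b₂ and b₁ are the two
components of `sol`, so the log ratios are these components and the Lax equations are the relations
of `IsSol` multiplied by an exponential. -/
theorem exists_isFormalEigenfunction (hδ : 0 < δ) (u v : 𝓢(ℝ, ℂ)) :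
    ∃ M₁ M₂ : ℕ → ℂ → ℂ, IsFormalEigenfunction δ u v M₁ M₂ ∧
      IsLaxExpansion δ M₁ M₂ (fun n x => (sol δ Complex.I u v n).1 x)
        (fun n x => (sol δ Complex.I u v n).2 x) ∧
      ∀ z, M₁ 0 z = 1 ∧ M₂ 0 z = 1 := by
  set s := sol δ Complex.I u v with hs
  have hsol : IsSol δ Complex.I u v s := isSol_sol δ Complex.I u v
  have p2 : ∀ n, IsStripPair δ (liftBot δ (s n).2 (s n).1) (liftTop δ (s n).1 (s n).2) :=
    fun n => isStripPair_lift hδ _ _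
  have p1 : ∀ n, IsStripPair δ (liftBot δ (s n).1 (s n).2) (liftTop δ (s n).2 (s n).1) :=
    fun n => isStripPair_lift hδ _ _
  set b₁ : ℕ → ℂ → ℂ := fun n => stripPrim (liftBot δ (s n).1 (s n).2) with hb₁
  set b₂ : ℕ → ℂ → ℂ := fun n => stripPrim (liftBot δ (s n).2 (s n).1) with hb₂
  have hprim0 : stripPrim 0 = 0 := by
    funext z
    simp [stripPrim, stripExt, FourierTransform.fourier_zero]
  have hlift0 : liftBot δ 0 0 = 0 := by simp [liftBot]
  have h10 : b₁ 0 = 0 := by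
    simp only [hb₁, hsol.zero, Prod.fst_zero, Prod.snd_zero, hlift0, hprim0]
  have h20 : b₂ 0 = 0 := by
    simp only [hb₂, hsol.zero, Prod.fst_zero, Prod.snd_zero, hlift0, hprim0]
  have hj2 : ∀ x : ℝ, (ser fun n => b₂ n (x + δ * Complex.I)) =
      (ser fun n => (s n).1 x) + ser fun n => b₁ n x := by
    intro x
    rw [← ser_add]
    congr 1
    funext n
    rw [hb₂, hb₁]
    simp only
    rw [(p2 n).stripPrim_top, stripPrim_ofReal, ← sub_eq_iff_eq_add, ← integral_sub,
      ← integral_Iic_Dop (s n).1 x, ← liftTop_sub_liftBot δ (s n).1 (s n).2]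
    · rfl
    · exact ((SchwartzMap.integrable _).comp_add_left x).integrableOn
    · exact ((SchwartzMap.integrable _).comp_add_left x).integrableOn
  have hj1 : ∀ x : ℝ, (ser fun n => b₁ n (x + δ * Complex.I)) =
      (ser fun n => (s n).2 x) + ser fun n => b₂ n x := by
    intro x
    rw [← ser_add]
    congr 1
    funext n
    rw [hb₂, hb₁]
    simp only
    rw [(p1 n).stripPrim_top, stripPrim_ofReal, ← sub_eq_iff_eq_add, ← integral_sub,
      ← integral_Iic_Dop (s n).2 x, ← liftTop_sub_liftBot δ (s n).2 (s n).1]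
    · rfl
    · exact ((SchwartzMap.integrable _).comp_add_left x).integrableOn
    · exact ((SchwartzMap.integrable _).comp_add_left x).integrableOn
  have hc1 : ∀ z, constantCoeff (ser fun n => b₁ n z) = 0 := fun z => by
    rw [constantCoeff_ser, h10]; rfl
  have hc2 : ∀ z, constantCoeff (ser fun n => b₂ n z) = 0 := fun z => by
    rw [constantCoeff_ser, h20]; rfl
  have hcs1 : ∀ x, constantCoeff (ser fun n => (s n).1 x) = 0 := fun z => by
    rw [constantCoeff_ser, hsol.zero]; rfl
  have hcs2 : ∀ x, constantCoeff (ser fun n => (s n).2 x) = 0 := fun z => by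
    rw [constantCoeff_ser, hsol.zero]; rfl
  have ht2 : ∀ x : ℝ, fexp (ser fun n => b₂ n (x + δ * Complex.I)) =
      fexp (ser fun n => (s n).1 x) * fexp (ser fun n => b₁ n x) := fun x => by
    rw [hj2, fexp_add (hcs1 x) (hc1 x)]
  have ht1 : ∀ x : ℝ, fexp (ser fun n => b₁ n (x + δ * Complex.I)) =
      fexp (ser fun n => (s n).2 x) * fexp (ser fun n => b₂ n x) := fun x => by
    rw [hj1, fexp_add (hcs2 x) (hc2 x)]
  refine ⟨fun n z => coeff n (fexp (ser fun m => b₁ m z)),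
    fun n z => coeff n (fexp (ser fun m => b₂ m z)), ⟨?_, ?_, ?_, ?_⟩, 
      fun x => ⟨⟨hcs1 x, ?_⟩, hcs2 x, ?_⟩, fun z => ?_⟩
  · exact isStripFunction_coeff_fexp h10 fun n => isStripFunction_stripPrim hδ (p1 n)
  · exact isStripFunction_coeff_fexp h20 fun n => isStripFunction_stripPrim hδ (p2 n)
  · intro x
    have hd : (ser fun n => deriv (fun y : ℝ => coeff n (fexp (ser fun m =>
        b₂ m (y + δ * Complex.I)))) x) = fexp (ser fun m => b₂ m (x + δ * Complex.I)) *
          ser fun n => liftTop δ (s n).1 (s n).2 x := by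
      have h := HasSerDeriv.fexp (f := fun n (y : ℝ) => b₂ n (y + δ * Complex.I))
        (by funext y; rw [h20]; rfl) fun n => (p2 n).hasDerivAt_stripPrim_top x
      ext n
      rw [coeff_ser]
      exact (h n).deriv
    have h1 := (relation_u δ u v s hsol x).1
    have h2 := fexp_mul_fexp_neg (hcs1 x)
    rw [hd, ser_coeff, ser_coeff, ht2]
    linear_combination (fexp (ser fun n => b₁ n x)) * h2
      - fexp (ser fun n => (s n).1 x) * fexp (ser fun n => b₁ n x) * h1
  · intro x
    have hd : (ser fun n => deriv (fun y : ℝ => coeff n (fexp (ser fun m =>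
        b₂ m y))) x) = fexp (ser fun m => b₂ m x) *
          ser fun n => liftBot δ (s n).2 (s n).1 x := by
      have h := HasSerDeriv.fexp (f := fun n (y : ℝ) => b₂ n y)
        (by funext y; rw [h20]; rfl) fun n => hasDerivAt_stripPrim_bot (liftBot δ (s n).2 (s n).1) x
      ext n
      rw [coeff_ser]
      exact (h n).deriv
    have h1 := (relation_v δ u v s hsol x).1
    rw [hd, ser_coeff, ser_coeff, ht1]
    linear_combination -(fexp (ser fun n => b₂ n x)) * h1
  · rw [ser_coeff, ser_coeff, ht2]
  · rw [ser_coeff, ser_coeff, ht1]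
  · simp only [coeff_zero_eq_constantCoeff]
    exact ⟨constantCoeff_fexp (hc1 z), constantCoeff_fexp (hc2 z)⟩

end StripPrimitive

/-! ### Liouville's theorem on the cylinder -/

section Liouville

open MeasureTheory Filter Topology Set
open scoped Real

variable {δ : ℝ} {p : ℂ → ℂ}

/-- The integrand of a Fourier coefficient of `p` along vertical segments. -/
def expWeight (δ : ℝ) (p : ℂ → ℂ) (k : ℤ) (z : ℂ) : ℂ := Complex.exp (-(2 * π * k / δ) * z) * p z

theorem expWeight_periodic (hδ : 0 < δ) (hp : ∀ x : ℝ, p (x + δ * Complex.I) = p x) (k : ℤ)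
    (x : ℝ) : expWeight δ p k (x + δ * Complex.I) = expWeight δ p k x := by
  have hδ' : (δ : ℂ) ≠ 0 := by exact_mod_cast hδ.ne'
  rw [expWeight, expWeight, hp]
  congr 1
  rw [show (-(2 * π * k / δ) * (x + δ * Complex.I) : ℂ)
    = -(2 * π * k / δ) * x + (-k : ℤ) * (2 * π * Complex.I) by push_cast; field_simp; ring]
  rw [Complex.exp_add, Complex.exp_int_mul_two_pi_mul_I, mul_one]

theorem norm_expWeight (p : ℂ → ℂ) (k : ℤ) (z : ℂ) :
    ‖expWeight δ p k z‖ = Real.exp (-(2 * π * k / δ) * z.re) * ‖p z‖ := by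
  rw [expWeight, norm_mul, Complex.norm_exp]
  congr 2
  have : (-(2 * π * k / δ) : ℂ) = ((-(2 * π * k / δ) : ℝ) : ℂ) := by push_cast; rfl
  rw [this, Complex.re_ofReal_mul]

/-- Cauchy's theorem on a rectangle: the weight has period iδ, so the horizontal sides cancel. -/
theorem IsStripFunction.integral_expWeight_eq (hδ : 0 < δ) {c : ℂ} (h : IsStripFunction δ p c)
    (hp : ∀ x : ℝ, p (x + δ * Complex.I) = p x) (k : ℤ) (a b : ℝ) :
    ∫ y in (0 : ℝ)..δ, expWeight δ p k (a + y * Complex.I)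
      = ∫ y in (0 : ℝ)..δ, expWeight δ p k (b + y * Complex.I) := by
  have hr := Complex.integral_boundary_rect_eq_zero_of_continuousOn_of_differentiableOn
    (expWeight δ p k) (b : ℂ) (a + δ * Complex.I) ?_ ?_
  · simp only [Complex.ofReal_re, Complex.ofReal_im, Complex.add_re, Complex.mul_re, Complex.I_re,
      Complex.I_im, Complex.add_im, Complex.mul_im, mul_zero, mul_one, zero_mul, add_zero,
      zero_add, Complex.ofReal_zero, expWeight_periodic hδ hp, sub_self] at hr
    rw [← smul_sub, smul_eq_mul] at hr
    exact sub_eq_zero.1 ((mul_eq_zero.1 hr).resolve_left Complex.I_ne_zero)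
  · refine (Continuous.continuousOn (by fun_prop)).mul (h.continuousOn.mono fun z hz => ?_)
    have := hz.2
    simpa [uIcc_of_le hδ.le, strip] using this
  · refine (Differentiable.differentiableOn (by fun_prop)).mul (h.differentiableOn.mono fun z hz => ?_)
    have := hz.2
    simpa [hδ.le] using this

/-- The segment may be moved freely. For k ≤ 0 it goes to -∞, where p tends to 0 and the weight is
at most 1; for k > 0 it goes to +∞, where the weight decays and boundedness of p suffices. -/
theorem IsStripFunction.integral_expWeight_eq_zero (hδ : 0 < δ) (h : IsStripFunction δ p 0)
    (hp : ∀ x : ℝ, p (x + δ * Complex.I) = p x) (k : ℤ) (a : ℝ) :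
    ∫ y in (0 : ℝ)..δ, expWeight δ p k (a + y * Complex.I) = 0 := by
  obtain ⟨B, hB⟩ := h.bounded
  have hmem : ∀ (x y : ℝ), y ∈ uIoc (0 : ℝ) δ → (x + y * Complex.I : ℂ) ∈ strip δ := by
    intro x y hy
    rw [uIoc_of_le hδ.le] at hy
    simpa [strip] using And.intro hy.1.le hy.2
  have hle : ∀ (x D : ℝ), (∀ z ∈ strip δ, z.re = x → ‖p z‖ ≤ D) →
      ‖∫ y in (0 : ℝ)..δ, expWeight δ p k (x + y * Complex.I)‖
        ≤ Real.exp (-(2 * π * k / δ) * x) * D * δ := by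
    intro x D hD
    have h1 := intervalIntegral.norm_integral_le_of_norm_le_const (a := 0) (b := δ)
      (C := Real.exp (-(2 * π * k / δ) * x) * D)
      (f := fun y : ℝ => expWeight δ p k (x + y * Complex.I)) fun y hy => by
        rw [norm_expWeight]
        have hre : (x + y * Complex.I : ℂ).re = x := by simp
        rw [hre]
        exact mul_le_mul_of_nonneg_left (hD _ (hmem x y hy) hre) (Real.exp_pos _).le
    rwa [sub_zero, abs_of_pos hδ] at h1
  have hpi := Real.pi_pos
  rcases le_or_gt k 0 with hk | hk
  · rw [← norm_le_zero_iff]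
    refine le_of_forall_pos_le_add fun ε hε => ?_
    rw [zero_add]
    have h1 := h.tendsto.eventually (Metric.closedBall_mem_nhds 0 (div_pos hε hδ))
    rw [eventually_inf_principal, eventually_comap] at h1
    obtain ⟨R, hR⟩ := eventually_atBot.1 h1
    set x := min R 0
    rw [h.integral_expWeight_eq hδ hp k a x]
    refine (hle x (ε / δ) fun z hz hre => ?_).trans ?_
    · simpa using hR x (min_le_left _ _) z hre hz
    · have e : Real.exp (-(2 * π * k / δ) * x) ≤ 1 := by
        refine Real.exp_le_one_iff.2 (mul_nonpos_of_nonneg_of_nonpos ?_ (min_le_right _ _))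
        have : (k : ℝ) ≤ 0 := by exact_mod_cast hk
        rw [neg_nonneg]
        exact div_nonpos_of_nonpos_of_nonneg (mul_nonpos_of_nonneg_of_nonpos (by positivity) this) hδ.le
      calc _ ≤ 1 * (ε / δ) * δ := by gcongr
        _ = ε := by field_simp
  · have hc : 0 < 2 * π * k / δ := by
      have : (0 : ℝ) < k := by exact_mod_cast hk
      positivity
    have hlim : Tendsto (fun x : ℝ => Real.exp (-(2 * π * k / δ) * x) * B * δ) atTop (𝓝 0) := by
      have h1 : Tendsto (fun x : ℝ => -(2 * π * k / δ) * x) atTop atBot :=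
        tendsto_id.const_mul_atTop_of_neg (neg_lt_zero.2 hc)
      simpa using ((Real.tendsto_exp_atBot.comp h1).mul_const B).mul_const δ
    have h2 := squeeze_zero_norm (f := fun _ : ℝ =>
      ∫ y in (0 : ℝ)..δ, expWeight δ p k (a + y * Complex.I)) (fun x => by
        rw [h.integral_expWeight_eq hδ hp k a x]
        exact hle x B fun z hz _ => hB z hz) hlim
    exact tendsto_nhds_unique tendsto_const_nhds h2

/-- A bounded function, analytic on a cylinder and tending to zero at one end, vanishes. -/
theorem IsStripFunction.eq_zero_of_periodic (hδ : 0 < δ) (h : IsStripFunction δ p 0)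
    (hp : ∀ x : ℝ, p (x + δ * Complex.I) = p x) (x : ℝ) : p x = 0 := by
  have : Fact (0 < δ) := ⟨hδ⟩
  set f : ℝ → ℂ := fun y => p (x + y * Complex.I) with hf
  have hδ' : (δ : ℂ) ≠ 0 := by exact_mod_cast hδ.ne'
  have hfc : ContinuousOn f (Icc 0 δ) := by
    refine h.continuousOn.comp (Continuous.continuousOn (by fun_prop)) fun y hy => ?_
    simpa [strip] using hy
  have hf0 : f 0 = f δ := by simp [hf, hp]
  set F : C(AddCircle δ, ℂ) := ⟨AddCircle.liftIco δ 0 f, AddCircle.liftIco_zero_continuous hf0 hfc⟩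
    with hF
  have hcoef : ∀ k : ℤ, fourierCoeff F k = 0 := by
    intro k
    have e : fourierCoeff F k = fourierCoeff (AddCircle.liftIco δ 0 f) k := rfl
    rw [e, fourierCoeff_liftIco_eq, fourierCoeffOn_eq_integral]
    have e2 : ∀ y : ℝ, fourier (-k) (y : AddCircle (0 + δ - 0)) • f y
        = Complex.exp (2 * π * k / δ * x) * expWeight δ p k (x + y * Complex.I) := by
      intro y
      rw [fourier_coe_apply, expWeight, ← mul_assoc, ← Complex.exp_add, smul_eq_mul]
      congr 2
      push_cast
      rw [zero_add, sub_zero]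
      field_simp
      ring
    simp only [e2, zero_add]
    rw [intervalIntegral.integral_const_mul, h.integral_expWeight_eq_zero hδ hp, mul_zero, smul_zero]
  -- All Fourier coefficients vanish, hence are summable, so the series converges pointwise to the
  -- continuous function on the circle.
  have hsum := has_pointwise_sum_fourier_series_of_summable (f := F)
    ((summable_zero (α := ℂ)).congr fun k => (hcoef k).symm) (0 : AddCircle δ)
  simp only [hcoef, zero_smul] at hsum
  have h0 : F (0 : AddCircle δ) = 0 := hsum.unique hasSum_zero
  have h1 : F ((0 : ℝ) : AddCircle δ) = f 0 :=
    by
    rw [hF]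
    exact AddCircle.liftIco_zero_coe_apply (f := f) ⟨le_rfl, hδ⟩
  rw [AddCircle.coe_zero, h0] at h1
  simpa [hf] using h1.symm

end Liouville

/-! ### Uniqueness of the Lax expansion -/

section LaxUniqueness

open PowerSeries

variable {δ : ℝ}

/-- Two strip functions without jumps across the lines of the cylinder that tend to zero vanish on
these lines. -/
theorem eq_zero_of_no_jumps (hδ : 0 < δ) {F G : ℂ → ℂ} (hF : IsStripFunction δ F 0)
    (hG : IsStripFunction δ G 0) (h₁ : ∀ x : ℝ, G (x + δ * Complex.I) = F x)
    (h₂ : ∀ x : ℝ, F (x + δ * Complex.I) = G x) (x : ℝ) : F x = 0 ∧ G x = 0 := by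
  have hs : IsStripFunction δ (fun z => F z + G z) 0 := by
    have h := hF.add hG
    rwa [add_zero] at h
  have hd : IsStripFunction δ (fun z => F z - G z) 0 := by
    have h := hF.sub hG
    rwa [sub_zero] at h
  -- A shift by iδ exchanges F and G, so F + G is periodic while F - G changes sign; its square is
  -- periodic.
  have hd2 : IsStripFunction δ (fun z => (F z - G z) * (F z - G z)) 0 := by
    have h := hd.mul hd
    rwa [mul_zero] at h
  have a := hs.eq_zero_of_periodic hδ (fun x => by simp only [h₁, h₂]; ring) x
  have b := mul_self_eq_zero.1 (hd2.eq_zero_of_periodic hδ (fun x => by simp only [h₁, h₂]; ring) x)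
  exact ⟨by linear_combination (a + b) / 2, by linear_combination (a - b) / 2⟩

theorem IsFormalEigenfunction.coeff_relations {u v : 𝓢(ℝ, ℂ)} {M₁ M₂ : ℕ → ℂ → ℂ}
    (h : IsFormalEigenfunction δ u v M₁ M₂) (x : ℝ) :
    (M₂ 0 (x + δ * Complex.I) = M₁ 0 x ∧ M₁ 0 (x + δ * Complex.I) = M₂ 0 x) ∧
    ∀ n, M₁ (n + 1) x = M₂ (n + 1) (x + δ * Complex.I)
        + Complex.I * deriv (fun y : ℝ => M₂ n (y + δ * Complex.I)) x
        - u x * M₂ n (x + δ * Complex.I) ∧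
      M₁ (n + 1) (x + δ * Complex.I) = M₂ (n + 1) x
        + Complex.I * deriv (fun y : ℝ => M₂ n y) x + v x * M₂ n x := by
  refine ⟨⟨?_, ?_⟩, fun n => ⟨?_, ?_⟩⟩
  · have e := congrArg (coeff 0) (h.eq_u x)
    simp only [map_add, map_sub, coeff_zero_X_mul, coeff_ser, zero_add] at e
    exact sub_eq_zero.1 e
  · have e := congrArg (coeff 0) (h.eq_v x)
    simp only [map_add, map_sub, map_neg, coeff_zero_X_mul, coeff_ser, zero_add, neg_zero] at e
    exact (sub_eq_zero.1 e).symm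
  · have e := congrArg (coeff (n + 1)) (h.eq_u x)
    simp only [map_add, map_sub, coeff_succ_X_mul, coeff_C_mul, coeff_ser] at e
    linear_combination -e
  · have e := congrArg (coeff (n + 1)) (h.eq_v x)
    simp only [map_add, map_sub, map_neg, coeff_succ_X_mul, coeff_C_mul, coeff_ser] at e
    linear_combination -e

/-- The boundary values of the formal eigenfunctions are unique. -/
theorem IsFormalEigenfunction.unique (hδ : 0 < δ) {u v : 𝓢(ℝ, ℂ)} {M₁ M₂ N₁ N₂ : ℕ → ℂ → ℂ}
    (hM : IsFormalEigenfunction δ u v M₁ M₂) (hN : IsFormalEigenfunction δ u v N₁ N₂) (n : ℕ) :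
    (∀ x : ℝ, M₁ n x = N₁ n x ∧ M₂ n x = N₂ n x) ∧
    ∀ x : ℝ, M₁ n (x + δ * Complex.I) = N₁ n (x + δ * Complex.I) ∧
      M₂ n (x + δ * Complex.I) = N₂ n (x + δ * Complex.I) := by
  have key : ∀ n, (∀ x : ℝ, M₂ n (x + δ * Complex.I) - N₂ n (x + δ * Complex.I)
      = M₁ n x - N₁ n x) → (∀ x : ℝ, M₁ n (x + δ * Complex.I) - N₁ n (x + δ * Complex.I)
      = M₂ n x - N₂ n x) → (∀ x : ℝ, M₁ n x = N₁ n x ∧ M₂ n x = N₂ n x) ∧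
    ∀ x : ℝ, M₁ n (x + δ * Complex.I) = N₁ n (x + δ * Complex.I) ∧
      M₂ n (x + δ * Complex.I) = N₂ n (x + δ * Complex.I) := by
    intro n e₁ e₂
    have d₁ := (hM.strip₁ n).sub (hN.strip₁ n)
    have d₂ := (hM.strip₂ n).sub (hN.strip₂ n)
    rw [sub_self] at d₁ d₂
    have h0 := eq_zero_of_no_jumps hδ d₁ d₂ e₁ e₂
    refine ⟨fun x => ⟨sub_eq_zero.1 (h0 x).1, sub_eq_zero.1 (h0 x).2⟩, fun x => ⟨?_, ?_⟩⟩
    · exact sub_eq_zero.1 ((e₂ x).trans (h0 x).2)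
    · exact sub_eq_zero.1 ((e₁ x).trans (h0 x).1)
  induction n with
  | zero =>
    refine key 0 (fun x => ?_) (fun x => ?_)
    · rw [(hM.coeff_relations x).1.1, (hN.coeff_relations x).1.1]
    · rw [(hM.coeff_relations x).1.2, (hN.coeff_relations x).1.2]
  | succ n ih =>
    -- Equal boundary values have equal tangential derivatives, so the two families have the same
    -- jumps at order n + 1.
    have hb : (fun y : ℝ => M₂ n y) = fun y : ℝ => N₂ n y := funext fun y => (ih.1 y).2
    have ht : (fun y : ℝ => M₂ n (y + δ * Complex.I)) = fun y : ℝ => N₂ n (y + δ * Complex.I) :=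
      funext fun y => (ih.2 y).2
    refine key (n + 1) (fun x => ?_) (fun x => ?_)
    · rw [((hM.coeff_relations x).2 n).1, ((hN.coeff_relations x).2 n).1, ht, (ih.2 x).2]
      ring
    · rw [((hM.coeff_relations x).2 n).2, ((hN.coeff_relations x).2 n).2, hb, (ih.1 x).2]
      ring

theorem IsFormalLogRatio.unique {σ τ F G : PowerSeries ℂ} (hσ : IsFormalLogRatio σ F G)
    (hτ : IsFormalLogRatio τ F G) (hG : G ≠ 0) : σ = τ :=
  fexp_injective hσ.1 hτ.1 (mul_right_cancel₀ hG (hσ.2.trans hτ.2.symm))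

/-- The log ratios involve only boundary values, and these agree with those of the eigenfunctions
constructed from `sol`. The logarithm is unique because the denominators have constant term 1. -/
theorem isLaxExpansion_iff (hδ : 0 < δ) {u v : 𝓢(ℝ, ℂ)} {M₁ M₂ : ℕ → ℂ → ℂ}
    (hM : IsFormalEigenfunction δ u v M₁ M₂) (s₁ s₂ : ℕ → ℝ → ℂ) :
    IsLaxExpansion δ M₁ M₂ s₁ s₂ ↔ ∀ n x, s₁ n x = (sol δ Complex.I u v n).1 x ∧
      s₂ n x = (sol δ Complex.I u v n).2 x := by
  obtain ⟨N₁, N₂, hN, hL, h1⟩ := exists_isFormalEigenfunction hδ u v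
  have hu := hM.unique hδ hN
  have hL' : IsLaxExpansion δ M₁ M₂ (fun n x => (sol δ Complex.I u v n).1 x)
      (fun n x => (sol δ Complex.I u v n).2 x) := by
    intro x
    have h := hL x
    simp only [fun n => ((hu n).1 x).1, fun n => ((hu n).1 x).2, fun n => ((hu n).2 x).1,
      fun n => ((hu n).2 x).2]
    exact h
  constructor
  · intro h
    have hne : ∀ f : ℕ → ℂ, f 0 = 1 → ser f ≠ 0 := fun f hf h0 => by
      have := congrArg (coeff 0) h0
      rw [coeff_ser, hf, map_zero] at this
      exact one_ne_zero this
    intro n x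
    have e₁ := (h x).1.unique (hL' x).1 (hne _ (by rw [((hu 0).1 x).1, (h1 x).1]))
    have e₂ := (h x).2.unique (hL' x).2 (hne _ (by rw [((hu 0).1 x).2, (h1 x).2]))
    have f₁ := congrArg (coeff n) e₁
    have f₂ := congrArg (coeff n) e₂
    rw [coeff_ser, coeff_ser] at f₁ f₂
    exact ⟨f₁, f₂⟩
  · intro h
    have e₁ : s₁ = fun n x => (sol δ Complex.I u v n).1 x := by
      funext n x; exact (h n x).1
    have e₂ : s₂ = fun n x => (sol δ Complex.I u v n).2 x := by
      funext n x; exact (h n x).2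
    rw [e₁, e₂]
    exact hL'

end LaxUniqueness

end NcILW

end

/-! ### Assembly of the theorem -/

theorem mainTheorem5 (δ : ℝ) (hδ : 0 < δ) :
    ∃ W Z σ₁ σ₂ : ℕ → 𝓢(ℝ, ℂ) → 𝓢(ℝ, ℂ) → 𝓢(ℝ, ℂ),
      -- the formal relations have exactly one solution, given by `W` and `Z`
      (∀ (u v : 𝓢(ℝ, ℂ)) (w z : ℕ → 𝓢(ℝ, ℂ)),
        IsBacklundExpansion δ u v w z ↔ ∀ n, w n = W n u v ∧ z n = Z n u v) ∧
      -- the coefficients are computed recursively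
      (∀ u v : 𝓢(ℝ, ℂ), W 1 u v = u ∧ Z 1 u v = v) ∧
      (∀ (u v : 𝓢(ℝ, ℂ)) (n : ℕ), 1 ≤ n → ∀ x : ℝ,
        W (n + 1) u v x
          = PowerSeries.coeff (n + 1) (fexp (-ser fun m => if m ≤ n then W m u v x else 0))
            + Complex.I * Pminus δ (deriv (W n u v)) x + 1 / 2 * Tt δ (deriv (Z n u v)) x ∧
        Z (n + 1) u v x
          = -PowerSeries.coeff (n + 1) (fexp (ser fun m => if m ≤ n then Z m u v x else 0))
            - Complex.I * Pplus δ (deriv (Z n u v)) x - 1 / 2 * Tt δ (deriv (W n u v)) x) ∧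
      -- all the quantities `I n` are conserved, and so are the integrals of `u` and of `v`
      (∀ (J : Set ℝ) (u v : ℝ → 𝓢(ℝ, ℂ)), J.OrdConnected → IsSolution δ J u v →
        ∀ s ∈ J, ∀ t ∈ J,
          (∀ n, 1 ≤ n → ∫ x, (W n (u s) (v s) x + Z n (u s) (v s) x)
            = ∫ x, (W n (u t) (v t) x + Z n (u t) (v t) x)) ∧
          ∫ x, u s x = ∫ x, u t x ∧
          ∫ x, v s x = ∫ x, v t x) ∧
      -- there are infinitely many of them
      LinearIndependent ℂ (fun (n : ℕ) (p : 𝓢(ℝ, ℂ) × 𝓢(ℝ, ℂ)) =>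
        ∫ x, (W (n + 1) p.1 p.2 x + Z (n + 1) p.1 p.2 x)) ∧
      -- the first ones are explicit
      (∀ u v : 𝓢(ℝ, ℂ),
        ∫ x, (W 1 u v x + Z 1 u v x) = (∫ x, u x) + ∫ x, v x ∧
        ∫ x, (W 2 u v x + Z 2 u v x) = 1 / 2 * ∫ x, (u x ^ 2 - v x ^ 2) ∧
        MeasureTheory.Integrable (density₃ δ u v) ∧
        ∫ x, (W 3 u v x + Z 3 u v x) = ∫ x, density₃ δ u v x ∧
        MeasureTheory.Integrable (density₄ δ u v) ∧
        ∫ x, (W 4 u v x + Z 4 u v x) = ∫ x, density₄ δ u v x) ∧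
      -- the Lax pair has formal eigenfunctions, whose logarithmic ratios are `σ₁` and `σ₂`
      (∀ u v : 𝓢(ℝ, ℂ), ∃ M₁ M₂ : ℕ → ℂ → ℂ, IsFormalEigenfunction δ u v M₁ M₂) ∧
      (∀ (u v : 𝓢(ℝ, ℂ)) (M₁ M₂ : ℕ → ℂ → ℂ), IsFormalEigenfunction δ u v M₁ M₂ →
        ∀ s₁ s₂ : ℕ → ℝ → ℂ, IsLaxExpansion δ M₁ M₂ s₁ s₂ ↔
          ∀ n x, s₁ n x = σ₁ n u v x ∧ s₂ n x = σ₂ n u v x) ∧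
      -- they give conserved quantities, the same as before up to complex conjugation
      (∀ (J : Set ℝ) (u v : ℝ → 𝓢(ℝ, ℂ)), J.OrdConnected → IsSolution δ J u v →
        ∀ s ∈ J, ∀ t ∈ J, ∀ n, 1 ≤ n →
          ∫ x, (σ₁ n (u s) (v s) x + σ₂ n (u s) (v s) x)
            = ∫ x, (σ₁ n (u t) (v t) x + σ₂ n (u t) (v t) x)) ∧
      (∀ (u v : 𝓢(ℝ, ℂ)) (n : ℕ),
        σ₁ n u v = conjS (W n (conjS u) (conjS v)) ∧
        σ₂ n u v = conjS (Z n (conjS u) (conjS v)) ∧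
        ∫ x, (σ₁ n u v x + σ₂ n u v x)
          = (starRingEnd ℂ) (∫ x, (W n (conjS u) (conjS v) x + Z n (conjS u) (conjS v) x))) := by
  have hI : -Complex.I * -Complex.I = -1 := by rw [neg_mul_neg, Complex.I_mul_I]
  -- W and Z are the solution for `ι = -i`, σ₁ and σ₂ the one for `ι = i`.
  refine ⟨fun n u v => (sol δ (-Complex.I) u v n).1, fun n u v => (sol δ (-Complex.I) u v n).2,
    fun n u v => (sol δ Complex.I u v n).1, fun n u v => (sol δ Complex.I u v n).2,
    fun u v w z => ?_, fun u v => ?_, fun u v n hn x => sol_recursion hδ u v hn x,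
    fun J u v hJ h s hs t ht => ⟨fun n _ => h.integral_sol_neg_eq hδ hJ hs ht n,
      h.integral_u_eq hδ hJ hs ht, h.integral_v_eq hδ hJ hs ht⟩,
    linearIndependent_integral_sol δ (-Complex.I), fun u v => ⟨?_, integral_sol_two hδ _ u v,
      (integral_sol_three hδ (-Complex.I) u v).1, (integral_sol_three hδ _ u v).2,
      (integral_sol_four hδ hI u v).1, (integral_sol_four hδ hI u v).2⟩,
    fun u v => ?_, fun u v M₁ M₂ hM s₁ s₂ => isLaxExpansion_iff hδ hM s₁ s₂,
    fun J u v hJ h s hs t ht n _ => h.integral_sol_eq hδ hJ hs ht n,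
    fun u v n => ⟨?_, ?_, integral_sol_conj hδ u v n⟩⟩
  · rw [isBacklundExpansion_iff hδ, isSol_iff]
    simp only [Prod.ext_iff]
  · simp only [sol_one, and_self]
  · simp only [sol_one]
    exact MeasureTheory.integral_add u.integrable v.integrable
  · obtain ⟨M₁, M₂, hM, -⟩ := exists_isFormalEigenfunction hδ u v
    exact ⟨M₁, M₂, hM⟩
  · exact congrArg Prod.fst (sol_conj hδ u v n)
  · exact congrArg Prod.snd (sol_conj hδ u v n)
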